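/- All manifolds are smooth, Hausdorff and $\sigma$-compact. A graded super bundle of degree $2$ is a supermanifold $F_2$ with an atlas of coordinates of weights $0,1,2$ and definite Grassmann parity, whose coordinate changes preserve weight and parity and are polynomial in the coordinates of positive weight; $\mathcal A^k$ denotes its functions of weight $k$ and $\widetilde a$ the parity of $a$. A pre-Courant algebroid (in the category of supermanifolds) is a graded super bundle $F_2$ of degree $2$ over a supermanifold $M$, with a nondegenerate even Poisson bracket $\{\cdot,\cdot\}$ of weight $-2$ and an odd function $\Theta\in\mathcal A^3(F_2)$ such that $\{\{\Theta,\Theta\},f\}=0$ for all $f\in\mathcal A^0(F_2)=C^\infty(M)$. Put $Q_\Theta=\{\Theta,\cdot\}$, and for $\sigma,\psi\in\mathcal A^1(F_2)$ and $f\in C^\infty(M)$ put $$[\![\sigma,\psi]\!]_\Theta=(-1)^{\widetilde\sigma}\{\{\Theta,\sigma\},\psi\},\qquad \rho_\Theta(\sigma)f=(-1)^{\widetilde\sigma}\{\{\Theta,\sigma\},f\}.$$ A sub-Dirac structure is a graded subbundle $\mathcal D\hookrightarrow F_2$, over an embedded sub-supermanifold $M_0\subset M$, which is isotropic and to which $Q_\Theta$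 is tangent. Let $L\to M_0$ be the vector bundle such that $\mathcal A^1(\mathcal D)$ is the module of fibrewise linear functions on the parity shift $\Pi L$; that is, sections of $L$ of parity $p$ are the $C^\infty(M_0)$-linear functionals $\mathcal A^1(\mathcal D)\to C^\infty(M_0)$ of parity $p+1$. A function $\sigma\in\mathcal A^1(F_2)$ such that $\{\sigma,\cdot\}$ is tangent to $\mathcal D$ acts in this way on $\mathcal A^1(\mathcal D)$ and so defines a section $\sigma_{\mathcal D}$ of $L$. Then every section of $L$ is locally of the form $\sigma_{\mathcal D}$, and $L$ carries a structure of an almost Lie algebroid over $M_0$ (an anchor $\rho:L\to TM_0$ and a graded skew-symmetric $\mathbb R$-bilinear bracket on sections with $[u,fv]=\rho(u)(f)\,v+(-1)^{\widetilde f\,\widetilde u}f[u,v]$ and $\rho([u,v])=[\rho(u),\rho(v)]$) induced from the pre-Courant algebroid: locally $$\rho(\sigma_{\mathcal D})(f|_{\mathcal D})=(\rho_\Theta(\sigma)f)|_{\mathcal D},\qquad [\sigma_{\mathcal D},\psi_{\mathcal D}]=\big([\![\sigma,\psi]\!]_\Theta+\{\Theta,f\}\big)_{\mathcal D}$$ for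 all such homogeneous $\sigma,\psi$, where $f$ is a locally defined function on $M$ (depending on $\sigma,\psi$) with $f|_{M_0}=0$ and $\{f,\cdot\}$ tangent to $\mathcal D$. In particular $[\sigma_{\mathcal D},\psi_{\mathcal D}]=([\![\sigma,\psi]\!]_\Theta)_{\mathcal D}$ if $M_0=M$. The bracket need not satisfy the Jacobi identity: there are a pre-Courant algebroid over a point and a sub-Dirac structure of it for which no almost Lie bracket on $L$ induced in this sense satisfies it. -/

import Mathlib

open TopologicalSpace
open scoped Manifold ContDiff

universe u v w

/-- The sign `(-1)^p`, for a Grassmann parity `p`. -/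
noncomputable def sgn (p : ZMod 2) : ℝ := if p = 0 then 1 else -1

/-- A presheaf of bigraded (weight in `ℕ`, Grassmann parity in `ZMod 2`) real algebras which are
supercommutative with respect to the parity, and whose bihomogeneous components are sheaves. -/
structure BigradedSheaf (X : Type u) [TopologicalSpace X] where
  A : Opens X → Type v
  [ring : ∀ U, Ring (A U)]
  [algebra : ∀ U, Algebra ℝ (A U)]
  /-- `gr U (w, p)` are the functions over `U` of weight `w` and parity `p`. -/
  gr : ∀ U, ℕ × ZMod 2 → Submodule ℝ (A U)
  one_mem : ∀ U, (1 : A U) ∈ gr U (0, 0)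
  mul_mem : ∀ {U} {i j : ℕ × ZMod 2} {a b : A U},
    a ∈ gr U i → b ∈ gr U j → a * b ∈ gr U (i + j)
  internal : ∀ U, DirectSum.IsInternal (gr U)
  supercomm : ∀ {U} {i j : ℕ × ZMod 2} {a b : A U},
    a ∈ gr U i → b ∈ gr U j → a * b = sgn (i.2 * j.2) • (b * a)
  res : ∀ {U V : Opens X}, V ≤ U → (A U →ₐ[ℝ] A V)
  res_mem : ∀ {U V : Opens X} (h : V ≤ U) {i : ℕ × ZMod 2} {a : A U},
    a ∈ gr U i → res h a ∈ gr V i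
  res_id : ∀ {U : Opens X} (a : A U), res le_rfl a = a
  res_res : ∀ {U V W : Opens X} (h : V ≤ U) (h' : W ≤ V) (a : A U),
    res h' (res h a) = res (h'.trans h) a
  gluing : ∀ {ι : Type u} (U : ι → Opens X) (i : ℕ × ZMod 2) (s : ∀ k, A (U k)),
    (∀ k, s k ∈ gr (U k) i) →
    (∀ k l, res (inf_le_left : U k ⊓ U l ≤ U k) (s k)
      = res (inf_le_right : U k ⊓ U l ≤ U l) (s l)) →
    ∃! t : A (iSup U), t ∈ gr (iSup U) i ∧ ∀ k, res (le_iSup U k) t = s k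

attribute [instance] BigradedSheaf.ring BigradedSheaf.algebra

namespace BigradedSheaf

section
variable {X : Type u} [TopologicalSpace X] (F : BigradedSheaf.{u, v} X)

/-- Functions of weight `k` (of any parity): `𝒜ᵏ(U)`. -/
def weightPart (U : Opens X) (k : ℕ) : Submodule ℝ (F.A U) := F.gr U (k, 0) ⊔ F.gr U (k, 1)

theorem weightPart_mul_mem {U : Opens X} {k l : ℕ} {a b : F.A U}
    (ha : a ∈ F.weightPart U k) (hb : b ∈ F.weightPart U l) :
    a * b ∈ F.weightPart U (k + l) := by
  obtain ⟨a₀, ha₀, a₁, ha₁, rfl⟩ := Submodule.mem_sup.1 ha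
  obtain ⟨b₀, hb₀, b₁, hb₁, rfl⟩ := Submodule.mem_sup.1 hb
  have e : (1 : ZMod 2) + 1 = 0 := by decide
  have h00 := F.mul_mem ha₀ hb₀
  have h01 := F.mul_mem ha₀ hb₁
  have h10 := F.mul_mem ha₁ hb₀
  have h11 := F.mul_mem ha₁ hb₁
  simp only [Prod.mk_add_mk, zero_add, add_zero, e] at h00 h01 h10 h11
  rw [add_mul, mul_add, mul_add]
  exact add_mem (add_mem (Submodule.mem_sup_left h00) (Submodule.mem_sup_right h01))
    (add_mem (Submodule.mem_sup_right h10) (Submodule.mem_sup_left h11))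

theorem res_weightPart {U V : Opens X} (h : V ≤ U) {k : ℕ} {a : F.A U}
    (ha : a ∈ F.weightPart U k) : F.res h a ∈ F.weightPart V k := by
  obtain ⟨a₀, ha₀, a₁, ha₁, rfl⟩ := Submodule.mem_sup.1 ha
  rw [map_add]
  exact add_mem (Submodule.mem_sup_left (F.res_mem h ha₀))
    (Submodule.mem_sup_right (F.res_mem h ha₁))

/-- The functions of weight zero, i.e. the functions on the base supermanifold `h₀(F)`. -/
def base (U : Opens X) : Subalgebra ℝ (F.A U) where
  carrier := F.weightPart U 0
  mul_mem' {a b} ha hb := by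
    have h : a * b ∈ F.weightPart U (0 + 0) := F.weightPart_mul_mem ha hb
    rwa [Nat.add_zero] at h
  add_mem' ha hb := add_mem ha hb
  algebraMap_mem' r := by
    rw [Algebra.algebraMap_eq_smul_one]
    exact Submodule.smul_mem _ r (Submodule.mem_sup_left (F.one_mem U))

/-- Restriction of functions on the base. -/
def baseRes {U V : Opens X} (h : V ≤ U) (f : F.base U) : F.base V :=
  ⟨F.res h f.1, F.res_weightPart h f.2⟩

/-- A (homogeneous, of parity `q`) vector field over `U`: a superderivation of the sheaf of
functions over `U`. -/
structure VectorField (U : Opens X) (q : ZMod 2) where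
  app : ∀ V, V ≤ U → (F.A V →ₗ[ℝ] F.A V)
  app_res : ∀ {V W : Opens X} (hV : V ≤ U) (h : W ≤ V) (a : F.A V),
    app W (h.trans hV) (F.res h a) = F.res h (app V hV a)
  app_parity : ∀ {V} (hV : V ≤ U) {i : ℕ × ZMod 2} {a : F.A V}, a ∈ F.gr V i →
    app V hV a ∈ ⨆ k : ℕ, F.gr V (k, q + i.2)
  leibniz : ∀ {V} (hV : V ≤ U) {i : ℕ × ZMod 2} {a : F.A V} (b : F.A V), a ∈ F.gr V i →
    app V hV (a * b) = app V hV a * b + sgn (q * i.2) • (a * app V hV b)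

end

section
variable (n : ℕ) {X : Type u} [TopologicalSpace X] [ChartedSpace (EuclideanSpace ℝ (Fin n)) X]

/-- A homogeneous local coordinate system of degree `k`, over an open subset `dom` of the domain
of a chart `φ` of the body `X`: an isomorphism of the sheaf over `dom` with the
sheaf of polynomials, with coefficients in the smooth functions of the `n` even coordinates of
weight zero, in `r` further coordinates `gen j`. The coordinate `gen j` has weight `wt j ≤ k` and
parity `par j`; it is odd if its weight is zero. Odd coordinates occur
at most once in a monomial. -/
structure Chart (F : BigradedSheaf.{u, v} X) (k : ℕ) where
  dom : Opens X
  φ : OpenPartialHomeomorph X (EuclideanSpace ℝ (Fin n))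
  φ_mem : φ ∈ IsManifold.maximalAtlas (𝓡 n) ∞ X
  dom_le : (dom : Set X) ⊆ φ.source
  /-- The coordinates of `φ` as smooth functions on `dom`. -/
  coord : Fin n → C^∞⟮𝓡 n, dom; 𝓘(ℝ, ℝ), ℝ⟯
  coord_eq : ∀ a (y : dom), coord a y = φ (y : X) a
  /-- The embedding of smooth functions of the even weight zero coordinates. -/
  emb : ∀ V : Opens X, V ≤ dom → (C^∞⟮𝓡 n, V; 𝓘(ℝ, ℝ), ℝ⟯ →ₐ[ℝ] F.A V)
  emb_mem : ∀ V hV f, emb V hV f ∈ F.gr V (0, 0)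
  emb_res : ∀ (V W : Opens X) (hV : V ≤ dom) (h : W ≤ V) (f : C^∞⟮𝓡 n, V; 𝓘(ℝ, ℝ), ℝ⟯),
    F.res h (emb V hV f)
      = emb W (h.trans hV) (ContMDiffMap.restrictRingHom (𝓡 n) 𝓘(ℝ, ℝ) ℝ h f)
  r : ℕ
  wt : Fin r → ℕ
  par : Fin r → ZMod 2
  wt_le : ∀ j, wt j ≤ k
  odd_of_wt_zero : ∀ j, wt j = 0 → par j = 1
  gen : Fin r → F.A dom
  gen_mem : ∀ j, gen j ∈ F.gr dom (wt j, par j)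
  expand : ∀ (V : Opens X) (hV : V ≤ dom) (a : F.A V),
    ∃! c : {m : Fin r → ℕ // ∀ j, par j = 1 → m j ≤ 1} →₀ C^∞⟮𝓡 n, V; 𝓘(ℝ, ℝ), ℝ⟯,
      a = c.sum fun m f => emb V hV f * (List.ofFn fun j => F.res hV (gen j) ^ m.1 j).prod

variable {n} in
/-- All coordinates of a local coordinate system: the `n` even ones of weight zero, and the
others. -/
noncomputable def Chart.z {F : BigradedSheaf.{u, v} X} {k : ℕ} (c : Chart n F k) : Fin n ⊕ Fin c.r → F.A c.dom :=
  Sum.elim (fun a => c.emb c.dom le_rfl (c.coord a)) c.gen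

end

end BigradedSheaf

/-- A graded super bundle of degree `k` whose body (the reduced base) is the manifold `X`, given
by its sheaf of polynomial functions. -/
structure GradedSuperBundle (n : ℕ) (X : Type u) [TopologicalSpace X]
    [ChartedSpace (EuclideanSpace ℝ (Fin n)) X] (k : ℕ) extends BigradedSheaf.{u, v} X where
  exists_chart : ∀ y : X, ∃ c : BigradedSheaf.Chart n toBigradedSheaf k, y ∈ c.dom

/-- A nondegenerate (even) Poisson bracket of weight `-2`. -/
structure PoissonBracket {n : ℕ} {X : Type u} [TopologicalSpace X]
    [ChartedSpace (EuclideanSpace ℝ (Fin n)) X] (F : GradedSuperBundle.{u, v} n X 2) where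
  br : ∀ U, F.A U →ₗ[ℝ] F.A U →ₗ[ℝ] F.A U
  br_res : ∀ {U V : Opens X} (h : V ≤ U) (a b : F.A U),
    F.res h (br U a b) = br V (F.res h a) (F.res h b)
  br_mem : ∀ {U} {k l m : ℕ} {p q : ZMod 2} {a b : F.A U}, a ∈ F.gr U (k, p) → b ∈ F.gr U (l, q) →
    m + 2 = k + l → br U a b ∈ F.gr U (m, p + q)
  br_eq_zero : ∀ {U} {k l : ℕ} {p q : ZMod 2} {a b : F.A U}, a ∈ F.gr U (k, p) →
    b ∈ F.gr U (l, q) → k + l < 2 → br U a b = 0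
  skew : ∀ {U} {i j : ℕ × ZMod 2} {a b : F.A U}, a ∈ F.gr U i → b ∈ F.gr U j →
    br U a b = -(sgn (i.2 * j.2) • br U b a)
  leibniz : ∀ {U} {i j : ℕ × ZMod 2} {a b : F.A U} (c : F.A U), a ∈ F.gr U i → b ∈ F.gr U j →
    br U a (b * c) = br U a b * c + sgn (i.2 * j.2) • (b * br U a c)
  jacobi : ∀ {U} {i j : ℕ × ZMod 2} {a b : F.A U} (c : F.A U), a ∈ F.gr U i → b ∈ F.gr U j →
    br U a (br U b c) = br U (br U a b) c + sgn (i.2 * j.2) • br U b (br U a c)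
  nondegenerate : ∀ y : X, ∃ c : BigradedSheaf.Chart n F.toBigradedSheaf 2, y ∈ c.dom ∧
    IsUnit (Matrix.of fun s t => br c.dom (c.z s) (c.z t))

/-- A pre-Courant algebroid in the category of supermanifolds (a symplectic almost Lie
2-algebroid). -/
structure PreCourantAlgebroid (n : ℕ) (X : Type u) [TopologicalSpace X]
    [ChartedSpace (EuclideanSpace ℝ (Fin n)) X] where
  F : GradedSuperBundle.{u, v} n X 2
  P : PoissonBracket F
  Θ : F.A ⊤
  Θ_mem : Θ ∈ F.gr ⊤ (3, 1)
  almost : ∀ (U : Opens X), ∀ f ∈ F.weightPart U 0,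
    P.br U (F.res le_top (P.br ⊤ Θ Θ)) f = 0

namespace PreCourantAlgebroid

variable {n : ℕ} {X : Type u} [TopologicalSpace X] [ChartedSpace (EuclideanSpace ℝ (Fin n)) X]
  (C : PreCourantAlgebroid.{u, v} n X)

/-- The vector field `Q_Θ = {Θ, •}`. -/
def Q (U : Opens X) : C.F.A U →ₗ[ℝ] C.F.A U := C.P.br U (C.F.res le_top C.Θ)

/-- The Courant--Dorfman pre-bracket `(-1)^p {{Θ, σ}, ψ}` of weight one functions, where `p` is the
parity of `σ` as a function. -/
noncomputable def preBracket (U : Opens X) (p : ZMod 2) (σ ψ : C.F.A U) : C.F.A U :=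
  sgn p • C.P.br U (C.Q U σ) ψ

/-- The anchor `ρ_Θ(σ) f = (-1)^p {{Θ, σ}, f}`, where `p` is the parity of `σ` as a function. -/
noncomputable def anchor (U : Opens X) (p : ZMod 2) (σ f : C.F.A U) : C.F.A U :=
  sgn p • C.P.br U (C.Q U σ) f

end PreCourantAlgebroid

/-- A graded subbundle `D` of `F`, with body `Y`: an embedding of graded super bundles, i.e. a
topological embedding `i` of the bodies together with a morphism `pull` (restriction of functions
to `D`) of sheaves of bigraded algebras that is locally surjective. -/
structure GradedSubbundle {n : ℕ} {X : Type u} [TopologicalSpace X]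
    [ChartedSpace (EuclideanSpace ℝ (Fin n)) X] {k : ℕ} (F : GradedSuperBundle.{u, v} n X k)
    (m : ℕ) (Y : Type u) [TopologicalSpace Y] [ChartedSpace (EuclideanSpace ℝ (Fin m)) Y] where
  D : GradedSuperBundle.{u, v} m Y k
  i : C(Y, X)
  isEmbedding : Topology.IsEmbedding i
  pull : ∀ U : Opens X, F.A U →ₐ[ℝ] D.A (Opens.comap i U)
  pull_mem : ∀ {U} {j : ℕ × ZMod 2} {a : F.A U}, a ∈ F.gr U j →
    pull U a ∈ D.gr (Opens.comap i U) j
  pull_res : ∀ {U V : Opens X} (h : V ≤ U) (a : F.A U),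
    pull V (F.res h a) = D.res (Opens.comap_mono i h) (pull U a)
  surj : ∀ (V : Opens Y) (b : D.A V), ∀ y ∈ V, ∃ (W : Opens X) (hW : Opens.comap i W ≤ V)
    (a : F.A W), i y ∈ W ∧ pull W a = D.res hW b

namespace GradedSubbundle

variable {n : ℕ} {X : Type u} [TopologicalSpace X] [ChartedSpace (EuclideanSpace ℝ (Fin n)) X]
  {F : GradedSuperBundle.{u, v} n X 2} {m : ℕ} {Y : Type u} [TopologicalSpace Y]
  [ChartedSpace (EuclideanSpace ℝ (Fin m)) Y]

/-- The Hamiltonian vector field `{a, •}` is tangent to `D`: it preserves the functions vanishing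
on `D`. -/
def HamTangent (S : GradedSubbundle F m Y) (P : PoissonBracket F) {W : Opens X} (a : F.A W) :
    Prop :=
  ∀ (V : Opens X) (h : V ≤ W) (g : F.A V), S.pull V g = 0 → S.pull V (P.br V (F.res h a) g) = 0

/-- `D` is isotropic, `TD ⊆ (TD)^⊥`: the symplectic orthogonal of `TD` is spanned, along `D`, by
the Hamiltonian vector fields `{g, •}` of the functions `g` vanishing on `D`, so this says
that every vector field on `D` is locally, as a vector field along `D`, a combination of those. -/
def IsIsotropic (S : GradedSubbundle F m Y) (P : PoissonBracket F) : Prop :=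
  ∀ (V : Opens Y) (q : ZMod 2) (δ : S.D.VectorField V q), ∀ y ∈ V,
    ∃ (W : Opens X) (hW : Opens.comap S.i W ≤ V) (N : ℕ) (g : Fin N → F.A W)
      (b : Fin N → S.D.A (Opens.comap S.i W)), S.i y ∈ W ∧ (∀ t, S.pull W (g t) = 0) ∧
      ∀ (W' : Opens X) (h : W' ≤ W) (a : F.A W'),
        δ.app (Opens.comap S.i W') ((Opens.comap_mono S.i h).trans hW) (S.pull W' a)
          = ∑ t, S.D.res (Opens.comap_mono S.i h) (b t) *
              S.pull W' (P.br W' (F.res h (g t)) a)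

end GradedSubbundle

/-- A sub-Dirac structure: an isotropic graded subbundle to which `Q_Θ` is tangent. -/
structure SubDirac {n : ℕ} {X : Type u} [TopologicalSpace X]
    [ChartedSpace (EuclideanSpace ℝ (Fin n)) X] (C : PreCourantAlgebroid.{u, v} n X)
    (m : ℕ) (Y : Type u) [TopologicalSpace Y] [ChartedSpace (EuclideanSpace ℝ (Fin m)) Y]
    extends GradedSubbundle C.F m Y where
  isotropic : toGradedSubbundle.IsIsotropic C.P
  tangent : toGradedSubbundle.HamTangent C.P C.Θ

/-- A vector bundle (in the category of supermanifolds) over the base of `B`, given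
by its sheaf of sections, a locally free sheaf of finite rank of supermodules over the functions
on the base. -/
structure SuperVectorBundle {Y : Type u} [TopologicalSpace Y] (B : BigradedSheaf.{u, v} Y) where
  Sec : Opens Y → Type w
  [group : ∀ V, AddCommGroup (Sec V)]
  [realModule : ∀ V, Module ℝ (Sec V)]
  [baseModule : ∀ V, Module (B.base V) (Sec V)]
  [tower : ∀ V, IsScalarTower ℝ (B.base V) (Sec V)]
  /-- The sections of given parity. -/
  par : ∀ V, ZMod 2 → Submodule ℝ (Sec V)
  internal : ∀ V, DirectSum.IsInternal (par V)
  smul_mem : ∀ {V} {p q : ZMod 2} {f : B.base V} {s : Sec V}, (f : B.A V) ∈ B.gr V (0, q) →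
    s ∈ par V p → f • s ∈ par V (q + p)
  res : ∀ {V W : Opens Y}, W ≤ V → (Sec V →ₗ[ℝ] Sec W)
  res_smul : ∀ {V W : Opens Y} (h : W ≤ V) (f : B.base V) (s : Sec V),
    res h (f • s) = B.baseRes h f • res h s
  res_mem : ∀ {V W : Opens Y} (h : W ≤ V) {p : ZMod 2} {s : Sec V}, s ∈ par V p → res h s ∈ par W p
  res_id : ∀ {V : Opens Y} (s : Sec V), res le_rfl s = s
  res_res : ∀ {V W Z : Opens Y} (h : W ≤ V) (h' : Z ≤ W) (s : Sec V),
    res h' (res h s) = res (h'.trans h) s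
  gluing : ∀ {ι : Type u} (V : ι → Opens Y) (s : ∀ k, Sec (V k)),
    (∀ k l, res (inf_le_left : V k ⊓ V l ≤ V k) (s k)
      = res (inf_le_right : V k ⊓ V l ≤ V l) (s l)) →
    ∃! t : Sec (iSup V), ∀ k, res (le_iSup V k) t = s k
  locally_free : ∀ y : Y, ∃ (V : Opens Y) (r : ℕ) (p : Fin r → ZMod 2) (e : Fin r → Sec V),
    y ∈ V ∧ (∀ j, e j ∈ par V (p j)) ∧
    ∀ (W : Opens Y) (h : W ≤ V) (s : Sec W), ∃! c : Fin r → B.base W, s = ∑ j, c j • res h (e j)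

attribute [instance] SuperVectorBundle.group SuperVectorBundle.realModule
  SuperVectorBundle.baseModule SuperVectorBundle.tower

/-- An almost Lie algebroid over the base of `B`. The anchor sends sections to vector fields on the
base. -/
structure AlmostLieAlgebroid {Y : Type u} [TopologicalSpace Y] (B : BigradedSheaf.{u, v} Y)
    extends SuperVectorBundle.{u, v, w} B where
  anchor : ∀ V, Sec V →ₗ[ℝ] B.base V →ₗ[ℝ] B.base V
  anchor_res : ∀ {V W : Opens Y} (h : W ≤ V) (s : Sec V) (f : B.base V),
    B.baseRes h (anchor V s f) = anchor W (res h s) (B.baseRes h f)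
  anchor_mem : ∀ {V} {p q : ZMod 2} {s : Sec V} {f : B.base V}, s ∈ par V p →
    (f : B.A V) ∈ B.gr V (0, q) → (anchor V s f : B.A V) ∈ B.gr V (0, p + q)
  anchor_leibniz : ∀ {V} {p q : ZMod 2} {s : Sec V} {f : B.base V} (g : B.base V), s ∈ par V p →
    (f : B.A V) ∈ B.gr V (0, q) →
    anchor V s (f * g) = anchor V s f * g + sgn (p * q) • (f * anchor V s g)
  anchor_smul : ∀ {V} (f : B.base V) (s : Sec V) (g : B.base V),
    anchor V (f • s) g = f * anchor V s g
  bracket : ∀ V, Sec V →ₗ[ℝ] Sec V →ₗ[ℝ] Sec V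
  bracket_res : ∀ {V W : Opens Y} (h : W ≤ V) (s t : Sec V),
    res h (bracket V s t) = bracket W (res h s) (res h t)
  bracket_mem : ∀ {V} {p q : ZMod 2} {s t : Sec V}, s ∈ par V p → t ∈ par V q →
    bracket V s t ∈ par V (p + q)
  skew : ∀ {V} {p q : ZMod 2} {s t : Sec V}, s ∈ par V p → t ∈ par V q →
    bracket V s t = -(sgn (p * q) • bracket V t s)
  leibniz : ∀ {V} {p q : ZMod 2} {s : Sec V} {f : B.base V} (t : Sec V), s ∈ par V p →
    (f : B.A V) ∈ B.gr V (0, q) →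
    bracket V s (f • t) = anchor V s f • t + sgn (q * p) • (f • bracket V s t)
  anchor_bracket : ∀ {V} {p q : ZMod 2} {s t : Sec V} (f : B.base V), s ∈ par V p → t ∈ par V q →
    anchor V s (anchor V t f) - sgn (p * q) • anchor V t (anchor V s f)
      = anchor V (bracket V s t) f

/-- The (graded) Jacobi identity for the bracket. -/
def AlmostLieAlgebroid.Jacobi {Y : Type u} [TopologicalSpace Y] {B : BigradedSheaf.{u, v} Y}
    (L : AlmostLieAlgebroid.{u, v, w} B) : Prop :=
  ∀ (V : Opens Y) (p q : ZMod 2), ∀ s ∈ L.par V p, ∀ t ∈ L.par V q, ∀ r : L.Sec V,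
    L.bracket V s (L.bracket V t r)
      = L.bracket V (L.bracket V s t) r + sgn (p * q) • L.bracket V t (L.bracket V s r)

/-- An identification of `𝒜¹(B)` with the fibrewise linear functions on the parity shift `ΠL` of a
vector bundle `L` over the base of `B`: a perfect pairing of `Sec L` with `𝒜¹(B)`.
A section of parity `p` is the same as a functional of parity `p + 1`. -/
structure LinearFunctionsPairing {Y : Type u} [TopologicalSpace Y] {B : BigradedSheaf.{u, v} Y}
    (L : SuperVectorBundle.{u, v, w} B) where
  pair : ∀ V, L.Sec V →ₗ[ℝ] B.weightPart V 1 →ₗ[ℝ] B.base V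
  pair_res : ∀ {V W : Opens Y} (h : W ≤ V) (s : L.Sec V) (α : B.weightPart V 1),
    B.baseRes h (pair V s α) = pair W (L.res h s) ⟨B.res h α.1, B.res_weightPart h α.2⟩
  pair_smul : ∀ {V} (f : B.base V) (s : L.Sec V) (α : B.weightPart V 1),
    pair V (f • s) α = f * pair V s α
  pair_mem : ∀ {V} {p q : ZMod 2} {s : L.Sec V} {α : B.weightPart V 1}, s ∈ L.par V p →
    α.1 ∈ B.gr V (1, q) → (pair V s α : B.A V) ∈ B.gr V (0, p + 1 + q)
  pair_linear : ∀ {V} {p q : ZMod 2} {s : L.Sec V} {f : B.base V} (α β : B.weightPart V 1),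
    s ∈ L.par V p → (f : B.A V) ∈ B.gr V (0, q) → β.1 = f.1 * α.1 →
    pair V s β = sgn ((p + 1) * q) • (f * pair V s α)
  perfect : ∀ (V : Opens Y) (p : ZMod 2) (l : B.weightPart V 1 →ₗ[ℝ] B.base V),
    (∀ (q : ZMod 2) (α : B.weightPart V 1), α.1 ∈ B.gr V (1, q) →
      (l α : B.A V) ∈ B.gr V (0, p + 1 + q)) →
    (∀ (q : ZMod 2) (f : B.base V) (α β : B.weightPart V 1), (f : B.A V) ∈ B.gr V (0, q) →
      β.1 = f.1 * α.1 → l β = sgn ((p + 1) * q) • (f * l α)) →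
    ∃! s : L.Sec V, s ∈ L.par V p ∧ pair V s = l

namespace SubDirac

variable {n : ℕ} {X : Type u} [TopologicalSpace X] [ChartedSpace (EuclideanSpace ℝ (Fin n)) X]
  {C : PreCourantAlgebroid.{u, v} n X} {m : ℕ} {Y : Type u} [TopologicalSpace Y]
  [ChartedSpace (EuclideanSpace ℝ (Fin m)) Y]

/-- The section `s` of `L` is the one given by the weight one function `σ` on `F₂`: the Hamiltonian
vector field `{σ, •}` is tangent to `D`, and it acts on `𝒜¹(D)` as pairing with `s`. -/
def Represents (S : SubDirac C m Y) {L : SuperVectorBundle.{u, v, w} S.D.toBigradedSheaf}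
    (e : LinearFunctionsPairing L) {W : Opens X} (σ : C.F.A W) (s : L.Sec (Opens.comap S.i W)) :
    Prop :=
  S.HamTangent C.P σ ∧
  ∀ (V : Opens X) (h : V ≤ W) (a : C.F.A V) (α : S.D.weightPart (Opens.comap S.i V) 1),
    a ∈ C.F.weightPart V 1 → α.1 = S.pull V a →
    (e.pair _ (L.res (Opens.comap_mono S.i h) s) α : S.D.A (Opens.comap S.i V))
      = S.pull V (C.P.br V (C.F.res h σ) a)

/-- `L` is an almost Lie algebroid structure on the vector bundle of the sub-Dirac structure which
is induced by the anchor and the Courant--Dorfman pre-bracket of the pre-Courant algebroid.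
Every section of `L` is locally given by a weight one function on `F₂`; the anchor is induced by
`ρ_Θ`; the bracket is induced by the Courant--Dorfman pre-bracket, up to terms `{Θ, f}` with
`f` a function on the base of `F₂` which vanishes on the base of `D`. -/
structure IsInduced (S : SubDirac C m Y) (L : AlmostLieAlgebroid.{u, v, w} S.D.toBigradedSheaf)
    (e : LinearFunctionsPairing L.toSuperVectorBundle) : Prop where
  exists_rep : ∀ (V : Opens Y) (p : ZMod 2), ∀ s ∈ L.par V (p + 1), ∀ y ∈ V,
    ∃ (W : Opens X) (hW : Opens.comap S.i W ≤ V), S.i y ∈ W ∧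
      ∃ σ ∈ C.F.gr W (1, p), S.Represents e σ (L.res hW s)
  anchor_eq : ∀ (W : Opens X) (p : ZMod 2), ∀ σ ∈ C.F.gr W (1, p),
    ∀ s ∈ L.par (Opens.comap S.i W) (p + 1), S.Represents e σ s →
    ∀ f ∈ C.F.weightPart W 0, ∀ g : S.D.base (Opens.comap S.i W), g.1 = S.pull W f →
      (L.anchor _ s g : S.D.A (Opens.comap S.i W)) = S.pull W (C.anchor W p σ f)
  bracket_eq : ∀ (W : Opens X) (p q : ZMod 2), ∀ σ ∈ C.F.gr W (1, p), ∀ ψ ∈ C.F.gr W (1, q),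
    ∀ s ∈ L.par (Opens.comap S.i W) (p + 1), ∀ t ∈ L.par (Opens.comap S.i W) (q + 1),
    S.Represents e σ s → S.Represents e ψ t → ∀ y : Y, S.i y ∈ W →
      ∃ (V : Opens X) (h : V ≤ W), S.i y ∈ V ∧
        ∃ f ∈ C.F.gr V (0, p + q), S.pull V f = 0 ∧ S.HamTangent C.P f ∧
          S.Represents e (C.F.res h (C.preBracket W p σ ψ) + C.Q V f)
            (L.res (Opens.comap_mono S.i h) (L.bracket _ s t))

end SubDirac

/-!
# The almost Lie algebroid of a sub-Dirac structure

**Sections as functionals.** Sections of the bundle `L` are the functionals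
`BigradedSheaf.Functional` on the functions of weight one on the sub-Dirac structure `D`; they form a
super vector bundle `dualBundle`, which is perfectly paired with these functions by `dualPairing`. Isotropy says that
vector fields on `D` are locally combinations of Hamiltonian vector fields of functions vanishing on
`D`. Applied to the coordinate vector fields of weight `-1` it yields functions of weight one which
vanish on `D`, whose Hamiltonian vector fields are tangent to `D` and which represent the coordinate
functionals (`IsIsotropic.exists_coord_rep`); hence every functional is locally represented.
Conversely, nondegeneracy of the Poisson bracket forces every function of weight one with tangent
Hamiltonian vector field to vanish on `D` (`IsIsotropic.pull_eq_zero`).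

**The bracket.** A functional determines the action of a representing Hamiltonian vector field on
functions of weight one, but not on functions of weight two. A choice of the latter which is linear
over the base, here called a lift, exists near every point (`IsIsotropic.exists_local_lift`), and
local choices are patched with a partition of unity (`exists_lift_of_local`). The vector field `Q`
induced on `D` by `Q_Θ` satisfies `Q (Q f) = 0` for functions `f` on the base. From `Q` and a lift
one derives an almost Lie algebroid (`DerivedData.almostLieAlgebroid`): the anchor of `l` is
`f ↦ -l (Q f)`, and the bracket is half the
skew-symmetrization of the derived bracket of the lifts
with `Q`. The factor `1 / 2` makes the bracket of two functionals linear over the base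
(`bracketOp_mul`), and that `Q` squares to zero on the base makes the anchor a morphism of brackets.

**Comparison with the pre-Courant bracket.** Let `σ`, `ψ` represent two sections and let `σ₀`, `ψ₀`
be representatives which also induce the lifts. The Jacobi identity of the Poisson bracket shows
that the bracket of the sections is represented by `⟦σ, ψ⟧ + {Θ, f}`, where, up to sign,
`f = {ψ, σ - σ₀} + {ψ₀, σ₀} / 2` (`SubDirac.correction`, `bracket_pull`). As `σ - σ₀` and `σ₀` vanish
on `D` and the Hamiltonian vector fields of `ψ`, `ψ₀` are tangent to `D`, the function `f` vanishes
on `D`.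

**Failure of the Jacobi identity.** Over a point, take even coordinates `x`, `y` and odd coordinates
`ξ`, `η` of weight one with `{x, y} = {ξ, η} = 1`, the function `Θ = x² η - x y ξ`, and `D` given by
`y = η = 0`. Over a point the functions `f` above vanish, so that every induced bracket is determined
by the pre-Courant bracket. The odd section `s` given by `-y` has `[s, s]` given by `2η` and
`[s, [s, s]]` given by `2y`, which is not zero, whereas the Jacobi identity and skew symmetry imply
`3 [s, [s, s]] = 0` (`Darboux.not_jacobi`).
-/

/-! ### Signs -/

@[simp] theorem sgn_zero : sgn 0 = 1 := by simp [sgn]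

@[simp] theorem sgn_one : sgn 1 = -1 := by simp [sgn]

theorem ZMod.eq_zero_or_one (p : ZMod 2) : p = 0 ∨ p = 1 := by
  revert p; decide

theorem sgn_add (p q : ZMod 2) : sgn (p + q) = sgn p * sgn q := by
  have e : (1 : ZMod 2) + 1 = 0 := by decide
  rcases p.eq_zero_or_one with rfl | rfl <;> rcases q.eq_zero_or_one with rfl | rfl <;> simp [e]

theorem sgn_mul_self (p : ZMod 2) : sgn p * sgn p = 1 := by
  rcases p.eq_zero_or_one with rfl | rfl <;> simp

theorem sgn_smul_sgn_smul {M : Type*} [AddCommGroup M] [Module ℝ M] (p : ZMod 2) (a : M) :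
    sgn p • sgn p • a = a := by
  rw [smul_smul, sgn_mul_self, one_smul]

theorem ZMod.self_add_self (p : ZMod 2) : p + p = 0 := CharTwo.add_self_eq_zero p

namespace BigradedSheaf

/-! ### Homogeneous components -/

section
variable {X : Type u} [TopologicalSpace X] (F : BigradedSheaf.{u, v} X)

theorem bijective_coeLinearMap (U : Opens X) :
    Function.Bijective (DirectSum.coeLinearMap (F.gr U)) := F.internal U

/-- The isomorphism of the functions with the direct sum of the bihomogeneous components. -/
noncomputable def decomp (U : Opens X) : F.A U ≃ₗ[ℝ] DirectSum _ fun i => F.gr U i :=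
  (LinearEquiv.ofBijective _ (F.bijective_coeLinearMap U)).symm

/-- The projection onto the component of weight `i.1` and parity `i.2`. -/
noncomputable def comp (U : Opens X) (i : ℕ × ZMod 2) : F.A U →ₗ[ℝ] F.A U :=
  (F.gr U i).subtype ∘ₗ DirectSum.component ℝ _ (fun i => F.gr U i) i ∘ₗ
    (F.decomp U).toLinearMap

variable {F} {U : Opens X}

theorem comp_mem (i : ℕ × ZMod 2) (a : F.A U) : F.comp U i a ∈ F.gr U i := by
  simp [comp]

theorem comp_of_mem_aux {i : ℕ × ZMod 2} {a : F.A U} (ha : a ∈ F.gr U i) :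
    F.decomp U a = DirectSum.lof ℝ _ (fun i => F.gr U i) i ⟨a, ha⟩ := by
  rw [decomp, LinearEquiv.symm_apply_eq]
  simp

theorem comp_of_mem {i : ℕ × ZMod 2} {a : F.A U} (ha : a ∈ F.gr U i) : F.comp U i a = a := by
  simp [comp, comp_of_mem_aux ha, DirectSum.component.lof_self]

theorem comp_of_mem_ne {i j : ℕ × ZMod 2} {a : F.A U} (ha : a ∈ F.gr U j) (h : j ≠ i) :
    F.comp U i a = 0 := by
  simp [comp, comp_of_mem_aux ha, DirectSum.component.of, h]

theorem mem_gr_iff {i : ℕ × ZMod 2} {a : F.A U} : a ∈ F.gr U i ↔ F.comp U i a = a :=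
  ⟨comp_of_mem, fun h => h ▸ comp_mem i a⟩

/-- A property of functions which is additive and true for homogeneous functions is true for
all functions. -/
theorem homog_induction {P : F.A U → Prop} (h0 : P 0) (hadd : ∀ a b, P a → P b → P (a + b))
    (hom : ∀ i, ∀ a ∈ F.gr U i, P a) (a : F.A U) : P a := by
  have ha : a ∈ ⨆ i, F.gr U i := by
    rw [(F.internal U).submodule_iSup_eq_top]; trivial
  exact Submodule.iSup_induction (F.gr U) (motive := P) ha hom h0 hadd

theorem exists_sum_comp (a : F.A U) : ∃ s : Finset (ℕ × ZMod 2), a = ∑ i ∈ s, F.comp U i a := by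
  classical
  refine ⟨(F.decomp U a).support, ?_⟩
  have : a = (F.decomp U).symm (F.decomp U a) := by simp
  conv_lhs => rw [this, ← DirectSum.sum_support_of (F.decomp U a)]
  rw [map_sum]
  refine Finset.sum_congr rfl fun i _ => ?_
  exact DirectSum.coeLinearMap_lof (F.gr U) i _

theorem ext_comp {a b : F.A U} (h : ∀ i, F.comp U i a = F.comp U i b) : a = b := by
  obtain ⟨s, hs⟩ := exists_sum_comp (a - b)
  rw [← sub_eq_zero, hs]
  refine Finset.sum_eq_zero fun i _ => ?_
  rw [map_sub, h, sub_self]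

/-- A linear map preserving the bigrading commutes with the projections. -/
theorem comp_map {Y : Type*} [TopologicalSpace Y] {G : BigradedSheaf Y} {V : Opens Y}
    (T : F.A U →ₗ[ℝ] G.A V) (hT : ∀ i, ∀ a ∈ F.gr U i, T a ∈ G.gr V i) (i : ℕ × ZMod 2)
    (a : F.A U) : G.comp V i (T a) = T (F.comp U i a) := by
  induction a using homog_induction with
  | h0 => simp
  | hadd a b ha hb => simp [ha, hb]
  | hom j a ha =>
    by_cases h : j = i
    · subst h
      rw [comp_of_mem ha, comp_of_mem (hT _ _ ha)]
    · rw [comp_of_mem_ne ha h, comp_of_mem_ne (hT _ _ ha) h, map_zero]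

theorem comp_res {V : Opens X} (h : V ≤ U) (i : ℕ × ZMod 2) (a : F.A U) :
    F.comp V i (F.res h a) = F.res h (F.comp U i a) :=
  comp_map (F.res h).toLinearMap (fun _ _ ha => F.res_mem h ha) i a

theorem gr_le_weightPart (U : Opens X) (k : ℕ) (p : ZMod 2) :
    F.gr U (k, p) ≤ F.weightPart U k := by
  rcases p.eq_zero_or_one with rfl | rfl
  exacts [le_sup_left, le_sup_right]

variable (F) in
/-- The projection onto the functions of weight `k`. -/
noncomputable def wcomp (U : Opens X) (k : ℕ) : F.A U →ₗ[ℝ] F.A U := F.comp U (k, 0) + F.comp U (k, 1)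

theorem wcomp_mem (k : ℕ) (a : F.A U) : F.wcomp U k a ∈ F.weightPart U k :=
  add_mem (gr_le_weightPart _ _ _ (comp_mem _ _)) (gr_le_weightPart _ _ _ (comp_mem _ _))

theorem wcomp_of_mem_gr {k : ℕ} {p : ZMod 2} {a : F.A U} (ha : a ∈ F.gr U (k, p)) :
    F.wcomp U k a = a := by
  rcases p.eq_zero_or_one with rfl | rfl
  · simp [wcomp, comp_of_mem ha, comp_of_mem_ne ha]
  · simp [wcomp, comp_of_mem ha, comp_of_mem_ne ha]

theorem wcomp_of_mem_gr_ne {k l : ℕ} {p : ZMod 2} {a : F.A U} (ha : a ∈ F.gr U (l, p))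
    (h : l ≠ k) : F.wcomp U k a = 0 := by
  simp [wcomp, comp_of_mem_ne ha, h]

/-- An additive property true for homogeneous functions of weight `k` is true for all functions
of weight `k`. -/
theorem weight_induction {k : ℕ} {P : F.A U → Prop}
    (hadd : ∀ a b, P a → P b → P (a + b))
    (hom : ∀ p, ∀ a ∈ F.gr U (k, p), P a) {a : F.A U} (ha : a ∈ F.weightPart U k) : P a := by
  obtain ⟨a₀, ha₀, a₁, ha₁, rfl⟩ := Submodule.mem_sup.1 ha
  exact hadd _ _ (hom _ _ ha₀) (hom _ _ ha₁)

theorem wcomp_of_mem {k : ℕ} {a : F.A U} (ha : a ∈ F.weightPart U k) : F.wcomp U k a = a := by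
  refine weight_induction (P := fun a => F.wcomp U k a = a) (fun a b ha hb => ?_)
    (fun p a ha => wcomp_of_mem_gr ha) ha
  simp [ha, hb]

theorem wcomp_of_mem_ne {k l : ℕ} {a : F.A U} (ha : a ∈ F.weightPart U l) (h : l ≠ k) :
    F.wcomp U k a = 0 := by
  refine weight_induction (P := fun a => F.wcomp U k a = 0) (fun a b ha hb => ?_)
    (fun p a ha => wcomp_of_mem_gr_ne ha h) ha
  simp [ha, hb]

theorem mem_weightPart_iff {k : ℕ} {a : F.A U} : a ∈ F.weightPart U k ↔ F.wcomp U k a = a :=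
  ⟨wcomp_of_mem, fun h => h ▸ wcomp_mem k a⟩

theorem wcomp_res {V : Opens X} (h : V ≤ U) (k : ℕ) (a : F.A U) :
    F.wcomp V k (F.res h a) = F.res h (F.wcomp U k a) := by
  simp [wcomp, comp_res]

/-! ### Local nature of functions -/

section Local
variable {ι : Type u} {N : ι → Opens X} (hle : ∀ k, N k ≤ U) (hcov : U ≤ iSup N)
include hcov

theorem eq_of_cover_homog {i : ℕ × ZMod 2} {a b : F.A U} (ha : a ∈ F.gr U i) (hb : b ∈ F.gr U i)
    (h : ∀ k, F.res (hle k) a = F.res (hle k) b) : a = b := by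
  have e : iSup N ≤ U := iSup_le hle
  have key := F.gluing N i (fun k => F.res (hle k) a) (fun k => F.res_mem _ ha)
    (fun k l => by rw [F.res_res, F.res_res])
  have hab : F.res e a = F.res e b := key.unique
    ⟨F.res_mem _ ha, fun k => F.res_res _ _ _⟩
    ⟨F.res_mem _ hb, fun k => by rw [F.res_res, h]⟩
  have := congrArg (F.res hcov) hab
  rwa [F.res_res, F.res_res, F.res_id, F.res_id] at this

theorem eq_of_cover {a b : F.A U} (h : ∀ k, F.res (hle k) a = F.res (hle k) b) : a = b :=
  ext_comp fun i => eq_of_cover_homog hle hcov (comp_mem i a) (comp_mem i b) fun k => by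
    rw [← comp_res, ← comp_res, h]

theorem glue_homog {i : ℕ × ZMod 2} (s : ∀ k, F.A (N k)) (hs : ∀ k, s k ∈ F.gr (N k) i)
    (h : ∀ k l, F.res (inf_le_left : N k ⊓ N l ≤ N k) (s k)
      = F.res (inf_le_right : N k ⊓ N l ≤ N l) (s l)) :
    ∃ t ∈ F.gr U i, ∀ k, F.res (hle k) t = s k := by
  obtain ⟨t, ⟨ht, hts⟩, -⟩ := F.gluing N i s hs h
  exact ⟨F.res hcov t, F.res_mem _ ht, fun k => by rw [F.res_res, ← hts k]⟩

theorem glue_weight {k : ℕ} (s : ∀ j, F.A (N j)) (hs : ∀ j, s j ∈ F.weightPart (N j) k)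
    (h : ∀ j l, F.res (inf_le_left : N j ⊓ N l ≤ N j) (s j)
      = F.res (inf_le_right : N j ⊓ N l ≤ N l) (s l)) :
    ∃ t ∈ F.weightPart U k, ∀ j, F.res (hle j) t = s j := by
  have key (p : ZMod 2) := glue_homog (i := (k, p)) hle hcov (fun j => F.comp _ (k, p) (s j))
    (fun j => comp_mem _ _) (fun j l => by rw [← comp_res, ← comp_res, h])
  obtain ⟨t₀, ht₀, h₀⟩ := key 0
  obtain ⟨t₁, ht₁, h₁⟩ := key 1
  refine ⟨t₀ + t₁, add_mem (gr_le_weightPart _ _ _ ht₀) (gr_le_weightPart _ _ _ ht₁),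
    fun j => ?_⟩
  rw [map_add, h₀, h₁]
  exact wcomp_of_mem (hs j)

end Local

theorem eq_of_local {a b : F.A U}
    (h : ∀ y ∈ U, ∃ (N : Opens X) (hN : N ≤ U), y ∈ N ∧ F.res hN a = F.res hN b) : a = b := by
  choose N hN hy hab using h
  refine eq_of_cover (ι := U) (N := fun y => N y.1 y.2) (fun y => hN _ _) (fun y hyU => ?_)
    fun y => hab _ _
  exact Opens.mem_iSup.2 ⟨⟨y, hyU⟩, hy _ _⟩

theorem mem_gr_of_local {i : ℕ × ZMod 2} {a : F.A U}
    (h : ∀ y ∈ U, ∃ (N : Opens X) (hN : N ≤ U), y ∈ N ∧ F.res hN a ∈ F.gr N i) :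
    a ∈ F.gr U i := by
  rw [mem_gr_iff]
  refine eq_of_local fun y hy => ?_
  obtain ⟨N, hN, hyN, ha⟩ := h y hy
  exact ⟨N, hN, hyN, by rw [← comp_res, comp_of_mem ha]⟩

/-- A function of weight `k` which is locally determined by a property stable under restriction
exists as soon as it exists locally. -/
theorem exists_of_local {k : ℕ} (R : ∀ N : Opens X, N ≤ U → F.A N → Prop)
    (hres : ∀ N (hN : N ≤ U) (c : F.A N) N' (h : N' ≤ N), R N hN c →
      R N' (h.trans hN) (F.res h c))
    (huniq : ∀ N (hN : N ≤ U) (c c' : F.A N), R N hN c → R N hN c' → c = c')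
    (hloc : ∀ y ∈ U, ∃ (N : Opens X) (hN : N ≤ U), y ∈ N ∧ ∃ c ∈ F.weightPart N k, R N hN c) :
    ∃ c ∈ F.weightPart U k, ∀ y ∈ U, ∃ (N : Opens X) (hN : N ≤ U), y ∈ N ∧ R N hN (F.res hN c) := by
  choose N hN hy c hc hR using hloc
  obtain ⟨t, ht, hts⟩ := glue_weight (ι := U) (N := fun y => N y.1 y.2) (fun y => hN _ _)
    (fun y hyU => Opens.mem_iSup.2 ⟨⟨y, hyU⟩, hy _ _⟩) (fun y => c y.1 y.2) (fun y => hc _ _)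
    (fun y z => huniq _ (inf_le_left.trans (hN y.1 y.2)) _ _ (hres _ _ _ _ _ (hR _ _))
      (hres _ _ _ _ _ (hR _ _)))
  refine ⟨t, ht, fun y hyU => ⟨N y hyU, hN y hyU, hy y hyU, ?_⟩⟩
  have := hts ⟨y, hyU⟩
  simp only at this
  rw [this]
  exact hR _ _

/-- An additive relation between functions, which determines its second argument and is solvable
for homogeneous first arguments, is the graph of a linear map. -/
theorem exists_linearMap {M : Type*} [AddCommGroup M] [Module ℝ M] (R : F.A U → M → Prop)
    (huniq : ∀ a b b', R a b → R a b' → b = b')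
    (hadd : ∀ a a' b b', R a b → R a' b' → R (a + a') (b + b'))
    (hsmul : ∀ (r : ℝ) a b, R a b → R (r • a) (r • b))
    (hex : ∀ i, ∀ a ∈ F.gr U i, ∃ b, R a b) :
    ∃ T : F.A U →ₗ[ℝ] M, ∀ a, R a (T a) := by
  have h0 : R 0 0 := by
    obtain ⟨b, hb⟩ := hex 0 0 (zero_mem _)
    simpa using hsmul 0 _ _ hb
  have H (a : F.A U) : ∃ b, R a b := by
    induction a using homog_induction with
    | h0 => exact ⟨0, h0⟩
    | hadd a b ha hb =>
      obtain ⟨c, hc⟩ := ha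
      obtain ⟨d, hd⟩ := hb
      exact ⟨c + d, hadd _ _ _ _ hc hd⟩
    | hom i a ha => exact hex i a ha
  choose f hf using H
  exact ⟨{ toFun := f
           map_add' := fun a b => huniq _ _ _ (hf _) (hadd _ _ _ _ (hf a) (hf b))
           map_smul' := fun r a => huniq _ _ _ (hf _) (hsmul _ _ _ (hf a)) }, hf⟩

end

end BigradedSheaf

/-! ### Ordered monomials in supercommuting elements -/

/-- The ordered monomial `x₀ ^ m₀ * x₁ ^ m₁ * ⋯`. -/
def orderedMonomial {r : ℕ} {R : Type*} [Monoid R] (x : Fin r → R) (m : Fin r → ℕ) : R :=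
  (List.ofFn fun j => x j ^ m j).prod

theorem orderedMonomial_succ {r : ℕ} {R : Type*} [Monoid R] (x : Fin (r + 1) → R)
    (m : Fin (r + 1) → ℕ) :
    orderedMonomial x m = x 0 ^ m 0 * orderedMonomial (fun j => x j.succ) (fun j => m j.succ) := by
  simp [orderedMonomial, List.ofFn_succ]

theorem mul_pow_of_supercomm {R : Type*} [Ring R] [Algebra ℝ R] {a b : R} {s : ℝ}
    (h : a * b = s • (b * a)) (k : ℕ) : a * b ^ k = s ^ k • (b ^ k * a) := by
  induction k with
  | zero => simp
  | succ k ih =>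
    rw [pow_succ, ← mul_assoc, ih, smul_mul_assoc, mul_assoc, h, mul_smul_comm, smul_smul,
      ← pow_succ, mul_assoc]

/-- The sign produced by sorting a generator into an ordered monomial depends only on the parities
and not on the ring in which the monomial is formed. -/
theorem exists_mul_orderedMonomial {r : ℕ} (par : Fin r → ZMod 2) (i : Fin r) (m : Fin r → ℕ) :
    ∃ c : ℝ, ∀ (R : Type v) [Ring R] [Algebra ℝ R] (x : Fin r → R),
      (∀ i j, x i * x j = sgn (par i * par j) • (x j * x i)) →
      x i * orderedMonomial x m = c • orderedMonomial x (m + Pi.single i 1) := by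
  induction r with
  | zero => exact i.elim0
  | succ r ih =>
    induction i using Fin.cases with
    | zero =>
      refine ⟨1, fun R _ _ x hx => ?_⟩
      simp [orderedMonomial_succ, pow_succ', mul_assoc]
    | succ i =>
      obtain ⟨c, hc⟩ := ih (fun j => par j.succ) i (fun j => m j.succ)
      refine ⟨sgn (par i.succ * par 0) ^ m 0 * c, fun R _ _ x hx => ?_⟩
      have e : (fun j : Fin r => (m + Pi.single i.succ 1 : Fin (r + 1) → ℕ) j.succ)
          = (fun j => m j.succ) + Pi.single i 1 := by
        ext j; simp [Pi.single_apply]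
      rw [orderedMonomial_succ, orderedMonomial_succ, ← mul_assoc,
        mul_pow_of_supercomm (hx i.succ 0), smul_mul_assoc, mul_assoc,
        hc R (fun j => x j.succ) (fun a b => hx _ _), mul_smul_comm, smul_smul, e]
      simp

theorem orderedMonomial_eq_zero {r : ℕ} {R : Type*} [Ring R] (x : Fin r → R) (m : Fin r → ℕ)
    (i : Fin r) (h : x i ^ m i = 0) : orderedMonomial x m = 0 := by
  refine List.prod_eq_zero ?_
  rw [List.mem_ofFn]
  exact ⟨i, h⟩

theorem sq_eq_zero_of_odd {R : Type*} [Ring R] [Algebra ℝ R] {a : R}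
    (h : a * a = sgn (1 * 1) • (a * a)) : a * a = 0 := by
  rw [mul_one, sgn_one, neg_one_smul] at h
  have : (2 : ℝ) • (a * a) = 0 := by
    rw [two_smul]; nth_rewrite 1 [h]; simp
  exact (smul_eq_zero.1 this).resolve_left two_ne_zero

theorem orderedMonomial_graded {ι : Type*} [AddCommMonoid ι] {r : ℕ} {R : Type*} [Monoid R]
    {P : ι → R → Prop} (one : P 0 1) (mul : ∀ i j a b, P i a → P j b → P (i + j) (a * b))
    {d : Fin r → ι} {x : Fin r → R} (hx : ∀ j, P (d j) (x j)) (m : Fin r → ℕ) :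
    P (∑ j, m j • d j) (orderedMonomial x m) := by
  have hpow (j : Fin r) (k : ℕ) : P (k • d j) (x j ^ k) := by
    induction k with
    | zero => simpa using one
    | succ k ih => rw [succ_nsmul, pow_succ]; exact mul _ _ _ _ ih (hx j)
  induction r with
  | zero => simpa [orderedMonomial] using one
  | succ r ih =>
    rw [Fin.sum_univ_succ, orderedMonomial_succ]
    exact mul _ _ _ _ (hpow 0 _) (ih (fun j => hx _) _ fun j k => hpow _ _)

namespace BigradedSheaf

/-! ### The algebra of functions on a chart -/

theorem even_comm {X : Type u} [TopologicalSpace X] {F : BigradedSheaf.{u, v} X} {U : Opens X}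
    {k : ℕ} {a : F.A U} (ha : a ∈ F.gr U (k, 0)) (b : F.A U) : a * b = b * a := by
  induction b using homog_induction with
  | h0 => simp
  | hadd b c hb hc => rw [mul_add, add_mul, hb, hc]
  | hom i b hb => rw [F.supercomm ha hb]; simp

namespace Chart

variable {n : ℕ} {X : Type u} [TopologicalSpace X] [ChartedSpace (EuclideanSpace ℝ (Fin n)) X]
  {F : BigradedSheaf.{u, v} X} {k : ℕ} (c : Chart n F k) {V : Opens X} (hV : V ≤ c.dom)

/-- The exponents of the monomials in the coordinates: odd coordinates occur at most once. -/
abbrev Exponent : Type := {m : Fin c.r → ℕ // ∀ j, c.par j = 1 → m j ≤ 1}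

/-- The restriction of a coordinate. -/
def genOn (j : Fin c.r) : F.A V := F.res hV (c.gen j)

theorem genOn_mem (j : Fin c.r) : c.genOn hV j ∈ F.gr V (c.wt j, c.par j) :=
  F.res_mem hV (c.gen_mem j)

theorem genOn_supercomm (i j : Fin c.r) :
    c.genOn hV i * c.genOn hV j = sgn (c.par i * c.par j) • (c.genOn hV j * c.genOn hV i) :=
  F.supercomm (c.genOn_mem hV i) (c.genOn_mem hV j)

/-- The linear map to `R` which extends, on formal combinations of monomials, an algebra map `ψ` on
smooth functions by `x` on the generators. -/
noncomputable def combination {R : Type v} [Ring R] [Algebra ℝ R]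
    (ψ : C^∞⟮𝓡 n, V; 𝓘(ℝ, ℝ), ℝ⟯ →ₐ[ℝ] R) (x : Fin c.r → R) :
    (c.Exponent →₀ C^∞⟮𝓡 n, V; 𝓘(ℝ, ℝ), ℝ⟯) →ₗ[ℝ] R :=
  Finsupp.lsum ℝ fun m => LinearMap.mulRight ℝ (orderedMonomial x m.1) ∘ₗ ψ.toLinearMap

theorem combination_bijective :
    Function.Bijective (c.combination (c.emb V hV) (c.genOn hV)) := by
  refine ⟨fun a b hab => (c.expand V hV (c.combination (c.emb V hV) (c.genOn hV) a)).unique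
    ?_ (hab.trans ?_), fun a => ?_⟩
  · rfl
  · rfl
  · obtain ⟨co, h, -⟩ := c.expand V hV a
    exact ⟨co, h.symm⟩

/-- The expansion of functions in monomials. -/
noncomputable def expansion : (c.Exponent →₀ C^∞⟮𝓡 n, V; 𝓘(ℝ, ℝ), ℝ⟯) ≃ₗ[ℝ] F.A V :=
  LinearEquiv.ofBijective _ (c.combination_bijective hV)

theorem expansion_single (m : c.Exponent) (f : C^∞⟮𝓡 n, V; 𝓘(ℝ, ℝ), ℝ⟯) :
    c.expansion hV (Finsupp.single m f) = c.emb V hV f * orderedMonomial (c.genOn hV) m.1 := by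
  simp [expansion, combination]

theorem expand_induction {P : F.A V → Prop} (hadd : ∀ a b, P a → P b → P (a + b))
    (hmono : ∀ f m, P (c.emb V hV f * orderedMonomial (c.genOn hV) m)) (a : F.A V) : P a := by
  obtain ⟨co, rfl⟩ := (c.expansion hV).surjective a
  induction co using Finsupp.induction_linear with
  | zero => simpa using hmono 0 0
  | add f g hf hg => rw [map_add]; exact hadd _ _ hf hg
  | single m f => rw [expansion_single]; exact hmono _ _

/-- Functions on a chart are generated by smooth functions and the coordinates. -/
theorem induction {P : F.A V → Prop} (hadd : ∀ a b, P a → P b → P (a + b))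
    (hmul : ∀ a b, P a → P b → P (a * b)) (hemb : ∀ f, P (c.emb V hV f))
    (hgen : ∀ j, P (c.genOn hV j)) (a : F.A V) : P a := by
  refine c.expand_induction hV hadd (fun f m => hmul _ _ (hemb f) ?_) a
  exact orderedMonomial_graded (ι := Unit) (P := fun _ => P) (d := fun _ => ())
    (by simpa using hemb 1) (fun _ _ => hmul) hgen m

/-- The graded version of the fact that functions on a chart are generated by smooth functions and
the coordinates. -/
theorem graded_induction {P : ℕ × ZMod 2 → F.A V → Prop} (hzero : ∀ i, P i 0)
    (hadd : ∀ i a b, P i a → P i b → P i (a + b))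
    (hmul : ∀ i j a b, a ∈ F.gr V i → b ∈ F.gr V j → P i a → P j b → P (i + j) (a * b))
    (hemb : ∀ f, P (0, 0) (c.emb V hV f))
    (hgen : ∀ j, P (c.wt j, c.par j) (c.genOn hV j)) {i : ℕ × ZMod 2} {a : F.A V}
    (ha : a ∈ F.gr V i) : P i a := by
  suffices h : ∀ i, P i (F.comp V i a) by
    have := h i; rwa [comp_of_mem ha] at this
  clear ha i
  refine c.expand_induction hV (P := fun a => ∀ i, P i (F.comp V i a))
    (fun a b ha hb i => ?_) (fun f m i => ?_) a
  · rw [map_add]; exact hadd _ _ _ (ha i) (hb i)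
  · have key := orderedMonomial_graded (P := fun i a => a ∈ F.gr V i ∧ P i a)
      (d := fun j => (c.wt j, c.par j)) ⟨F.one_mem V, (map_one (c.emb V hV)) ▸ hemb 1⟩
      (fun i j a b ha hb => ⟨F.mul_mem ha.1 hb.1, hmul _ _ _ _ ha.1 hb.1 ha.2 hb.2⟩)
      (fun j => ⟨c.genOn_mem hV j, hgen j⟩) m
    have h1 := F.mul_mem (c.emb_mem V hV f) key.1
    have h2 := hmul _ _ _ _ (c.emb_mem V hV f) key.1 (hemb f) key.2
    by_cases h : ((0, 0) + ∑ j, m j • (c.wt j, c.par j) : ℕ × ZMod 2) = i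
    · rw [← h, comp_of_mem h1]; exact h2
    · rw [comp_of_mem_ne h1 h]; exact hzero _

section Lift

variable {R : Type v} [Ring R] [Algebra ℝ R] (ψ : C^∞⟮𝓡 n, V; 𝓘(ℝ, ℝ), ℝ⟯ →ₐ[ℝ] R)
  (x : Fin c.r → R)

/-- The linear map underlying `Chart.lift`. -/
noncomputable def liftLinear : F.A V →ₗ[ℝ] R :=
  c.combination ψ x ∘ₗ (c.expansion hV).symm.toLinearMap

variable (hx : ∀ i j, x i * x j = sgn (c.par i * c.par j) • (x j * x i))
  (hψ : ∀ f j, x j * ψ f = ψ f * x j)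

include hx in
theorem liftLinear_monomial (f : C^∞⟮𝓡 n, V; 𝓘(ℝ, ℝ), ℝ⟯) (m : Fin c.r → ℕ) :
    c.liftLinear hV ψ x (c.emb V hV f * orderedMonomial (c.genOn hV) m)
      = ψ f * orderedMonomial x m := by
  by_cases hm : ∀ j, c.par j = 1 → m j ≤ 1
  · rw [← c.expansion_single hV ⟨m, hm⟩]
    simp [liftLinear, combination]
  · push Not at hm
    obtain ⟨j, hj, h2⟩ := hm
    obtain ⟨l, hl⟩ := Nat.exists_eq_add_of_le (Nat.succ_le_of_lt h2)
    have aux {S : Type v} [Ring S] [Algebra ℝ S] (z : Fin c.r → S)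
        (hz : ∀ i j, z i * z j = sgn (c.par i * c.par j) • (z j * z i)) :
        orderedMonomial z m = 0 := by
      refine orderedMonomial_eq_zero z m j ?_
      have := hz j j
      rw [hj] at this
      rw [hl, pow_add, pow_two, sq_eq_zero_of_odd this, zero_mul]
    rw [aux _ (c.genOn_supercomm hV), aux x hx]
    simp

include hx in
theorem liftLinear_emb_mul (f : C^∞⟮𝓡 n, V; 𝓘(ℝ, ℝ), ℝ⟯) (a : F.A V) :
    c.liftLinear hV ψ x (c.emb V hV f * a) = ψ f * c.liftLinear hV ψ x a := by
  induction a using c.expand_induction hV with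
  | hadd a b ha hb => rw [mul_add, map_add, map_add, mul_add, ha, hb]
  | hmono g m =>
    rw [← mul_assoc, ← map_mul, liftLinear_monomial c hV ψ x hx, liftLinear_monomial c hV ψ x hx,
      map_mul, mul_assoc]

include hx hψ in
theorem liftLinear_gen_mul (j : Fin c.r) (a : F.A V) :
    c.liftLinear hV ψ x (c.genOn hV j * a) = x j * c.liftLinear hV ψ x a := by
  induction a using c.expand_induction hV with
  | hadd a b ha hb => rw [mul_add, map_add, map_add, mul_add, ha, hb]
  | hmono g m =>
    obtain ⟨s, hs⟩ := exists_mul_orderedMonomial c.par j m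
    rw [← mul_assoc, ← even_comm (c.emb_mem V hV g), mul_assoc,
      hs _ _ (c.genOn_supercomm hV), mul_smul_comm, map_smul, liftLinear_monomial c hV ψ x hx,
      liftLinear_monomial c hV ψ x hx, ← mul_assoc, hψ, mul_assoc, hs _ _ hx, mul_smul_comm]

/-- The universal property of the functions on a chart: an algebra map is given by its values on
smooth functions and on the coordinates. -/
noncomputable def lift : F.A V →ₐ[ℝ] R :=
  AlgHom.ofLinearMap (c.liftLinear hV ψ x)
    (by simpa [orderedMonomial] using c.liftLinear_monomial hV ψ x hx 1 0)
    (by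
      have h1 : c.liftLinear hV ψ x 1 = 1 := by
        simpa [orderedMonomial] using c.liftLinear_monomial hV ψ x hx 1 0
      refine fun a => c.induction hV (P := fun a => ∀ b, c.liftLinear hV ψ x (a * b)
        = c.liftLinear hV ψ x a * c.liftLinear hV ψ x b) (fun a b ha hb d => ?_)
        (fun a b ha hb d => ?_) (fun f b => ?_) (fun j b => ?_) a
      · rw [add_mul, map_add, map_add, add_mul, ha, hb]
      · rw [mul_assoc, ha, hb, ha, mul_assoc]
      · have := c.liftLinear_emb_mul hV ψ x hx f 1
        rw [mul_one, h1, mul_one] at this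
        rw [c.liftLinear_emb_mul hV ψ x hx, this]
      · have := c.liftLinear_gen_mul hV ψ x hx hψ j 1
        rw [mul_one, h1, mul_one] at this
        rw [c.liftLinear_gen_mul hV ψ x hx hψ, this])

@[simp] theorem lift_emb (f : C^∞⟮𝓡 n, V; 𝓘(ℝ, ℝ), ℝ⟯) :
    c.lift hV ψ x hx hψ (c.emb V hV f) = ψ f := by
  have := c.liftLinear_monomial hV ψ x hx f 0
  simp only [orderedMonomial, Pi.zero_apply, pow_zero, List.ofFn_const, List.prod_replicate,
    one_pow, mul_one] at this
  exact this

@[simp] theorem lift_gen (j : Fin c.r) : c.lift hV ψ x hx hψ (c.genOn hV j) = x j := by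
  have := c.liftLinear_gen_mul hV ψ x hx hψ j 1
  have h1 : c.liftLinear hV ψ x 1 = 1 := by
    simpa [orderedMonomial] using c.liftLinear_monomial hV ψ x hx 1 0
  rwa [mul_one, h1, mul_one] at this

end Lift

end Chart

end BigradedSheaf

namespace BigradedSheaf

namespace Chart

variable {n : ℕ} {X : Type u} [TopologicalSpace X] [ChartedSpace (EuclideanSpace ℝ (Fin n)) X]
  {F : BigradedSheaf.{u, v} X} {k : ℕ} (c : Chart n F k) (j : Fin c.r)
  {V : Opens X} (hV : V ≤ c.dom)

/-! ### Coordinate vector fields -/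

/-- The image of the coordinate `l` under `Chart.jet`. -/
noncomputable def jetGen (l : Fin c.r) : Matrix (Fin 2) (Fin 2) (F.A V) :=
  !![sgn (c.par j * c.par l) • c.genOn hV l, if l = j then 1 else 0; 0, c.genOn hV l]

theorem jetGen_supercomm (l m : Fin c.r) : c.jetGen j hV l * c.jetGen j hV m
    = sgn (c.par l * c.par m) • (c.jetGen j hV m * c.jetGen j hV l) := by
  have h := c.genOn_supercomm hV l m
  ext s t
  fin_cases s <;> fin_cases t
  · simp only [jetGen, Matrix.smul_apply, Matrix.mul_apply, Fin.sum_univ_two, Fin.zero_eta,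
      Matrix.of_apply, Matrix.cons_val', Matrix.cons_val_zero, Matrix.cons_val_one,
      Matrix.cons_val_fin_one, mul_zero, add_zero, smul_mul_smul_comm, h, smul_smul]
    congr 1
    ring
  · by_cases hl : l = j <;> by_cases hm : m = j
    · subst hl; subst hm
      rcases (c.par m).eq_zero_or_one with h | h <;> simp [jetGen, h, add_comm]
    · subst hl
      simp [jetGen, hm, smul_smul, sgn_mul_self]
    · subst hm
      simp [jetGen, hl, mul_comm]
    · simp [jetGen, hl, hm]
  · simp [jetGen]
  · simp [jetGen, h]

/-- The algebra map `a ↦ !![τ a, δ a; 0, a]`, where `δ` is the partial derivative with respect to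
the coordinate `j` and `τ` multiplies functions of parity `p` by the sign of `δ` and `p`. That it is
multiplicative is the Leibniz rule for `δ`. -/
noncomputable def jet : F.A V →ₐ[ℝ] Matrix (Fin 2) (Fin 2) (F.A V) :=
  c.lift hV ((Matrix.scalarAlgHom (Fin 2) ℝ).comp (c.emb V hV)) (c.jetGen j hV)
    (c.jetGen_supercomm j hV) fun f l => by
      simp only [AlgHom.comp_apply, Matrix.scalarAlgHom_apply]
      refine ((Matrix.scalar_commute _ (fun b => ?_) _).eq).symm
      exact even_comm (c.emb_mem V hV f) b

@[simp] theorem jet_emb (f : C^∞⟮𝓡 n, V; 𝓘(ℝ, ℝ), ℝ⟯) :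
    c.jet j hV (c.emb V hV f) = Matrix.scalar (Fin 2) (c.emb V hV f) := by
  simp [jet]

@[simp] theorem jet_gen (l : Fin c.r) : c.jet j hV (c.genOn hV l) = c.jetGen j hV l := by
  simp [jet]

theorem jet_one_zero (a : F.A V) : c.jet j hV a 1 0 = 0 := by
  induction a using c.induction hV with
  | hadd a b ha hb => simp [ha, hb]
  | hmul a b ha hb => simp [Matrix.mul_apply, Fin.sum_univ_two, ha, hb]
  | hemb f => simp
  | hgen l => simp [jetGen]

theorem jet_one_one (a : F.A V) : c.jet j hV a 1 1 = a := by
  induction a using c.induction hV with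
  | hadd a b ha hb => simp [ha, hb]
  | hmul a b ha hb => simp [Matrix.mul_apply, Fin.sum_univ_two, ha, hb, jet_one_zero]
  | hemb f => simp
  | hgen l => simp [jetGen]

theorem jet_zero_zero {i : ℕ × ZMod 2} {a : F.A V} (ha : a ∈ F.gr V i) :
    c.jet j hV a 0 0 = sgn (c.par j * i.2) • a := by
  refine c.graded_induction hV (P := fun i a => c.jet j hV a 0 0 = sgn (c.par j * i.2) • a)
    (fun i => by simp) (fun i a b ha hb => by simp [ha, hb])
    (fun i j a b _ _ ha hb => ?_) (fun f => by simp) (fun l => by simp [jetGen]) ha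
  simp [Matrix.mul_apply, Fin.sum_univ_two, ha, hb, jet_one_zero, smul_smul]
  rw [mul_add, sgn_add, mul_comm]

/-- The partial derivative with respect to the coordinate `j`. -/
noncomputable def partialDeriv : F.A V →ₗ[ℝ] F.A V :=
  Matrix.entryLinearMap ℝ (F.A V) 0 1 ∘ₗ (c.jet j hV).toLinearMap

theorem partialDeriv_apply (a : F.A V) : c.partialDeriv j hV a = c.jet j hV a 0 1 := rfl

theorem partialDeriv_mul {i : ℕ × ZMod 2} {a : F.A V} (ha : a ∈ F.gr V i) (b : F.A V) :
    c.partialDeriv j hV (a * b)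
      = c.partialDeriv j hV a * b + sgn (c.par j * i.2) • (a * c.partialDeriv j hV b) := by
  simp [partialDeriv_apply, Matrix.mul_apply, Fin.sum_univ_two, jet_one_one,
    jet_zero_zero _ _ _ ha, add_comm]

@[simp] theorem partialDeriv_emb (f : C^∞⟮𝓡 n, V; 𝓘(ℝ, ℝ), ℝ⟯) :
    c.partialDeriv j hV (c.emb V hV f) = 0 := by
  simp [partialDeriv_apply]

@[simp] theorem partialDeriv_gen (l : Fin c.r) :
    c.partialDeriv j hV (c.genOn hV l) = if l = j then 1 else 0 := by
  simp [partialDeriv_apply, jetGen]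

theorem partialDeriv_res {W : Opens X} (h : W ≤ V) (a : F.A V) :
    c.partialDeriv j (h.trans hV) (F.res h a) = F.res h (c.partialDeriv j hV a) := by
  suffices H : ∀ (a : F.A V) s t, c.jet j (h.trans hV) (F.res h a) s t = F.res h (c.jet j hV a s t)
    from H a 0 1
  intro a
  induction a using c.induction hV with
  | hadd a b ha hb => simp [ha, hb]
  | hmul a b ha hb => simp [Matrix.mul_apply, ha, hb]
  | hemb f =>
    intro s t
    rw [c.emb_res V W hV h, jet_emb, jet_emb]
    simp only [Matrix.scalar_apply, Matrix.diagonal_apply]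
    split_ifs
    · rw [c.emb_res V W hV h]
    · simp
  | hgen l =>
    have e : F.res h (c.genOn hV l) = c.genOn (h.trans hV) l := F.res_res _ _ _
    intro s t
    rw [e, jet_gen, jet_gen]
    fin_cases s <;> fin_cases t <;> simp [jetGen, e, apply_ite (F.res h)]

theorem mul_mem_iSup_gr {p : ZMod 2} {i : ℕ × ZMod 2} {a b : F.A V}
    (ha : a ∈ ⨆ k : ℕ, F.gr V (k, p)) (hb : b ∈ F.gr V i) :
    a * b ∈ ⨆ k : ℕ, F.gr V (k, p + i.2) := by
  induction ha using Submodule.iSup_induction' with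
  | mem k a ha => exact Submodule.mem_iSup_of_mem (k + i.1) (F.mul_mem ha hb)
  | zero => simp
  | add a a' _ _ ha ha' => rw [add_mul]; exact add_mem ha ha'

theorem mul_mem_iSup_gr' {p : ZMod 2} {i : ℕ × ZMod 2} {a b : F.A V}
    (ha : a ∈ F.gr V i) (hb : b ∈ ⨆ k : ℕ, F.gr V (k, p)) :
    a * b ∈ ⨆ k : ℕ, F.gr V (k, i.2 + p) := by
  induction hb using Submodule.iSup_induction' with
  | mem k b hb => exact Submodule.mem_iSup_of_mem (i.1 + k) (F.mul_mem ha hb)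
  | zero => simp
  | add a a' _ _ ha ha' => rw [mul_add]; exact add_mem ha ha'

theorem partialDeriv_parity {i : ℕ × ZMod 2} {a : F.A V} (ha : a ∈ F.gr V i) :
    c.partialDeriv j hV a ∈ ⨆ k : ℕ, F.gr V (k, c.par j + i.2) := by
  refine c.graded_induction hV
    (P := fun i a => c.partialDeriv j hV a ∈ ⨆ k : ℕ, F.gr V (k, c.par j + i.2))
    (fun i => by simp) (fun i a b ha hb => by rw [map_add]; exact add_mem ha hb)
    (fun i i' a b hia hib ha hb => ?_) (fun f => by simp) (fun l => ?_) ha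
  · rw [partialDeriv_mul _ _ _ hia]
    have h1 := mul_mem_iSup_gr ha hib
    have h2 := mul_mem_iSup_gr' hia hb
    rw [add_assoc] at h1
    rw [add_left_comm] at h2
    exact add_mem h1 (Submodule.smul_mem _ _ h2)
  · rw [partialDeriv_gen]
    split_ifs with h
    · subst h
      exact Submodule.mem_iSup_of_mem 0 (by rw [ZMod.self_add_self]; exact F.one_mem V)
    · exact zero_mem _

/-- The partial derivative with respect to a coordinate, as a vector field. -/
noncomputable def coordVectorField : F.VectorField c.dom (c.par j) where
  app _ hV := c.partialDeriv j hV
  app_res hV h a := c.partialDeriv_res j hV h a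
  app_parity hV _ _ ha := c.partialDeriv_parity j hV ha
  leibniz hV _ _ b ha := c.partialDeriv_mul j hV ha b

/-- A coordinate vector field of negative weight kills the functions on the base. -/
theorem partialDeriv_base (hj : c.wt j ≠ 0) {a : F.A V} (ha : a ∈ F.weightPart V 0) :
    c.partialDeriv j hV a = 0 := by
  suffices H : ∀ i, ∀ a ∈ F.gr V i, i.1 = 0 → c.partialDeriv j hV a = 0 from
    weight_induction (P := fun a => c.partialDeriv j hV a = 0)
      (fun a b ha hb => by rw [map_add, ha, hb, add_zero]) (fun p a ha => H _ a ha rfl) ha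
  intro i a ha
  refine c.graded_induction hV (P := fun i a => i.1 = 0 → c.partialDeriv j hV a = 0)
    (fun i _ => by simp) (fun i a b ha hb h => by rw [map_add, ha h, hb h, add_zero])
    (fun i i' a b hia hib ha hb h => ?_) (fun f _ => by simp) (fun l h => ?_) ha
  · rw [Prod.fst_add, Nat.add_eq_zero_iff] at h
    rw [partialDeriv_mul _ _ _ hia, ha h.1, hb h.2]
    simp
  · rw [partialDeriv_gen, if_neg]
    rintro rfl
    exact hj h

/-- Weight one functions are combinations of the weight one coordinates. -/
theorem exists_eq_sum_gen_mul {p : ZMod 2} {a : F.A V} (ha : a ∈ F.gr V (1, p)) :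
    ∃ b : Fin c.r → F.A V, (∀ l, b l ∈ F.gr V (0, c.par l + p)) ∧ (∀ l, c.wt l ≠ 1 → b l = 0) ∧
      a = ∑ l, c.genOn hV l * b l := by
  suffices H : ∀ i, ∀ a ∈ F.gr V i, i.1 = 1 → ∃ b : Fin c.r → F.A V,
      (∀ l, b l ∈ F.gr V (0, c.par l + i.2)) ∧ (∀ l, c.wt l ≠ 1 → b l = 0) ∧
      a = ∑ l, c.genOn hV l * b l from H (1, p) a ha rfl
  clear ha a p
  intro i a ha
  refine c.graded_induction hV (P := fun i a => i.1 = 1 → ∃ b : Fin c.r → F.A V,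
      (∀ l, b l ∈ F.gr V (0, c.par l + i.2)) ∧ (∀ l, c.wt l ≠ 1 → b l = 0) ∧
      a = ∑ l, c.genOn hV l * b l) (fun i _ => ⟨0, by simp⟩) (fun i a b ha hb h => ?_)
    (fun i i' a b hia hib ha hb h => ?_) (fun f h => by simp at h) (fun l h => ?_) ha
  · obtain ⟨a', ha1, ha2, rfl⟩ := ha h
    obtain ⟨b', hb1, hb2, rfl⟩ := hb h
    refine ⟨a' + b', fun l => add_mem (ha1 l) (hb1 l), fun l hl => ?_, ?_⟩
    · simp [ha2 l hl, hb2 l hl]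
    · simp [mul_add, Finset.sum_add_distrib]
  · rw [Prod.fst_add, Nat.add_eq_one_iff] at h
    rcases h with ⟨h0, h1⟩ | ⟨h1, h0⟩
    · obtain ⟨b', hb1, hb2, rfl⟩ := hb h1
      refine ⟨fun l => sgn (i.2 * c.par l) • (a * b' l), fun l => Submodule.smul_mem _ _ ?_,
        fun l hl => ?_, ?_⟩
      · have := F.mul_mem hia (hb1 l)
        rw [Prod.snd_add, add_left_comm]
        convert this using 2
        exact Prod.ext (by simp [h0]) rfl
      · simp [hb2 l hl]
      · rw [Finset.mul_sum]
        refine Finset.sum_congr rfl fun l _ => ?_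
        rw [← mul_assoc, F.supercomm hia (c.genOn_mem hV l), mul_smul_comm, smul_mul_assoc,
          mul_assoc]
    · obtain ⟨a', ha1, ha2, rfl⟩ := ha h1
      refine ⟨fun l => a' l * b, fun l => ?_, fun l hl => ?_, ?_⟩
      · have := F.mul_mem (ha1 l) hib
        rw [Prod.snd_add, ← add_assoc]
        convert this using 2
        exact Prod.ext (by simp [h0]) rfl
      · simp [ha2 l hl]
      · simp [Finset.sum_mul, mul_assoc]
  · refine ⟨Pi.single l 1, fun l' => ?_, fun l' hl' => ?_, ?_⟩
    · by_cases e : l' = l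
      · subst e
        rw [Pi.single_eq_same, ZMod.self_add_self]; exact F.one_mem V
      · rw [Pi.single_eq_of_ne e]; exact zero_mem _
    · rw [Pi.single_eq_of_ne]; rintro rfl; exact hl' h
    · simp [Pi.single_apply]

/-- The coefficients of a weight one function are its partial derivatives. -/
theorem weight_one_eq_sum {a : F.A V} (ha : a ∈ F.weightPart V 1) :
    a = ∑ l, if c.wt l = 1 then c.genOn hV l * c.partialDeriv l hV a else 0 := by
  refine weight_induction
    (P := fun a => a = ∑ l, if c.wt l = 1 then c.genOn hV l * c.partialDeriv l hV a else 0)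
    (fun a b ha hb => ?_) (fun p a ha => ?_) ha
  · conv_lhs => rw [ha, hb, ← Finset.sum_add_distrib]
    refine Finset.sum_congr rfl fun l _ => ?_
    split_ifs <;> simp [mul_add]
  · obtain ⟨b, hb1, hb2, rfl⟩ := c.exists_eq_sum_gen_mul hV ha
    refine Finset.sum_congr rfl fun l _ => ?_
    split_ifs with h
    · congr 1
      rw [map_sum, Finset.sum_eq_single l]
      · rw [c.partialDeriv_mul l hV (c.genOn_mem hV l), partialDeriv_gen, if_pos rfl,
          c.partialDeriv_base l hV (by omega) (gr_le_weightPart _ _ _ (hb1 l))]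
        simp
      · intro l' _ hl'
        rw [c.partialDeriv_mul l hV (c.genOn_mem hV l'), partialDeriv_gen, if_neg hl',
          c.partialDeriv_base l hV (by omega) (gr_le_weightPart _ _ _ (hb1 l'))]
        simp
      · simp
    · rw [hb2 l h, mul_zero]

/-- A coordinate vector field of weight `-1` maps functions of weight one to functions on the
base. -/
theorem partialDeriv_mem (hj : c.wt j = 1) {p : ZMod 2} {a : F.A V} (ha : a ∈ F.gr V (1, p)) :
    c.partialDeriv j hV a ∈ F.gr V (0, c.par j + p) := by
  obtain ⟨b, hb1, hb2, rfl⟩ := c.exists_eq_sum_gen_mul hV ha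
  rw [map_sum]
  refine Submodule.sum_mem _ fun l _ => ?_
  rw [c.partialDeriv_mul j hV (c.genOn_mem hV l), partialDeriv_gen,
    c.partialDeriv_base j hV (by omega) (gr_le_weightPart _ _ _ (hb1 l))]
  split_ifs with h
  · subst h; simpa using hb1 l
  · simp

end Chart

end BigradedSheaf

namespace BigradedSheaf

/-! ### Operators given locally -/

section
variable {X : Type u} [TopologicalSpace X] {F : BigradedSheaf.{u, v} X}

/-- A local linear relation between functions which determines its second argument, and which is
locally solvable for homogeneous first arguments with solutions in a fixed weight, defines linear
operators commuting with restrictions. -/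
theorem exists_operator {U : Opens X} (R : ∀ N : Opens X, N ≤ U → F.A N → F.A N → Prop)
    (hres : ∀ N (hN : N ≤ U) a b N' (h : N' ≤ N), R N hN a b →
      R N' (h.trans hN) (F.res h a) (F.res h b))
    (huniq : ∀ N (hN : N ≤ U) a b b', R N hN a b → R N hN a b' → b = b')
    (hadd : ∀ N (hN : N ≤ U) a a' b b', R N hN a b → R N hN a' b' → R N hN (a + a') (b + b'))
    (hsmul : ∀ N (hN : N ≤ U) (r : ℝ) a b, R N hN a b → R N hN (r • a) (r • b))
    (hloc : ∀ i, ∃ k, ∀ N (hN : N ≤ U), ∀ a ∈ F.gr N i, ∀ y ∈ N, ∃ (N' : Opens X) (h : N' ≤ N),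
      y ∈ N' ∧ ∃ b ∈ F.weightPart N' k, R N' (h.trans hN) (F.res h a) b) :
    ∃ T : ∀ N : Opens X, N ≤ U → (F.A N →ₗ[ℝ] F.A N),
      (∀ N (hN : N ≤ U) a, ∀ y ∈ N, ∃ (N' : Opens X) (h : N' ≤ N), y ∈ N' ∧
        R N' (h.trans hN) (F.res h a) (F.res h (T N hN a))) ∧
      (∀ N (hN : N ≤ U) N' (h : N' ≤ N) a, T N' (h.trans hN) (F.res h a) = F.res h (T N hN a)) ∧
      (∀ N (hN : N ≤ U) a b, R N hN a b → T N hN a = b) := by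
  let S : ∀ N : Opens X, N ≤ U → F.A N → F.A N → Prop := fun N hN a b =>
    ∀ y ∈ N, ∃ (N' : Opens X) (h : N' ≤ N), y ∈ N' ∧ R N' (h.trans hN) (F.res h a) (F.res h b)
  have Sres : ∀ N (hN : N ≤ U) a b N' (h : N' ≤ N), S N hN a b →
      S N' (h.trans hN) (F.res h a) (F.res h b) := by
    intro N hN a b N' h hS y hy
    obtain ⟨M, hM, hyM, hR⟩ := hS y (h hy)
    refine ⟨M ⊓ N', inf_le_right, ⟨hyM, hy⟩, ?_⟩
    have := hres _ _ _ _ (M ⊓ N') inf_le_left hR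
    simpa only [F.res_res] using this
  have Suniq : ∀ N (hN : N ≤ U) a b b', S N hN a b → S N hN a b' → b = b' := by
    intro N hN a b b' h h'
    refine eq_of_local fun y hy => ?_
    obtain ⟨M, hM, hyM, hR⟩ := h y hy
    obtain ⟨M', hM', hyM', hR'⟩ := h' y hy
    refine ⟨M ⊓ M', inf_le_left.trans hM, ⟨hyM, hyM'⟩, ?_⟩
    have h1 := hres _ _ _ _ (M ⊓ M') inf_le_left hR
    have h2 := hres _ _ _ _ (M ⊓ M') inf_le_right hR'
    simp only [F.res_res] at h1 h2
    exact huniq _ _ _ _ _ h1 h2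
  have Sadd : ∀ N (hN : N ≤ U) a a' b b', S N hN a b → S N hN a' b' →
      S N hN (a + a') (b + b') := by
    intro N hN a a' b b' h h' y hy
    obtain ⟨M, hM, hyM, hR⟩ := h y hy
    obtain ⟨M', hM', hyM', hR'⟩ := h' y hy
    refine ⟨M ⊓ M', inf_le_left.trans hM, ⟨hyM, hyM'⟩, ?_⟩
    have h1 := hres _ _ _ _ (M ⊓ M') inf_le_left hR
    have h2 := hres _ _ _ _ (M ⊓ M') inf_le_right hR'
    simp only [F.res_res] at h1 h2
    rw [map_add, map_add]
    exact hadd _ _ _ _ _ _ h1 h2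
  have Ssmul : ∀ N (hN : N ≤ U) (r : ℝ) a b, S N hN a b → S N hN (r • a) (r • b) := by
    intro N hN r a b h y hy
    obtain ⟨M, hM, hyM, hR⟩ := h y hy
    exact ⟨M, hM, hyM, by rw [map_smul, map_smul]; exact hsmul _ _ _ _ _ hR⟩
  have SofR : ∀ N (hN : N ≤ U) a b, R N hN a b → S N hN a b := fun N hN a b h y hy =>
    ⟨N, le_rfl, hy, by rwa [F.res_id, F.res_id]⟩
  have Sex : ∀ N (hN : N ≤ U) i, ∀ a ∈ F.gr N i, ∃ b, S N hN a b := by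
    intro N hN i a ha
    obtain ⟨k, hk⟩ := hloc i
    obtain ⟨c, -, hc⟩ := exists_of_local (U := N) (k := k)
      (fun M hM c => S M (hM.trans hN) (F.res hM a) c)
      (fun M hM c M' h hS => by
        have := Sres M (hM.trans hN) _ _ M' h hS
        rwa [F.res_res] at this)
      (fun M hM c c' => Suniq M (hM.trans hN) _ _ _)
      (fun y hy => by
        obtain ⟨M, hM, hyM, b, hb, hR⟩ := hk N hN a ha y hy
        exact ⟨M, hM, hyM, b, hb, SofR _ _ _ _ hR⟩)
    refine ⟨c, fun y hy => ?_⟩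
    obtain ⟨M, hM, hyM, hS⟩ := hc y hy
    obtain ⟨M', hM', hyM', hR⟩ := hS y hyM
    refine ⟨M', hM'.trans hM, hyM', ?_⟩
    rwa [F.res_res, F.res_res] at hR
  choose T hT using fun N hN => exists_linearMap (S N hN) (Suniq N hN) (Sadd N hN) (Ssmul N hN)
    (Sex N hN)
  refine ⟨T, hT, fun N hN N' h a => ?_, fun N hN a b h => ?_⟩
  · exact Suniq N' (h.trans hN) _ _ _ (hT _ _ _) (Sres N hN _ _ N' h (hT _ _ _))
  · exact Suniq N hN _ _ _ (hT _ _ _) (SofR _ _ _ _ h)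

end

/-! ### Bump functions -/

section Bump
variable {m : ℕ} {Y : Type u} [TopologicalSpace Y] [ChartedSpace (EuclideanSpace ℝ (Fin m)) Y]
  [IsManifold (𝓡 m) ∞ Y] [T2Space Y] {k : ℕ} (D : GradedSuperBundle.{u, v} m Y k)

/-- There is an even function on the base which is `1` near `y` and is supported in `V`. -/
theorem exists_bump {V : Opens Y} {y : Y} (hy : y ∈ V) :
    ∃ χ ∈ D.gr ⊤ (0, 0), (∃ N : Opens Y, N ≤ V ∧ y ∈ N ∧ D.res le_top χ = (1 : D.A N)) ∧
      ∃ O : Opens Y, V ⊔ O = ⊤ ∧ D.res le_top χ = (0 : D.A O) := by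
  obtain ⟨c, hyc⟩ := D.exists_chart y
  have hnhds : ((V ⊓ c.dom : Opens Y) : Set Y) ∈ nhds y := (V ⊓ c.dom).isOpen.mem_nhds ⟨hy, hyc⟩
  obtain ⟨f, hf⟩ := ((SmoothBumpFunction.nhds_basis_tsupport (I := 𝓡 m) y).mem_iff).1 hnhds
  have hfs : ContMDiff (𝓡 m) 𝓘(ℝ, ℝ) ∞ f := f.contMDiff
  let g (W : Opens Y) : C^∞⟮𝓡 m, W; 𝓘(ℝ, ℝ), ℝ⟯ :=
    ⟨fun z => f z, hfs.comp contMDiff_subtype_val⟩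
  let O : Opens Y := ⟨(tsupport f)ᶜ, (isClosed_tsupport f).isOpen_compl⟩
  -- Only a chart embeds functions of the base into `D.A`; glue the image of `f` there with zero.
  let N : Bool → Opens Y := fun b => if b then c.dom else O
  let s : ∀ b : ULift.{u} Bool, D.A (N b.down) := fun b =>
    match b with
    | ⟨true⟩ => c.emb c.dom le_rfl (g c.dom)
    | ⟨false⟩ => (0 : D.A O)
  have h0 : D.res (inf_le_left : c.dom ⊓ O ≤ c.dom) (c.emb c.dom le_rfl (g c.dom)) = 0 := by
    rw [c.emb_res, show ContMDiffMap.restrictRingHom (𝓡 m) 𝓘(ℝ, ℝ) ℝ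
      (inf_le_left : c.dom ⊓ O ≤ c.dom) (g c.dom) = 0 from ?_, map_zero]
    ext z
    have hz : (z : Y) ∉ tsupport f := z.2.2
    exact image_eq_zero_of_notMem_tsupport (f := f) hz
  have hcover : ∀ z : Y, z ∈ (V ⊓ c.dom : Opens Y) ∨ z ∈ O := fun z => by
    by_cases hz : z ∈ tsupport f
    exacts [Or.inl (hf.2 hz), Or.inr hz]
  obtain ⟨χ, hχ, hs⟩ := glue_homog (F := D.toBigradedSheaf) (U := ⊤) (i := (0, 0))
    (N := fun b : ULift.{u} Bool => N b.down)
    (fun b => le_top) (fun z _ => by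
      rcases hcover z with h | h
      · exact Opens.mem_iSup.2 ⟨⟨true⟩, h.2⟩
      · exact Opens.mem_iSup.2 ⟨⟨false⟩, h⟩) s
    (fun b => by
      rcases b with ⟨_ | _⟩
      · exact zero_mem _
      · exact c.emb_mem _ _ _)
    (fun a b => by
      rcases a with ⟨_ | _⟩ <;> rcases b with ⟨_ | _⟩
      · rfl
      · change D.res _ (0 : D.A O) = D.res _ (c.emb c.dom le_rfl (g c.dom))
        have h1 : O ⊓ c.dom ≤ c.dom ⊓ O := le_of_eq (inf_comm _ _)
        have h2 := congrArg (D.res h1) h0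
        rw [D.res_res, map_zero] at h2
        rw [map_zero, h2]
      · change D.res _ (c.emb c.dom le_rfl (g c.dom)) = D.res _ (0 : D.A O)
        rw [map_zero, h0]
      · rfl)
  have hs1 : D.res le_top χ = c.emb c.dom le_rfl (g c.dom) := hs ⟨true⟩
  have hs0 : D.res le_top χ = (0 : D.A O) := hs ⟨false⟩
  refine ⟨χ, hχ, ?_, O, ?_, hs0⟩
  · obtain ⟨t, ht, hto, hyt⟩ := eventually_nhds_iff.1 f.eventuallyEq_one
    let M : Opens Y := ⟨t, hto⟩
    refine ⟨V ⊓ c.dom ⊓ M, inf_le_left.trans inf_le_left, ⟨⟨hy, hyc⟩, hyt⟩, ?_⟩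
    have hM : V ⊓ c.dom ⊓ M ≤ c.dom := inf_le_left.trans inf_le_right
    rw [← D.res_res le_top hM, hs1, c.emb_res, show ContMDiffMap.restrictRingHom (𝓡 m) 𝓘(ℝ, ℝ) ℝ
      hM (g c.dom) = 1 from ?_, map_one]
    ext z
    exact ht z z.2.2
  · refine top_le_iff.1 fun z _ => ?_
    rcases hcover z with h | h
    exacts [Or.inl h.1, Or.inr h]

/-- Functions are locally restrictions of functions with a larger domain. -/
theorem exists_extension {V W : Opens Y} (h : W ≤ V) (a : D.A W) {y : Y} (hy : y ∈ W) :
    ∃ (N : Opens Y) (hN : N ≤ W), y ∈ N ∧ ∃ a' : D.A V, D.res (hN.trans h) a' = D.res hN a := by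
  obtain ⟨χ, hχ, ⟨N, hN, hyN, h1⟩, O, hO, h0⟩ := exists_bump D hy
  refine ⟨N, hN, hyN, ?_⟩
  -- With a bump function `χ` around `y`, the product `χ * a` extends by zero.
  suffices H : ∃ a' : D.A V, D.res h a' = D.res le_top χ * a by
    obtain ⟨a', ha'⟩ := H
    refine ⟨a', ?_⟩
    rw [← D.res_res h hN, ha', map_mul, D.res_res, h1, one_mul]
  induction a using homog_induction with
  | h0 => exact ⟨0, by simp⟩
  | hadd a b ha hb =>
    obtain ⟨a', ha⟩ := ha
    obtain ⟨b', hb⟩ := hb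
    exact ⟨a' + b', by rw [map_add, ha, hb, mul_add]⟩
  | hom i a ha =>
    let N : Bool → Opens Y := fun b => if b then W else O ⊓ V
    let s : ∀ b : ULift.{u} Bool, D.A (N b.down) := fun b =>
      match b with
      | ⟨true⟩ => (D.res le_top χ * a : D.A W)
      | ⟨false⟩ => (0 : D.A (O ⊓ V))
    have key : ∀ M (hM : M ≤ W), M ≤ O → D.res hM (D.res le_top χ * a) = 0 := fun M hM hMO => by
      rw [map_mul, D.res_res, ← D.res_res le_top hMO, h0, map_zero, zero_mul]
    obtain ⟨t, -, hs⟩ := glue_homog (F := D.toBigradedSheaf) (U := V) (i := i)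
      (N := fun b : ULift.{u} Bool => N b.down)
      (fun b => by
        rcases b with ⟨_ | _⟩
        exacts [inf_le_right, h]) (fun z hz => by
        have : z ∈ W ⊔ O := hO ▸ trivial
        rcases this with h | h
        · exact Opens.mem_iSup.2 ⟨⟨true⟩, h⟩
        · exact Opens.mem_iSup.2 ⟨⟨false⟩, ⟨h, hz⟩⟩) s
      (fun b => by
        rcases b with ⟨_ | _⟩
        · exact zero_mem _
        · have := D.mul_mem (D.res_mem (le_top : W ≤ ⊤) hχ) ha
          rwa [show ((0, 0) : ℕ × ZMod 2) = 0 from rfl, zero_add] at this)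
      (fun a b => by
        rcases a with ⟨_ | _⟩ <;> rcases b with ⟨_ | _⟩
        · rfl
        · refine (map_zero _).trans (key _ _ (inf_le_left.trans inf_le_left)).symm
        · exact (key _ _ (inf_le_right.trans inf_le_left)).trans (map_zero _).symm
        · rfl)
    exact ⟨t, hs ⟨true⟩⟩

end Bump

/-! ### The vector bundle dual to the functions of weight one -/

section
variable {Y : Type u} [TopologicalSpace Y] (B : BigradedSheaf.{u, v} Y)

/-- A functional on the functions of weight one, with values in the functions on the base, which is
linear over the base from the right. It is encoded as an operator on all functions which vanishes on
the functions of other weights. -/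
@[ext] structure Functional (V : Opens Y) where
  /-- The underlying operator on functions. -/
  op : B.A V →ₗ[ℝ] B.A V
  op_wcomp : ∀ a, op (B.wcomp V 1 a) = op a
  op_mem : ∀ a, op a ∈ B.weightPart V 0
  op_mul : ∀ a, ∀ f ∈ B.weightPart V 0, op (a * f) = op a * f

namespace Functional

variable {B} {V : Opens Y}

theorem op_injective : Function.Injective (op : B.Functional V → _) := fun _ _ => Functional.ext

instance : Zero (B.Functional V) :=
  ⟨⟨0, fun _ => rfl, fun _ => zero_mem _, fun _ _ _ => by simp⟩⟩

instance : Add (B.Functional V) :=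
  ⟨fun l l' => ⟨l.op + l'.op, fun a => by simp [op_wcomp],
    fun a => add_mem (l.op_mem a) (l'.op_mem a),
    fun a f hf => by simp [l.op_mul a f hf, l'.op_mul a f hf, add_mul]⟩⟩

instance : Neg (B.Functional V) :=
  ⟨fun l => ⟨-l.op, fun a => by simp [op_wcomp], fun a => neg_mem (l.op_mem a),
    fun a f hf => by simp [l.op_mul a f hf]⟩⟩

instance : Sub (B.Functional V) :=
  ⟨fun l l' => ⟨l.op - l'.op, fun a => by simp [op_wcomp],
    fun a => sub_mem (l.op_mem a) (l'.op_mem a),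
    fun a f hf => by simp [l.op_mul a f hf, l'.op_mul a f hf, sub_mul]⟩⟩

instance : SMul ℝ (B.Functional V) :=
  ⟨fun r l => ⟨r • l.op, fun a => by simp [op_wcomp],
    fun a => Submodule.smul_mem _ _ (l.op_mem a),
    fun a f hf => by simp [l.op_mul a f hf]⟩⟩

instance : AddCommGroup (B.Functional V) where
  add_assoc l l' l'' := op_injective (add_assoc l.op l'.op l''.op)
  zero_add l := op_injective (zero_add l.op)
  add_zero l := op_injective (add_zero l.op)
  add_comm l l' := op_injective (add_comm l.op l'.op)
  neg_add_cancel l := op_injective (neg_add_cancel l.op)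
  sub_eq_add_neg l l' := op_injective (sub_eq_add_neg l.op l'.op)
  nsmul := nsmulRec
  zsmul := zsmulRec

/-- The operator of a functional, as an additive map. -/
def opHom : B.Functional V →+ (B.A V →ₗ[ℝ] B.A V) where
  toFun := op
  map_zero' := rfl
  map_add' _ _ := rfl

instance : Module ℝ (B.Functional V) := op_injective.module ℝ opHom fun _ _ => rfl

instance : SMul (B.base V) (B.Functional V) :=
  ⟨fun f l => ⟨LinearMap.mulLeft ℝ f.1 ∘ₗ l.op, fun a => by simp [op_wcomp],
    fun a => (B.base V).mul_mem f.2 (l.op_mem a), fun a g hg => by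
      simp [l.op_mul a g hg, mul_assoc]⟩⟩

theorem smul_apply (f : B.base V) (l : B.Functional V) (a : B.A V) :
    (f • l).op a = f.1 * l.op a := rfl

@[simp] theorem zero_op : (0 : B.Functional V).op = 0 := rfl

@[simp] theorem add_op (l l' : B.Functional V) : (l + l').op = l.op + l'.op := rfl

@[simp] theorem neg_op (l : B.Functional V) : (-l).op = -l.op := rfl

@[simp] theorem smul_op (r : ℝ) (l : B.Functional V) : (r • l).op = r • l.op := rfl

theorem sum_op {ι : Type*} (s : Finset ι) (l : ι → B.Functional V) :
    (∑ i ∈ s, l i).op = ∑ i ∈ s, (l i).op := map_sum opHom l s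

instance : Module (B.base V) (B.Functional V) where
  one_smul l := Functional.ext (LinearMap.ext fun a => by simp [smul_apply])
  mul_smul f g l := Functional.ext (LinearMap.ext fun a => by simp [smul_apply, mul_assoc])
  smul_zero f := Functional.ext (LinearMap.ext fun a => by simp [smul_apply])
  smul_add f l l' := Functional.ext (LinearMap.ext fun a => by simp [smul_apply, mul_add])
  add_smul f g l := Functional.ext (LinearMap.ext fun a => by simp [smul_apply, add_mul])
  zero_smul l := Functional.ext (LinearMap.ext fun a => by simp [smul_apply])

instance : IsScalarTower ℝ (B.base V) (B.Functional V) :=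
  ⟨fun r f l => Functional.ext (LinearMap.ext fun a => by simp [smul_apply])⟩

theorem ext_weight {l l' : B.Functional V}
    (h : ∀ p, ∀ a ∈ B.gr V (1, p), l.op a = l'.op a) : l = l' := by
  refine Functional.ext (LinearMap.ext fun a => ?_)
  rw [← l.op_wcomp, ← l'.op_wcomp]
  exact weight_induction (P := fun a => l.op a = l'.op a)
    (fun a b ha hb => by rw [map_add, map_add, ha, hb]) h (wcomp_mem 1 a)

theorem apply_of_ne (l : B.Functional V) {i : ℕ × ZMod 2} {a : B.A V}
    (ha : a ∈ B.gr V i) (hi : i.1 ≠ 1) : l.op a = 0 := by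
  rw [← l.op_wcomp, wcomp_of_mem_gr_ne (p := i.2) ha hi, map_zero]

end Functional

end

end BigradedSheaf

namespace BigradedSheaf

section
variable {X : Type u} [TopologicalSpace X] {F : BigradedSheaf.{u, v} X} {U : Opens X}

theorem mem_weightPart_of_local {k : ℕ} {a : F.A U}
    (h : ∀ y ∈ U, ∃ (N : Opens X) (hN : N ≤ U), y ∈ N ∧ F.res hN a ∈ F.weightPart N k) :
    a ∈ F.weightPart U k := by
  rw [mem_weightPart_iff]
  refine eq_of_local fun y hy => ?_
  obtain ⟨N, hN, hyN, ha⟩ := h y hy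
  exact ⟨N, hN, hyN, by rw [← wcomp_res, wcomp_of_mem ha]⟩

theorem mul_base_mem {k : ℕ} {a f : F.A U} (ha : a ∈ F.weightPart U k)
    (hf : f ∈ F.weightPart U 0) : a * f ∈ F.weightPart U k := by
  have h := F.weightPart_mul_mem ha hf
  rwa [Nat.add_zero] at h

theorem base_mul_mem {k : ℕ} {a f : F.A U} (hf : f ∈ F.weightPart U 0)
    (ha : a ∈ F.weightPart U k) : f * a ∈ F.weightPart U k := by
  have h := F.weightPart_mul_mem hf ha
  rwa [Nat.zero_add] at h

theorem comp_add_mul {j : ℕ × ZMod 2} {b : F.A U} (hb : b ∈ F.gr U j) (i : ℕ × ZMod 2)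
    (a : F.A U) : F.comp U (i + j) (a * b) = F.comp U i a * b := by
  induction a using homog_induction with
  | h0 => simp
  | hadd a b ha hb => simp [add_mul, ha, hb]
  | hom i' a ha =>
    by_cases h : i' = i
    · subst h
      rw [comp_of_mem ha, comp_of_mem (F.mul_mem ha hb)]
    · rw [comp_of_mem_ne ha h, comp_of_mem_ne (F.mul_mem ha hb), zero_mul]
      exact fun e => h (Prod.ext (Nat.add_right_cancel (congrArg Prod.fst e))
        (add_right_cancel (congrArg Prod.snd e)))

theorem wcomp_mul {b : F.A U} (hb : b ∈ F.weightPart U 0) (k : ℕ) (a : F.A U) :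
    F.wcomp U k (a * b) = F.wcomp U k a * b := by
  refine weight_induction (P := fun b => F.wcomp U k (a * b) = F.wcomp U k a * b)
    (fun b b' h h' => by rw [mul_add, map_add, h, h', mul_add]) (fun p b hb => ?_) hb
  have h0 := comp_add_mul hb (k, 0) a
  have h1 := comp_add_mul hb (k, 1) a
  simp only [Prod.mk_add_mk, add_zero, zero_add] at h0 h1
  rw [wcomp, LinearMap.add_apply, LinearMap.add_apply, add_mul, ← h0, ← h1]
  rcases p.eq_zero_or_one with rfl | rfl
  · simp
  · rw [show (1 : ZMod 2) + 1 = 0 from by decide, add_comm]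

end

theorem isInternal_of_projections {M : Type*} [AddCommGroup M] [Module ℝ M]
    (S : ZMod 2 → Submodule ℝ M) (P : ZMod 2 → M →ₗ[ℝ] M) (hP : ∀ p a, P p a ∈ S p)
    (hS : ∀ p, ∀ a ∈ S p, P p a = a) (hne : ∀ a ∈ S 1, P 0 a = 0)
    (hadd : ∀ a, P 0 a + P 1 a = a) : DirectSum.IsInternal S := by
  rw [DirectSum.isInternal_submodule_iff_isCompl _ (i := 0) (j := 1) (by decide)
    (by ext p; simpa [eq_comm] using p.eq_zero_or_one)]
  refine ⟨Submodule.disjoint_def.2 fun l h0 h1 => ?_, codisjoint_iff.2 ?_⟩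
  · rw [← hS 0 l h0, hne l h1]
  · refine eq_top_iff.2 fun l _ => ?_
    rw [← hadd l]
    exact Submodule.add_mem_sup (hP _ _) (hP _ _)

namespace Functional

section
variable {Y : Type u} [TopologicalSpace Y] {B : BigradedSheaf.{u, v} Y} {V : Opens Y}

/-- The functionals of parity `p`. As functions of weight one are linear functions on the parity
shift, these change the parity of functions by `p + 1`. -/
def par (V : Opens Y) (p : ZMod 2) : Submodule ℝ (B.Functional V) where
  carrier := {l | ∀ q, ∀ a ∈ B.gr V (1, q), l.op a ∈ B.gr V (0, p + 1 + q)}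
  zero_mem' := by simp
  add_mem' h h' q a ha := add_mem (h q a ha) (h' q a ha)
  smul_mem' r l h q a ha := Submodule.smul_mem _ r (h q a ha)

/-- The operator underlying `parityPart`. -/
noncomputable def parityOp (p : ZMod 2) (l : B.A V →ₗ[ℝ] B.A V) : B.A V →ₗ[ℝ] B.A V :=
  B.comp V (0, p + 1) ∘ₗ l ∘ₗ B.comp V (1, 0) + B.comp V (0, p) ∘ₗ l ∘ₗ B.comp V (1, 1)

theorem parityOp_apply (p : ZMod 2) (l : B.A V →ₗ[ℝ] B.A V) (a : B.A V) :
    parityOp p l a = B.comp V (0, p + 1) (l (B.comp V (1, 0) a))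
      + B.comp V (0, p) (l (B.comp V (1, 1) a)) := rfl

/-- The homogeneous component of parity `p` of a functional. -/
noncomputable def parityPart (p : ZMod 2) : B.Functional V →ₗ[ℝ] B.Functional V where
  toFun l := ⟨parityOp p l.op, fun a => by
      simp only [parityOp_apply, wcomp, LinearMap.add_apply, map_add, comp_of_mem (comp_mem (1, 0) a),
        comp_of_mem (comp_mem (1, 1) a),
        comp_of_mem_ne (i := (1, 0)) (comp_mem (1, 1) a) (by simp),
        comp_of_mem_ne (i := (1, 1)) (comp_mem (1, 0) a) (by simp)]
      simp,
    fun a => add_mem (gr_le_weightPart _ _ _ (comp_mem _ _)) (gr_le_weightPart _ _ _ (comp_mem _ _)),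
    fun a f hf => by
      refine weight_induction (P := fun f => parityOp p l.op (a * f) = parityOp p l.op a * f)
        (fun f f' h h' => by rw [mul_add, map_add, h, h', mul_add]) (fun r f hf => ?_) hf
      have h (q : ZMod 2) : B.comp V (1, q + r) (a * f) = B.comp V (1, q) a * f := by
        simpa using comp_add_mul hf (1, q) a
      have h' (q : ZMod 2) (a : B.A V) : B.comp V (0, q + r) (a * f) = B.comp V (0, q) a * f := by
        simpa using comp_add_mul hf (0, q) a
      have e : (1 : ZMod 2) + 1 = 0 := by decide
      simp only [parityOp_apply, add_mul, ← h',
        ← l.op_mul _ _ (gr_le_weightPart _ _ _ hf), ← h]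
      rcases r.eq_zero_or_one with rfl | rfl
      · simp
      · rw [add_assoc p 1 1, e, add_zero, zero_add, add_comm]⟩
  map_add' l l' := by
    refine Functional.ext (LinearMap.ext fun a => ?_)
    simp only [add_op, LinearMap.add_apply, parityOp_apply, map_add]
    abel
  map_smul' r l := by
    refine Functional.ext (LinearMap.ext fun a => ?_)
    simp [parityOp_apply]

theorem parityPart_apply (p : ZMod 2) (l : B.Functional V) {q : ZMod 2} {a : B.A V}
    (ha : a ∈ B.gr V (1, q)) : (parityPart p l).op a = B.comp V (0, p + 1 + q) (l.op a) := by
  have e : (1 : ZMod 2) + 1 = 0 := by decide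
  rcases q.eq_zero_or_one with rfl | rfl
  · simp [parityPart, parityOp_apply, comp_of_mem ha, comp_of_mem_ne ha]
  · simp [parityPart, parityOp_apply, comp_of_mem ha, comp_of_mem_ne ha, add_assoc, e]

theorem parityPart_mem (p : ZMod 2) (l : B.Functional V) : parityPart p l ∈ par V p :=
  fun q a ha => by rw [parityPart_apply p l ha]; exact comp_mem _ _

theorem parityPart_of_mem {p : ZMod 2} {l : B.Functional V} (hl : l ∈ par V p) :
    parityPart p l = l :=
  ext_weight fun q a ha => by rw [parityPart_apply p l ha, comp_of_mem (hl q a ha)]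

theorem parityPart_of_mem_ne {p p' : ZMod 2} (h : p ≠ p') {l : B.Functional V}
    (hl : l ∈ par V p) : parityPart p' l = 0 :=
  ext_weight fun q a ha => by
    rw [parityPart_apply p' l ha, comp_of_mem_ne (hl q a ha)]
    · rfl
    · simpa using h

theorem parityPart_add (l : B.Functional V) : parityPart 0 l + parityPart 1 l = l :=
  ext_weight fun q a ha => by
    have e : (1 : ZMod 2) + 1 = 0 := by decide
    rw [add_op, LinearMap.add_apply, parityPart_apply _ _ ha, parityPart_apply _ _ ha]
    conv_rhs => rw [← wcomp_of_mem (l.op_mem a)]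
    rw [wcomp, LinearMap.add_apply]
    rcases q.eq_zero_or_one with rfl | rfl
    · rw [e, zero_add, add_zero, add_zero, add_comm]
    · simp [e]

theorem par_internal (V : Opens Y) : DirectSum.IsInternal (par (B := B) V) :=
  isInternal_of_projections _ parityPart parityPart_mem (fun _ _ => parityPart_of_mem)
    (fun l hl => parityPart_of_mem_ne (by decide) hl) parityPart_add

theorem smul_mem {p q : ZMod 2} {f : B.base V} {l : B.Functional V}
    (hf : (f : B.A V) ∈ B.gr V (0, q)) (hl : l ∈ par V p) : f • l ∈ par V (q + p) := by
  intro r a ha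
  have := B.mul_mem hf (hl r a ha)
  rwa [Prod.mk_add_mk, zero_add, ← add_assoc, ← add_assoc] at this

/-- A functional of parity `p` is linear from the left up to the sign rule. -/
theorem apply_mul {p q : ZMod 2} {l : B.Functional V} (hl : l ∈ par V p) {f : B.A V}
    (hf : f ∈ B.gr V (0, q)) (a : B.A V) : l.op (f * a) = sgn ((p + 1) * q) • (f * l.op a) := by
  induction a using homog_induction with
  | h0 => simp
  | hadd a b ha hb => simp [mul_add, ha, hb]
  | hom i a ha =>
    by_cases hi : i.1 = 1
    · obtain ⟨k, r⟩ := i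
      subst hi
      rw [B.supercomm hf ha, map_smul, l.op_mul _ _ (gr_le_weightPart _ _ _ hf),
        B.supercomm (hl r a ha) hf, smul_smul]
      congr 1
      dsimp only
      rw [add_mul _ r, sgn_add, mul_comm q r, mul_left_comm, sgn_mul_self, mul_one]
    · have := B.mul_mem hf ha
      rw [apply_of_ne l ha hi, apply_of_ne l this (by simpa using hi)]
      simp

end

/-! ### Restriction of functionals -/

section
variable {m : ℕ} {Y : Type u} [TopologicalSpace Y] [ChartedSpace (EuclideanSpace ℝ (Fin m)) Y]
  [IsManifold (𝓡 m) ∞ Y] [T2Space Y] {k : ℕ} {D : GradedSuperBundle.{u, v} m Y k}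
  {V W : Opens Y}

/-- Functionals are local, because of the existence of bump functions. -/
theorem local_zero (l : D.Functional V) {N : Opens Y} (hN : N ≤ V) {a : D.A V}
    (ha : D.res hN a = 0) : D.res hN (l.op a) = 0 := by
  refine eq_of_local fun y hy => ?_
  obtain ⟨χ, hχ, ⟨M, hM, hyM, h1⟩, O, hO, h0⟩ := exists_bump D hy
  refine ⟨M, hM, hyM, ?_⟩
  -- For a bump function `χ` supported in `N`, already `a * χ` vanishes on all of `V`.
  have key : a * D.res le_top χ = 0 := by
    refine eq_of_local fun z hz => ?_
    have : z ∈ N ⊔ O := hO ▸ trivial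
    rcases this with h | h
    · exact ⟨N, hN, h, by rw [map_mul, ha, zero_mul, map_zero]⟩
    · exact ⟨O ⊓ V, inf_le_right, ⟨h, hz⟩, by
        rw [map_mul, D.res_res, ← D.res_res le_top inf_le_left, h0, map_zero, mul_zero, map_zero]⟩
  have h2 := l.op_mul a (D.res le_top χ) (gr_le_weightPart _ _ _ (D.res_mem _ hχ))
  rw [key, map_zero] at h2
  have h3 := congrArg (D.res (hM.trans hN)) h2
  rw [map_zero, map_mul, D.res_res, h1, mul_one] at h3
  rw [D.res_res, ← h3, map_zero]

theorem local_eq (l : D.Functional V) {N : Opens Y} (hN : N ≤ V) {a b : D.A V}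
    (h : D.res hN a = D.res hN b) : D.res hN (l.op a) = D.res hN (l.op b) := by
  have := local_zero l hN (a := a - b) (by rw [map_sub, h, sub_self])
  rwa [map_sub, map_sub, sub_eq_zero] at this

/-- Functionals over `W` are determined by their values on functions which extend to `V`. -/
theorem ext_res (h : W ≤ V) {l l' : D.Functional W}
    (hl : ∀ a : D.A V, l.op (D.res h a) = l'.op (D.res h a)) : l = l' := by
  refine Functional.ext (LinearMap.ext fun a => eq_of_local fun y hy => ?_)
  obtain ⟨N, hN, hyN, a', ha'⟩ := exists_extension D h a hy
  rw [← D.res_res h hN] at ha'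
  exact ⟨N, hN, hyN, by rw [← local_eq l hN ha', hl, local_eq l' hN ha']⟩

theorem exists_res (h : W ≤ V) (l : D.Functional V) :
    ∃ l' : D.Functional W, ∀ a, l'.op (D.res h a) = D.res h (l.op a) := by
  obtain ⟨T, hT, hTres, hTR⟩ := exists_operator (F := D.toBigradedSheaf) (U := W)
    (fun N hN a b => ∃ a' : D.A V, D.res (hN.trans h) a' = a ∧ D.res (hN.trans h) (l.op a') = b)
    (by
      rintro N hN _ _ N' h' ⟨a', rfl, rfl⟩
      exact ⟨a', by rw [D.res_res], by rw [D.res_res]⟩)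
    (by
      rintro N hN _ _ _ ⟨a', rfl, rfl⟩ ⟨a'', h1, rfl⟩
      exact local_eq l _ h1.symm)
    (by
      rintro N hN _ _ _ _ ⟨a, rfl, rfl⟩ ⟨a', rfl, rfl⟩
      exact ⟨a + a', by simp, by simp⟩)
    (by
      rintro N hN r _ _ ⟨a, rfl, rfl⟩
      exact ⟨r • a, by simp, by simp⟩)
    (fun i => ⟨0, fun N hN a ha y hy => by
      obtain ⟨N', hN', hyN, a', ha'⟩ := exists_extension D (hN.trans h) a hy
      exact ⟨N', hN', hyN, _, D.res_weightPart _ (l.op_mem a'), a', ha', rfl⟩⟩)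
  refine ⟨⟨T W le_rfl, fun a => ?_, fun a => ?_, fun a f hf => ?_⟩, fun a => ?_⟩
  · refine eq_of_local fun y hy => ?_
    obtain ⟨N, hN, hyN, a', h1, h2⟩ := hT W le_rfl a y hy
    refine ⟨N, hN, hyN, ?_⟩
    rw [← h2, ← hTres]
    exact hTR _ _ _ _ ⟨D.wcomp V 1 a', by rw [← wcomp_res, ← wcomp_res, h1], by rw [l.op_wcomp]⟩
  · refine mem_weightPart_of_local fun y hy => ?_
    obtain ⟨N, hN, hyN, a', h1, h2⟩ := hT W le_rfl a y hy
    exact ⟨N, hN, hyN, h2 ▸ D.res_weightPart _ (l.op_mem a')⟩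
  · refine eq_of_local fun y hy => ?_
    obtain ⟨N, hN, hyN, a', h1, h2⟩ := hT W le_rfl a y hy
    obtain ⟨M, hM, hyM, f', hf'⟩ := exists_extension D h f hy
    refine ⟨N ⊓ M, inf_le_left.trans hN, ⟨hyN, hyM⟩, ?_⟩
    rw [← hTres]
    refine hTR _ _ _ _ ⟨a' * D.wcomp V 0 f', ?_, ?_⟩
    · rw [map_mul, map_mul, ← D.res_res (hN.trans h) (inf_le_left : N ⊓ M ≤ N) a', h1, D.res_res,
        ← wcomp_res, ← D.res_res (hM.trans h) (inf_le_right : N ⊓ M ≤ M) f', hf', D.res_res, wcomp_res,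
        wcomp_of_mem hf]
    · rw [l.op_mul _ _ (wcomp_mem _ _), map_mul, map_mul,
        ← D.res_res (hN.trans h) (inf_le_left : N ⊓ M ≤ N) (l.op a'), h2, D.res_res,
        ← wcomp_res, ← D.res_res (hM.trans h) (inf_le_right : N ⊓ M ≤ M) f', hf', D.res_res, wcomp_res,
        wcomp_of_mem hf]
  · exact hTR _ _ _ _ ⟨a, rfl, rfl⟩

/-- The restriction of functionals. -/
noncomputable def res (h : W ≤ V) : D.Functional V →ₗ[ℝ] D.Functional W where
  toFun l := (exists_res h l).choose
  map_add' l l' := ext_res h fun a => by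
    rw [(exists_res h (l + l')).choose_spec]
    simp only [add_op, LinearMap.add_apply, map_add]
    rw [(exists_res h l).choose_spec, (exists_res h l').choose_spec]
  map_smul' r l := ext_res h fun a => by
    rw [(exists_res h (r • l)).choose_spec]
    simp only [smul_op, LinearMap.smul_apply, map_smul, RingHom.id_apply]
    rw [(exists_res h l).choose_spec]

theorem res_apply (h : W ≤ V) (l : D.Functional V) (a : D.A V) :
    (res h l).op (D.res h a) = D.res h (l.op a) :=
  (exists_res h l).choose_spec a

theorem res_eq_of_apply (h : W ≤ V) {l : D.Functional V} {l' : D.Functional W}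
    (H : ∀ a, l'.op (D.res h a) = D.res h (l.op a)) : res h l = l' :=
  ext_res h fun a => by rw [res_apply, H]

theorem res_self (l : D.Functional V) : res le_rfl l = l :=
  res_eq_of_apply _ fun a => by rw [D.res_id, D.res_id]

theorem res_trans {Z : Opens Y} (h : W ≤ V) (h' : Z ≤ W) (l : D.Functional V) :
    res h' (res h l) = res (h'.trans h) l :=
  (res_eq_of_apply _ fun a => by
    rw [← D.res_res h h' a, res_apply, res_apply, D.res_res]).symm

theorem res_smul (h : W ≤ V) (f : D.base V) (l : D.Functional V) :
    res h (f • l) = D.baseRes h f • res h l :=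
  res_eq_of_apply _ fun a => by
    rw [smul_apply, smul_apply, res_apply, map_mul]
    rfl

theorem res_mem (h : W ≤ V) {p : ZMod 2} {l : D.Functional V} (hl : l ∈ par V p) :
    res h l ∈ par W p := by
  intro q a ha
  refine mem_gr_of_local fun y hy => ?_
  obtain ⟨N, hN, hyN, a', ha'⟩ := exists_extension D h a hy
  refine ⟨N, hN, hyN, ?_⟩
  have e : D.res hN a = D.res hN (D.res h (D.comp V (1, q) a')) := by
    rw [D.res_res, ← comp_res, ha', comp_res, comp_of_mem ha]
  rw [local_eq _ hN e, res_apply]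
  exact D.res_mem _ (D.res_mem _ (hl q _ (comp_mem _ _)))

theorem gluing {ι : Type u} (V : ι → Opens Y) (s : ∀ k, D.Functional (V k))
    (hs : ∀ k l, res (inf_le_left : V k ⊓ V l ≤ V k) (s k)
      = res (inf_le_right : V k ⊓ V l ≤ V l) (s l)) :
    ∃! t : D.Functional (iSup V), ∀ k, res (le_iSup V k) t = s k := by
  obtain ⟨T, hT, hTres, hTR⟩ := exists_operator (F := D.toBigradedSheaf) (U := iSup V)
    (fun N hN a b => ∃ (k : ι) (h : N ≤ V k), (res h (s k)).op a = b)
    (by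
      rintro N hN a _ N' h' ⟨k, h, rfl⟩
      exact ⟨k, h'.trans h, by rw [← res_trans h h', res_apply]⟩)
    (by
      rintro N hN a _ _ ⟨k, h, rfl⟩ ⟨l, h', rfl⟩
      have := congrArg (res (le_inf h h')) (hs k l)
      rw [res_trans, res_trans] at this
      rw [this])
    (by
      rintro N hN a a' _ _ ⟨k, h, rfl⟩ ⟨l, h', rfl⟩
      have := congrArg (res (le_inf h h')) (hs k l)
      rw [res_trans, res_trans] at this
      exact ⟨k, h, by rw [map_add, this]⟩)
    (by
      rintro N hN r a _ ⟨k, h, rfl⟩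
      exact ⟨k, h, by rw [map_smul]⟩)
    (fun i => ⟨0, fun N hN a ha y hy => by
      obtain ⟨k, hk⟩ := Opens.mem_iSup.1 (hN hy)
      exact ⟨N ⊓ V k, inf_le_left, ⟨hy, hk⟩, _, (res inf_le_right (s k)).op_mem _, k, inf_le_right,
        rfl⟩⟩)
  have hk (k : ι) : T (V k) (le_iSup V k) = (s k).op :=
    LinearMap.ext fun a => hTR _ _ _ _ ⟨k, le_rfl, by rw [res_self]⟩
  refine ⟨⟨T _ le_rfl, fun a => ?_, fun a => ?_, fun a f hf => ?_⟩, fun k => ?_, fun t ht => ?_⟩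
  · refine eq_of_cover (le_iSup V) le_rfl fun k => ?_
    rw [← hTres, ← hTres, hk, ← wcomp_res, (s k).op_wcomp]
  · refine mem_weightPart_of_local fun y hy => ?_
    obtain ⟨k, hyk⟩ := Opens.mem_iSup.1 hy
    refine ⟨V k, le_iSup V k, hyk, ?_⟩
    rw [← hTres, hk]
    exact (s k).op_mem _
  · refine eq_of_cover (le_iSup V) le_rfl fun k => ?_
    rw [← hTres, hk, map_mul (D.res _), (s k).op_mul _ _ (D.res_weightPart _ hf),
      map_mul (D.res _), ← hTres, hk]
  · refine res_eq_of_apply _ fun a => ?_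
    rw [← hTres, hk]
  · refine Functional.ext (LinearMap.ext fun a => eq_of_cover (le_iSup V) le_rfl fun k => ?_)
    rw [← res_apply, ht, ← hTres, hk]

/-- The functional given by the partial derivative with respect to a coordinate of weight one. -/
noncomputable def coord (c : Chart m D.toBigradedSheaf k) (j : Fin c.r) (hj : c.wt j = 1)
    {V : Opens Y} (hV : V ≤ c.dom) : D.Functional V :=
  ⟨c.partialDeriv j hV ∘ₗ D.wcomp V 1, fun a => by simp [wcomp_of_mem (wcomp_mem 1 a)],
    fun a => by
      refine weight_induction (P := fun a => c.partialDeriv j hV a ∈ D.weightPart V 0)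
        (fun a b ha hb => by rw [map_add]; exact add_mem ha hb)
        (fun p a ha => gr_le_weightPart _ _ _ (c.partialDeriv_mem j hV hj ha)) (wcomp_mem 1 a),
    fun a f hf => by
      rw [LinearMap.comp_apply, LinearMap.comp_apply, wcomp_mul hf]
      refine weight_induction
        (P := fun a => c.partialDeriv j hV (a * f) = c.partialDeriv j hV a * f)
        (fun a b ha hb => by rw [add_mul, map_add, map_add, ha, hb, add_mul])
        (fun p a ha => ?_) (wcomp_mem 1 a)
      rw [c.partialDeriv_mul j hV ha, c.partialDeriv_base j hV (by omega) hf]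
      simp⟩

omit [IsManifold (𝓡 m) ∞ Y] [T2Space Y] in
theorem coord_apply (c : Chart m D.toBigradedSheaf k) (j : Fin c.r) (hj : c.wt j = 1)
    (hV : V ≤ c.dom) {a : D.A V} (ha : a ∈ D.weightPart V 1) :
    (coord c j hj hV).op a = c.partialDeriv j hV a := by
  simp [coord, wcomp_of_mem ha]

omit [IsManifold (𝓡 m) ∞ Y] [T2Space Y] in
theorem coord_mem (c : Chart m D.toBigradedSheaf k) (j : Fin c.r) (hj : c.wt j = 1)
    (hV : V ≤ c.dom) : coord c j hj hV ∈ par V (c.par j + 1) := by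
  intro q a ha
  rw [coord_apply _ _ _ _ (gr_le_weightPart _ _ _ ha), add_assoc (c.par j), ZMod.self_add_self,
    add_zero]
  exact c.partialDeriv_mem j hV hj ha

theorem res_coord (c : Chart m D.toBigradedSheaf k) (j : Fin c.r) (hj : c.wt j = 1)
    (hV : V ≤ c.dom) (h : W ≤ V) : res h (coord c j hj hV) = coord c j hj (h.trans hV) :=
  res_eq_of_apply _ fun a => by
    simp [coord, wcomp_res, c.partialDeriv_res j hV h]

omit [IsManifold (𝓡 m) ∞ Y] [T2Space Y] in
/-- On a chart, a functional is determined by its values on the coordinates of weight one. -/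
theorem eq_sum_coord (c : Chart m D.toBigradedSheaf k) (hV : V ≤ c.dom) (l : D.Functional V) :
    l = ∑ j : {j // c.wt j = 1},
      (⟨l.op (c.genOn hV j), l.op_mem _⟩ : D.base V) • coord c j.1 j.2 hV := by
  refine ext_weight fun p a ha => ?_
  have ha' := gr_le_weightPart _ _ _ ha
  conv_lhs => rw [c.weight_one_eq_sum hV ha', map_sum]
  rw [sum_op, LinearMap.sum_apply]
  simp only [smul_apply, coord_apply c _ _ hV ha']
  rw [← Finset.sum_filter_of_ne (p := fun j => c.wt j = 1)
    (by intro j _ h; by_contra h'; simp [h'] at h), Finset.sum_subtype _ (p := fun j => c.wt j = 1)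
    (by simp)]
  refine Finset.sum_congr rfl fun j _ => ?_
  rw [if_pos j.2, l.op_mul]
  exact gr_le_weightPart _ _ _ (c.partialDeriv_mem j.1 hV j.2 ha)

theorem locally_free (y : Y) : ∃ (V : Opens Y) (r : ℕ) (p : Fin r → ZMod 2)
    (e : Fin r → D.Functional V), y ∈ V ∧ (∀ j, e j ∈ par V (p j)) ∧
    ∀ (W : Opens Y) (h : W ≤ V) (s : D.Functional W),
      ∃! c : Fin r → D.base W, s = ∑ j, c j • res h (e j) := by
  obtain ⟨c, hy⟩ := D.exists_chart y
  let E := (Fintype.equivFin {j // c.wt j = 1}).symm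
  refine ⟨c.dom, _, fun j => c.par (E j).1 + 1, fun j => coord c (E j).1 (E j).2 le_rfl, hy,
    fun j => coord_mem _ _ _ _, fun W h s => ?_⟩
  refine ⟨fun j => ⟨s.op (c.genOn h (E j)), s.op_mem _⟩, ?_, fun b hb => ?_⟩
  · simp only [res_coord]
    rw [Equiv.sum_comp E fun j : {j // c.wt j = 1} =>
      (⟨s.op (c.genOn h j), s.op_mem _⟩ : D.base W) • coord c j.1 j.2 _]
    exact eq_sum_coord c h s
  · funext i
    refine Subtype.ext ?_
    simp only at hb
    have hw : c.genOn h (E i).1 ∈ D.weightPart W 1 := by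
      have := c.genOn_mem h (E i).1
      rw [(E i).2] at this
      exact gr_le_weightPart _ _ _ this
    dsimp only
    rw [hb, sum_op, LinearMap.sum_apply, Finset.sum_eq_single i]
    · rw [smul_apply, res_coord, coord_apply _ _ _ _ hw, c.partialDeriv_gen, if_pos rfl, mul_one]
    · intro j _ hj
      rw [smul_apply, res_coord, coord_apply _ _ _ _ hw, c.partialDeriv_gen, if_neg, mul_zero]
      exact fun e => hj (E.injective (Subtype.ext e.symm))
    · simp

end

end Functional

section
variable {m : ℕ} {Y : Type u} [TopologicalSpace Y] [ChartedSpace (EuclideanSpace ℝ (Fin m)) Y]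
  [IsManifold (𝓡 m) ∞ Y] [T2Space Y] {k : ℕ} (D : GradedSuperBundle.{u, v} m Y k)

/-- The vector bundle whose sections are the functionals on functions of weight one. -/
noncomputable def dualBundle : SuperVectorBundle.{u, v, v} D.toBigradedSheaf where
  Sec := D.Functional
  par := Functional.par
  internal := Functional.par_internal
  smul_mem := Functional.smul_mem
  res := Functional.res
  res_smul := Functional.res_smul
  res_mem := Functional.res_mem
  res_id := Functional.res_self
  res_res := Functional.res_trans
  gluing := Functional.gluing
  locally_free := Functional.locally_free

omit [IsManifold (𝓡 m) ∞ Y] [T2Space Y] in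
theorem exists_functional_of_linearMap (V : Opens Y) (p : ZMod 2)
    (l : D.weightPart V 1 →ₗ[ℝ] D.base V)
    (hl : ∀ (q : ZMod 2) (α : D.weightPart V 1), α.1 ∈ D.gr V (1, q) →
      (l α : D.A V) ∈ D.gr V (0, p + 1 + q))
    (hmul : ∀ (q : ZMod 2) (f : D.base V) (α β : D.weightPart V 1), (f : D.A V) ∈ D.gr V (0, q) →
      β.1 = f.1 * α.1 → l β = sgn ((p + 1) * q) • (f * l α)) :
    ∃ s ∈ Functional.par V p, ∀ α : D.weightPart V 1, s.op α.1 = l α := by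
  obtain ⟨T, hT⟩ : ∃ T : D.A V →ₗ[ℝ] D.A V, ∀ a, T a = l ⟨D.wcomp V 1 a, wcomp_mem 1 a⟩ :=
    ⟨(D.base V).val.toLinearMap ∘ₗ l ∘ₗ (D.wcomp V 1).codRestrict (D.weightPart V 1) (wcomp_mem 1),
      fun a => rfl⟩
  have hT1 (a : D.A V) (ha : a ∈ D.weightPart V 1) : T a = l ⟨a, ha⟩ := by
    rw [hT]
    congr 2
    exact Subtype.ext (wcomp_of_mem ha)
  have hT0 (a : D.A V) (ha : D.wcomp V 1 a = 0) : T a = 0 := by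
    have e : (⟨D.wcomp V 1 a, wcomp_mem 1 a⟩ : D.weightPart V 1) = 0 := Subtype.ext ha
    rw [hT, e, map_zero]
    rfl
  have hTw (a : D.A V) : T (D.wcomp V 1 a) = T a := by
    rw [hT1 _ (wcomp_mem 1 a), hT]
  have hTgr (q : ZMod 2) (a : D.A V) (ha : a ∈ D.gr V (1, q)) : T a ∈ D.gr V (0, p + 1 + q) := by
    rw [hT1 a (gr_le_weightPart _ _ _ ha)]
    exact hl q _ ha
  have hTmul (q : ZMod 2) (f a : D.A V) (hf : f ∈ D.gr V (0, q)) (ha : a ∈ D.weightPart V 1)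
      (h : f * a ∈ D.weightPart V 1) : T (f * a) = sgn ((p + 1) * q) • (f * T a) := by
    rw [hT1 a ha, hT1 _ h, hmul q ⟨f, gr_le_weightPart _ _ _ hf⟩ ⟨a, ha⟩ ⟨f * a, h⟩ hf rfl]
    rfl
  refine ⟨⟨T, hTw, fun a => ?_, fun a f hf => ?_⟩, fun q a ha => hTgr q a ha, fun α => hT1 _ α.2⟩
  · rw [hT]
    exact (l _).2
  · refine weight_induction (P := fun f => T (a * f) = T a * f)
      (fun f g h h' => by rw [mul_add, map_add, h, h', mul_add]) (fun r f hf => ?_) hf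
    have hf' := gr_le_weightPart _ _ _ hf
    refine homog_induction (P := fun a => T (a * f) = T a * f) (by simp)
      (fun a b ha hb => by rw [add_mul, map_add, ha, hb, map_add, add_mul]) (fun i a ha => ?_) a
    obtain ⟨w, q⟩ := i
    have h1 := gr_le_weightPart _ _ _ ha
    by_cases hw : w = 1
    · subst hw
      have h2 : a * f ∈ D.weightPart V 1 := mul_base_mem h1 hf'
      have h3 : f * a = sgn (r * q) • (a * f) := D.supercomm hf ha
      have h5 := hTmul r f a hf h1 (h3 ▸ Submodule.smul_mem _ _ h2)
      rw [h3, map_smul, D.supercomm hf (hTgr q a ha), smul_smul] at h5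
      dsimp only at h5
      rw [mul_add r, sgn_add, ← mul_assoc, mul_comm (p + 1) r, sgn_mul_self, one_mul] at h5
      have := congrArg (sgn (r * q) • ·) h5
      simpa only [sgn_smul_sgn_smul] using this
    · rw [hT0 a (wcomp_of_mem_ne h1 hw), hT0, zero_mul]
      exact wcomp_of_mem_ne (mul_base_mem h1 hf') hw

/-- The evaluation pairing between functionals and functions of weight one. -/
noncomputable def dualPairing : LinearFunctionsPairing (dualBundle D) where
  pair V :=
    { toFun := fun s => LinearMap.codRestrict (D.base V).toSubmodule
        (Functional.op (B := D.toBigradedSheaf) s ∘ₗ (D.weightPart V 1).subtype)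
        (fun α => Functional.op_mem s α.1)
      map_add' := fun _ _ => rfl
      map_smul' := fun _ _ => rfl }
  pair_res h s α := Subtype.ext (Functional.res_apply h s α.1).symm
  pair_smul _ _ _ := rfl
  pair_mem hs hα := hs _ _ hα
  pair_linear {V p q s f} α β hs hf hβ := Subtype.ext (by
    have := Functional.apply_mul hs hf α.1
    rw [← hβ] at this
    exact this)
  perfect V p l hl hmul := by
    obtain ⟨s, hs, h⟩ := exists_functional_of_linearMap D V p l hl hmul
    refine ⟨s, ⟨hs, LinearMap.ext fun α => Subtype.ext (h α)⟩, fun t ht => ?_⟩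
    refine Functional.ext_weight fun q a ha => ?_
    have := LinearMap.congr_fun ht.2 ⟨a, gr_le_weightPart _ _ _ ha⟩
    rw [h ⟨a, gr_le_weightPart _ _ _ ha⟩, ← this]
    rfl

end

end BigradedSheaf

namespace BigradedSheaf

/-! ### The derived bracket -/

section
variable {m : ℕ} {Y : Type u} [TopologicalSpace Y] [ChartedSpace (EuclideanSpace ℝ (Fin m)) Y]
  [IsManifold (𝓡 m) ∞ Y] [T2Space Y] {k : ℕ}

/-- The data from which an almost Lie algebroid structure on the dual bundle is derived: an odd
vector field `Q` of weight one, whose square kills the functions on the base, and a lift `lift` of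
functionals to vector fields of weight `-1`, linear over the base. Only the action of the lifts on
functions of weight two is recorded. -/
structure DerivedData (D : GradedSuperBundle.{u, v} m Y k) where
  /-- The odd vector field of weight one. -/
  Q : ∀ V, D.A V →ₗ[ℝ] D.A V
  Q_res : ∀ {V W} (h : W ≤ V) (a : D.A V), Q W (D.res h a) = D.res h (Q V a)
  Q_mem : ∀ {V w p} {a : D.A V}, a ∈ D.gr V (w, p) → Q V a ∈ D.gr V (w + 1, p + 1)
  Q_mul : ∀ {V w p} {a : D.A V} (b : D.A V), a ∈ D.gr V (w, p) →
    Q V (a * b) = Q V a * b + sgn p • (a * Q V b)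
  Q_sq : ∀ {V} {a : D.A V}, a ∈ D.weightPart V 0 → Q V (Q V a) = 0
  /-- The action of the lift of a functional on functions of weight two. -/
  lift : ∀ V, D.Functional V →ₗ[ℝ] D.A V →ₗ[ℝ] D.A V
  lift_res : ∀ {V W} (h : W ≤ V) (l : D.Functional V) (a : D.A V),
    lift W (Functional.res h l) (D.res h a) = D.res h (lift V l a)
  lift_smul : ∀ {V} (f : D.base V) (l : D.Functional V) (a : D.A V),
    lift V (f • l) a = f * lift V l a
  lift_of_ne : ∀ {V} (l : D.Functional V) {i} {a : D.A V}, a ∈ D.gr V i → i.1 ≠ 2 → lift V l a = 0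
  lift_mem : ∀ {V p q} {l : D.Functional V} {a : D.A V}, l ∈ Functional.par V p →
    a ∈ D.gr V (2, q) → lift V l a ∈ D.gr V (1, p + 1 + q)
  lift_mul : ∀ {V p q} {l : D.Functional V} {a b : D.A V}, l ∈ Functional.par V p →
    a ∈ D.gr V (1, q) → b ∈ D.weightPart V 1 →
    lift V l (a * b) = l.op a * b + sgn ((p + 1) * q) • (a * l.op b)
  lift_mul_base : ∀ {V q} (l : D.Functional V) {a f : D.A V}, a ∈ D.gr V (2, q) →
    f ∈ D.weightPart V 0 → lift V l (a * f) = lift V l a * f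

namespace DerivedData

variable {D : GradedSuperBundle.{u, v} m Y k} (d : DerivedData D) {V W : Opens Y}

theorem Q_weight {w : ℕ} {a : D.A V} (ha : a ∈ D.weightPart V w) :
    d.Q V a ∈ D.weightPart V (w + 1) :=
  weight_induction (P := fun a => d.Q V a ∈ D.weightPart V (w + 1))
    (fun a b ha hb => by rw [map_add]; exact add_mem ha hb)
    (fun p a ha => gr_le_weightPart _ _ _ (d.Q_mem ha)) ha

/-- The action of a section on functions on the base. -/
noncomputable def anchor (V : Opens Y) : D.Functional V →ₗ[ℝ] D.base V →ₗ[ℝ] D.base V :=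
  LinearMap.mk₂ ℝ (fun l f => ⟨-l.op (d.Q V f.1), neg_mem (l.op_mem _)⟩)
    (fun l l' f => Subtype.ext (by simp [add_comm]))
    (fun r l f => Subtype.ext (by simp))
    (fun l f f' => Subtype.ext (by simp [add_comm]))
    (fun r l f => Subtype.ext (by simp))

theorem anchor_coe (l : D.Functional V) (f : D.base V) :
    (d.anchor V l f : D.A V) = -l.op (d.Q V f.1) := rfl

theorem anchor_res (h : W ≤ V) (l : D.Functional V) (f : D.base V) :
    D.baseRes h (d.anchor V l f) = d.anchor W (Functional.res h l) (D.baseRes h f) :=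
  Subtype.ext (by
    rw [anchor_coe]
    change D.res h (-l.op (d.Q V f.1)) = -(Functional.res h l).op (d.Q W (D.res h f.1))
    rw [d.Q_res, Functional.res_apply, map_neg])

theorem anchor_mem {p q : ZMod 2} {l : D.Functional V} {f : D.base V}
    (hl : l ∈ Functional.par V p) (hf : (f : D.A V) ∈ D.gr V (0, q)) :
    (d.anchor V l f : D.A V) ∈ D.gr V (0, p + q) := by
  have := hl _ _ (d.Q_mem hf)
  rw [add_add_add_comm, add_comm 1 1, ← add_assoc, add_assoc (p + q), ZMod.self_add_self,
    add_zero] at this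
  exact neg_mem this

theorem anchor_leibniz {p q : ZMod 2} {l : D.Functional V} {f : D.base V} (g : D.base V)
    (hl : l ∈ Functional.par V p) (hf : (f : D.A V) ∈ D.gr V (0, q)) :
    d.anchor V l (f * g) = d.anchor V l f * g + sgn (p * q) • (f * d.anchor V l g) := by
  refine Subtype.ext ?_
  change -l.op (d.Q V (f.1 * g.1)) = -l.op (d.Q V f.1) * g.1
    + sgn (p * q) • (f.1 * -l.op (d.Q V g.1))
  rw [d.Q_mul _ hf, map_add, map_smul, l.op_mul _ _ g.2, Functional.apply_mul hl hf]
  rcases p.eq_zero_or_one with rfl | rfl <;> rcases q.eq_zero_or_one with rfl | rfl <;>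
    simp [ZMod.self_add_self] <;> abel

theorem anchor_smul (f : D.base V) (l : D.Functional V) (g : D.base V) :
    d.anchor V (f • l) g = f * d.anchor V l g :=
  Subtype.ext (by
    change -(f.1 * l.op (d.Q V g.1)) = f.1 * -l.op (d.Q V g.1)
    rw [mul_neg])

/-- The operator underlying the bracket of a functional of parity `p` and one of parity `q`: half
the graded skew-symmetrization, with respect to the two functionals, of the derived bracket of their
lifts with `Q`. -/
noncomputable def bracketOp (V : Opens Y) (p q : ZMod 2) :
    D.Functional V →ₗ[ℝ] D.Functional V →ₗ[ℝ] D.A V →ₗ[ℝ] D.A V :=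
  LinearMap.mk₂ ℝ (fun l l' => -(l.op ∘ₗ d.Q V ∘ₗ l'.op) + sgn (p * q) • (l'.op ∘ₗ d.Q V ∘ₗ l.op)
      + (2⁻¹ : ℝ) • (sgn (p * q + p) • (l'.op ∘ₗ d.lift V l ∘ₗ d.Q V)
        - sgn q • (l.op ∘ₗ d.lift V l' ∘ₗ d.Q V)))
    (fun l₁ l₂ l' => LinearMap.ext fun a => by simp; module)
    (fun r l l' => LinearMap.ext fun a => by simp; module)
    (fun l l₁ l₂ => LinearMap.ext fun a => by simp; module)
    (fun r l l' => LinearMap.ext fun a => by simp; module)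

theorem bracketOp_apply (p q : ZMod 2) (l l' : D.Functional V) (a : D.A V) :
    d.bracketOp V p q l l' a = -l.op (d.Q V (l'.op a)) + sgn (p * q) • l'.op (d.Q V (l.op a))
      + (2⁻¹ : ℝ) • (sgn (p * q + p) • l'.op (d.lift V l (d.Q V a))
        - sgn q • l.op (d.lift V l' (d.Q V a))) := rfl

theorem bracketOp_of_ne (p q : ZMod 2) (l l' : D.Functional V) {i : ℕ × ZMod 2} {a : D.A V}
    (ha : a ∈ D.gr V i) (hi : i.1 ≠ 1) : d.bracketOp V p q l l' a = 0 := by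
  have hQ := d.Q_mem (w := i.1) (p := i.2) ha
  rw [bracketOp_apply, l.apply_of_ne ha hi, l'.apply_of_ne ha hi,
    d.lift_of_ne l hQ (by simpa using hi), d.lift_of_ne l' hQ (by simpa using hi)]
  simp

theorem bracketOp_wcomp (p q : ZMod 2) (l l' : D.Functional V) (a : D.A V) :
    d.bracketOp V p q l l' (D.wcomp V 1 a) = d.bracketOp V p q l l' a := by
  refine homog_induction (P := fun a => d.bracketOp V p q l l' (D.wcomp V 1 a)
    = d.bracketOp V p q l l' a) (by simp)
    (fun a b ha hb => by rw [map_add, map_add, map_add, ha, hb]) (fun i a ha => ?_) a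
  by_cases hi : i.1 = 1
  · obtain ⟨w, r⟩ := i
    subst hi
    rw [wcomp_of_mem_gr ha]
  · rw [wcomp_of_mem_gr_ne (p := i.2) ha hi, d.bracketOp_of_ne p q l l' ha hi, map_zero]

theorem bracketOp_mem_weight (p q : ZMod 2) (l l' : D.Functional V) (a : D.A V) :
    d.bracketOp V p q l l' a ∈ D.weightPart V 0 :=
  add_mem (add_mem (neg_mem (l.op_mem _)) (Submodule.smul_mem _ _ (l'.op_mem _)))
    (Submodule.smul_mem _ _ (sub_mem (Submodule.smul_mem _ _ (l'.op_mem _))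
      (Submodule.smul_mem _ _ (l.op_mem _))))

/-- The operator underlying the bracket is linear over the base, although none of its four terms
is: owing to the factor `1 / 2` the terms which contain `Q f` cancel. -/
theorem bracketOp_mul {p q : ZMod 2} {l l' : D.Functional V} (hl : l ∈ Functional.par V p)
    (hl' : l' ∈ Functional.par V q) (a : D.A V) {f : D.A V} (hf : f ∈ D.weightPart V 0) :
    d.bracketOp V p q l l' (a * f) = d.bracketOp V p q l l' a * f := by
  refine weight_induction (P := fun f => d.bracketOp V p q l l' (a * f)
    = d.bracketOp V p q l l' a * f)
    (fun f g h h' => by rw [mul_add, map_add, h, h', mul_add]) (fun r f hf => ?_) hf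
  have hf' := gr_le_weightPart _ _ _ hf
  refine homog_induction (P := fun a => d.bracketOp V p q l l' (a * f)
    = d.bracketOp V p q l l' a * f) (by simp)
    (fun a b ha hb => by rw [add_mul, map_add, ha, hb, map_add, add_mul]) (fun i a ha => ?_) a
  by_cases hi : i.1 = 1
  · obtain ⟨w, s⟩ := i
    subst hi
    have hQf : d.Q V f ∈ D.weightPart V 1 := d.Q_weight hf'
    have hQa := d.Q_mem ha
    have e1 : l.op (d.Q V (l'.op (a * f))) = l.op (d.Q V (l'.op a)) * f
        + sgn (q + 1 + s) • sgn ((p + 1) * (q + 1 + s)) • (l'.op a * l.op (d.Q V f)) := by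
      rw [l'.op_mul _ _ hf', d.Q_mul _ (hl' s a ha), map_add, map_smul, l.op_mul _ _ hf',
        Functional.apply_mul hl (hl' s a ha)]
    have e2 : l'.op (d.Q V (l.op (a * f))) = l'.op (d.Q V (l.op a)) * f
        + sgn (p + 1 + s) • sgn ((q + 1) * (p + 1 + s)) • (l.op a * l'.op (d.Q V f)) := by
      rw [l.op_mul _ _ hf', d.Q_mul _ (hl s a ha), map_add, map_smul, l'.op_mul _ _ hf',
        Functional.apply_mul hl' (hl s a ha)]
    have e3 : l'.op (d.lift V l (d.Q V (a * f))) = l'.op (d.lift V l (d.Q V a)) * f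
        + sgn s • (sgn ((q + 1) * (p + 1 + s)) • (l.op a * l'.op (d.Q V f))
          + sgn ((p + 1) * s) • (l'.op a * l.op (d.Q V f))) := by
      rw [d.Q_mul _ ha, map_add, map_smul, d.lift_mul_base l hQa hf', d.lift_mul hl ha hQf,
        map_add, map_smul, map_add, map_smul, l'.op_mul _ _ hf',
        Functional.apply_mul hl' (hl s a ha), l'.op_mul _ _ (l.op_mem _)]
    have e4 : l.op (d.lift V l' (d.Q V (a * f))) = l.op (d.lift V l' (d.Q V a)) * f
        + sgn s • (sgn ((p + 1) * (q + 1 + s)) • (l'.op a * l.op (d.Q V f))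
          + sgn ((q + 1) * s) • (l.op a * l'.op (d.Q V f))) := by
      rw [d.Q_mul _ ha, map_add, map_smul, d.lift_mul_base l' hQa hf', d.lift_mul hl' ha hQf,
        map_add, map_smul, map_add, map_smul, l.op_mul _ _ hf',
        Functional.apply_mul hl (hl' s a ha), l.op_mul _ _ (l'.op_mem _)]
    rw [bracketOp_apply, bracketOp_apply, e1, e2, e3, e4]
    simp only [add_mul, neg_mul, smul_mul_assoc, sub_mul]
    generalize l.op (d.Q V (l'.op a)) * f = x1
    generalize l'.op (d.Q V (l.op a)) * f = x2
    generalize l'.op (d.lift V l (d.Q V a)) * f = x3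
    generalize l.op (d.lift V l' (d.Q V a)) * f = x4
    generalize l'.op a * l.op (d.Q V f) = x5
    generalize l.op a * l'.op (d.Q V f) = x6
    have e : (1 : ZMod 2) + 1 = 0 := by decide
    rcases p.eq_zero_or_one with rfl | rfl <;> rcases q.eq_zero_or_one with rfl | rfl <;>
      rcases s.eq_zero_or_one with rfl | rfl <;> simp [e] <;> module
  · have h2 := D.mul_mem ha hf
    rw [d.bracketOp_of_ne p q l l' ha hi, d.bracketOp_of_ne p q l l' h2 (by simpa using hi),
      zero_mul]

theorem bracketOp_mem {p q : ZMod 2} {l l' : D.Functional V} (hl : l ∈ Functional.par V p)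
    (hl' : l' ∈ Functional.par V q) {s : ZMod 2} {a : D.A V} (ha : a ∈ D.gr V (1, s)) :
    d.bracketOp V p q l l' a ∈ D.gr V (0, p + q + 1 + s) := by
  have h1 := hl _ _ (d.Q_mem (hl' s a ha))
  have h2 := hl' _ _ (d.Q_mem (hl s a ha))
  have h3 := hl' _ _ (d.lift_mem hl (d.Q_mem ha))
  have h4 := hl _ _ (d.lift_mem hl' (d.Q_mem ha))
  have e1 : p + 1 + (q + 1 + s + 1) = p + q + 1 + s := by linear_combination ZMod.self_add_self 1
  have e2 : q + 1 + (p + 1 + s + 1) = p + q + 1 + s := by linear_combination ZMod.self_add_self 1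
  have e3 : q + 1 + (p + 1 + (s + 1)) = p + q + 1 + s := by
    linear_combination ZMod.self_add_self 1
  have e4 : p + 1 + (q + 1 + (s + 1)) = p + q + 1 + s := by
    linear_combination ZMod.self_add_self 1
  rw [e1] at h1; rw [e2] at h2; rw [e3] at h3; rw [e4] at h4
  exact add_mem (add_mem (neg_mem h1) (Submodule.smul_mem _ _ h2))
    (Submodule.smul_mem _ _ (sub_mem (Submodule.smul_mem _ _ h3) (Submodule.smul_mem _ _ h4)))

open Functional in
/-- The operator underlying the bracket of two functionals. -/
noncomputable def totalOp (V : Opens Y) :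
    D.Functional V →ₗ[ℝ] D.Functional V →ₗ[ℝ] D.A V →ₗ[ℝ] D.A V :=
  ∑ p : ZMod 2, ∑ q : ZMod 2, (d.bracketOp V p q).compl₁₂ (parityPart p) (parityPart q)

open Functional in
theorem totalOp_apply (l l' : D.Functional V) : d.totalOp V l l'
    = ∑ p : ZMod 2, ∑ q : ZMod 2, d.bracketOp V p q (parityPart p l) (parityPart q l') := by
  simp [totalOp, LinearMap.sum_apply]

/-- The bracket of functionals. -/
noncomputable def bracket (V : Opens Y) :
    D.Functional V →ₗ[ℝ] D.Functional V →ₗ[ℝ] D.Functional V :=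
  LinearMap.mk₂ ℝ (fun l l' => ⟨d.totalOp V l l',
      fun a => by simp only [totalOp_apply, LinearMap.sum_apply, bracketOp_wcomp],
      fun a => by
        simp only [totalOp_apply, LinearMap.sum_apply]
        exact Submodule.sum_mem _ fun p _ => Submodule.sum_mem _ fun q _ =>
          d.bracketOp_mem_weight _ _ _ _ _,
      fun a f hf => by
        simp only [totalOp_apply, LinearMap.sum_apply, Finset.sum_mul,
          d.bracketOp_mul (Functional.parityPart_mem _ _) (Functional.parityPart_mem _ _) a hf]⟩)
    (fun l₁ l₂ l' => Functional.ext (by simp))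
    (fun r l l' => Functional.ext (by simp))
    (fun l l₁ l₂ => Functional.ext (by simp))
    (fun r l l' => Functional.ext (by simp))

theorem bracket_op {p q : ZMod 2} {l l' : D.Functional V} (hl : l ∈ Functional.par V p)
    (hl' : l' ∈ Functional.par V q) : (d.bracket V l l').op = d.bracketOp V p q l l' := by
  change d.totalOp V l l' = _
  rw [totalOp_apply, Finset.sum_eq_single p, Finset.sum_eq_single q,
    Functional.parityPart_of_mem hl, Functional.parityPart_of_mem hl']
  · intro q' _ h
    rw [Functional.parityPart_of_mem_ne (Ne.symm h) hl', map_zero]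
  · simp
  · intro p' _ h
    simp [Functional.parityPart_of_mem_ne (Ne.symm h) hl]
  · simp

theorem bracket_apply {p q : ZMod 2} {l l' : D.Functional V} (hl : l ∈ Functional.par V p)
    (hl' : l' ∈ Functional.par V q) (a : D.A V) : (d.bracket V l l').op a
      = -l.op (d.Q V (l'.op a)) + sgn (p * q) • l'.op (d.Q V (l.op a))
      + (2⁻¹ : ℝ) • (sgn (p * q + p) • l'.op (d.lift V l (d.Q V a))
        - sgn q • l.op (d.lift V l' (d.Q V a))) := by
  rw [d.bracket_op hl hl', bracketOp_apply]

theorem bracket_mem {p q : ZMod 2} {l l' : D.Functional V} (hl : l ∈ Functional.par V p)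
    (hl' : l' ∈ Functional.par V q) : d.bracket V l l' ∈ Functional.par V (p + q) :=
  fun s a ha => by rw [d.bracket_op hl hl']; exact d.bracketOp_mem hl hl' ha

omit [IsManifold (𝓡 m) ∞ Y] [T2Space Y] in
/-- A bilinear identity for functionals follows from the homogeneous case. -/
theorem parity_induction {P : D.Functional V → Prop} (hadd : ∀ l l', P l → P l' → P (l + l'))
    (hom : ∀ p, ∀ l ∈ Functional.par V p, P l) (l : D.Functional V) : P l := by
  rw [← Functional.parityPart_add l]
  exact hadd _ _ (hom _ _ (Functional.parityPart_mem _ _))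
    (hom _ _ (Functional.parityPart_mem _ _))

theorem bracket_res (h : W ≤ V) (l l' : D.Functional V) : Functional.res h (d.bracket V l l')
    = d.bracket W (Functional.res h l) (Functional.res h l') := by
  refine parity_induction (P := fun l => Functional.res h (d.bracket V l l')
    = d.bracket W (Functional.res h l) (Functional.res h l'))
    (fun l₁ l₂ h₁ h₂ => by simp only [map_add, LinearMap.add_apply, h₁, h₂]) (fun p l hl => ?_) l
  refine parity_induction (P := fun l' => Functional.res h (d.bracket V l l')
    = d.bracket W (Functional.res h l) (Functional.res h l'))
    (fun l₁ l₂ h₁ h₂ => by simp only [map_add, h₁, h₂]) (fun q l' hl' => ?_) l'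
  refine Functional.res_eq_of_apply h fun a => ?_
  rw [d.bracket_apply hl hl', d.bracket_apply (Functional.res_mem h hl) (Functional.res_mem h hl')]
  simp only [d.Q_res, Functional.res_apply, d.lift_res, map_add, map_neg, map_smul, map_sub]

theorem bracket_skew {p q : ZMod 2} {l l' : D.Functional V} (hl : l ∈ Functional.par V p)
    (hl' : l' ∈ Functional.par V q) :
    d.bracket V l l' = -(sgn (p * q) • d.bracket V l' l) := by
  refine Functional.ext (LinearMap.ext fun a => ?_)
  rw [Functional.neg_op, Functional.smul_op, LinearMap.neg_apply, LinearMap.smul_apply,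
    d.bracket_apply hl hl', d.bracket_apply hl' hl]
  have e : (1 : ZMod 2) + 1 = 0 := by decide
  rcases p.eq_zero_or_one with rfl | rfl <;> rcases q.eq_zero_or_one with rfl | rfl <;>
    simp [e] <;> module

theorem bracket_leibniz {p q : ZMod 2} {l : D.Functional V} {f : D.base V} (l' : D.Functional V)
    (hl : l ∈ Functional.par V p) (hf : (f : D.A V) ∈ D.gr V (0, q)) :
    d.bracket V l (f • l')
      = d.anchor V l f • l' + sgn (q * p) • (f • d.bracket V l l') := by
  refine parity_induction (P := fun l' => d.bracket V l (f • l')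
      = d.anchor V l f • l' + sgn (q * p) • (f • d.bracket V l l'))
    (fun l₁ l₂ h₁ h₂ => by
      simp only [map_add, smul_add, h₁, h₂]
      abel) (fun r l' hl' => Functional.ext_weight fun s a ha => ?_) l'
  have hl'a := hl' s a ha
  have hf' := f.2
  have e1 : l.op (d.Q V (f.1 * l'.op a)) = l.op (d.Q V f.1) * l'.op a
      + sgn q • sgn ((p + 1) * q) • (f.1 * l.op (d.Q V (l'.op a))) := by
    rw [d.Q_mul _ hf, map_add, map_smul, l.op_mul _ _ (l'.op_mem _), Functional.apply_mul hl hf]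
  rw [d.bracket_apply hl (Functional.smul_mem hf hl'), Functional.add_op, Functional.smul_op,
    LinearMap.add_apply, LinearMap.smul_apply, Functional.smul_apply, Functional.smul_apply,
    Functional.smul_apply, Functional.smul_apply, Functional.smul_apply, d.bracket_apply hl hl',
    anchor_coe, d.lift_smul, e1, Functional.apply_mul hl hf]
  simp only [mul_add, mul_sub, mul_smul_comm, mul_neg, neg_mul]
  generalize l.op (d.Q V f.1) * l'.op a = x1
  generalize f.1 * l.op (d.Q V (l'.op a)) = x2
  generalize f.1 * l'.op (d.Q V (l.op a)) = x3
  generalize f.1 * l'.op (d.lift V l (d.Q V a)) = x4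
  generalize f.1 * l.op (d.lift V l' (d.Q V a)) = x5
  have e : (1 : ZMod 2) + 1 = 0 := by decide
  rcases p.eq_zero_or_one with rfl | rfl <;> rcases q.eq_zero_or_one with rfl | rfl <;>
    rcases r.eq_zero_or_one with rfl | rfl <;> simp [e] <;> module

theorem anchor_bracket {p q : ZMod 2} {l l' : D.Functional V} (f : D.base V)
    (hl : l ∈ Functional.par V p) (hl' : l' ∈ Functional.par V q) :
    d.anchor V l (d.anchor V l' f) - sgn (p * q) • d.anchor V l' (d.anchor V l f)
      = d.anchor V (d.bracket V l l') f := by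
  refine Subtype.ext ?_
  change -l.op (d.Q V (-l'.op (d.Q V f.1))) - sgn (p * q) • -l'.op (d.Q V (-l.op (d.Q V f.1)))
    = -(d.bracket V l l').op (d.Q V f.1)
  rw [d.bracket_apply hl hl', d.Q_sq f.2]
  simp only [map_neg, map_zero, smul_zero, sub_zero, add_zero, neg_neg, neg_add]
  abel

/-- The almost Lie algebroid defined by an odd vector field and a lift. -/
noncomputable def almostLieAlgebroid : AlmostLieAlgebroid.{u, v, v} D.toBigradedSheaf where
  toSuperVectorBundle := dualBundle D
  anchor := d.anchor
  anchor_res := d.anchor_res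
  anchor_mem := d.anchor_mem
  anchor_leibniz := d.anchor_leibniz
  anchor_smul := d.anchor_smul
  bracket := d.bracket
  bracket_res := d.bracket_res
  bracket_mem := d.bracket_mem
  skew := d.bracket_skew
  leibniz := d.bracket_leibniz
  anchor_bracket := d.anchor_bracket

end DerivedData

end

end BigradedSheaf

/-! ### Poisson brackets and Hamiltonian vector fields tangent to a subbundle -/

namespace PoissonBracket

variable {n : ℕ} {X : Type u} [TopologicalSpace X] [ChartedSpace (EuclideanSpace ℝ (Fin n)) X]
  {F : GradedSuperBundle.{u, v} n X 2} (P : PoissonBracket F) {U : Opens X}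

theorem br_mem_sub {k l : ℕ} {p q : ZMod 2} {a b : F.A U} (ha : a ∈ F.gr U (k, p))
    (hb : b ∈ F.gr U (l, q)) : P.br U a b ∈ F.gr U (k + l - 2, p + q) := by
  by_cases h : k + l < 2
  · rw [P.br_eq_zero ha hb h]; exact zero_mem _
  · exact P.br_mem ha hb (by omega)

/-- The weight one component of a function determines the component of weight `-1` of its
Hamiltonian vector field. -/
theorem comp_br {w : ℕ} {q : ZMod 2} {a : F.A U} (ha : a ∈ F.gr U (w + 1, q)) (p : ZMod 2)
    (g : F.A U) : F.comp U (w, p + q) (P.br U g a) = P.br U (F.comp U (1, p) g) a := by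
  induction g using BigradedSheaf.homog_induction with
  | h0 => simp
  | hadd a b ha hb => simp [ha, hb]
  | hom i g hg =>
    obtain ⟨k, r⟩ := i
    by_cases h : ((k, r) : ℕ × ZMod 2) = (1, p)
    · obtain ⟨rfl, rfl⟩ := Prod.mk.inj h
      rw [BigradedSheaf.comp_of_mem hg, BigradedSheaf.comp_of_mem]
      exact P.br_mem hg ha (by omega)
    · rw [BigradedSheaf.comp_of_mem_ne hg h, map_zero, LinearMap.zero_apply]
      by_cases h' : k + (w + 1) < 2
      · rw [P.br_eq_zero hg ha h', map_zero]
      · refine BigradedSheaf.comp_of_mem_ne (P.br_mem_sub hg ha) fun e => h ?_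
        have h1 := congrArg Prod.fst e
        have h2 := add_right_cancel (congrArg Prod.snd e)
        dsimp only at h1 h2
        exact Prod.ext (by dsimp only; omega) h2

theorem mul_br {i j : ℕ × ZMod 2} {b c a : F.A U} {l : ℕ × ZMod 2} (hb : b ∈ F.gr U i)
    (hc : c ∈ F.gr U j) (ha : a ∈ F.gr U l) : P.br U (b * c) a
      = b * P.br U c a + sgn (j.2 * l.2) • (P.br U b a * c) := by
  rw [P.skew (F.mul_mem hb hc) ha, P.leibniz c ha hb, P.skew ha hb, P.skew ha hc]
  simp only [neg_mul, mul_neg, smul_neg, smul_add, neg_add, neg_neg, smul_mul_assoc, mul_smul_comm,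
    smul_smul]
  rw [add_comm]
  congr 2
  · rcases i.2.eq_zero_or_one with h | h <;> rcases j.2.eq_zero_or_one with h' | h' <;>
      rcases l.2.eq_zero_or_one with h'' | h'' <;> simp [h, h', h'', ZMod.self_add_self]
  · rcases i.2.eq_zero_or_one with h | h <;> rcases j.2.eq_zero_or_one with h' | h' <;>
      rcases l.2.eq_zero_or_one with h'' | h'' <;> simp [h, h', h'', ZMod.self_add_self]

/-- The matrix of brackets of the weight one coordinates in a nondegenerate chart has a left
inverse, the weight zero part of the inverse of the full matrix. -/
theorem exists_weight_one_inverse (c : BigradedSheaf.Chart n F.toBigradedSheaf 2)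
    (hc : IsUnit (Matrix.of fun s t => P.br c.dom (c.z s) (c.z t))) :
    ∃ N : Fin c.r → Fin c.r → F.A c.dom, ∀ j l, c.wt j = 1 → c.wt l = 1 →
      (∑ s, if c.wt s = 1 then N j s * P.br c.dom (c.gen s) (c.gen l) else 0)
        = if j = l then 1 else 0 := by
  obtain ⟨N, hN⟩ := hc.exists_left_inv
  refine ⟨fun j s => F.wcomp c.dom 0 (N (Sum.inr j) (Sum.inr s)), fun j l _ hl => ?_⟩
  have h := congrArg (F.wcomp c.dom 0) (congrFun (congrFun hN (Sum.inr j)) (Sum.inr l))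
  have hgl := c.gen_mem l
  rw [hl] at hgl
  rw [Matrix.mul_apply, Fintype.sum_sum_type, map_add, map_sum, map_sum, Finset.sum_eq_zero,
    zero_add, Matrix.one_apply] at h
  · refine Eq.trans (Finset.sum_congr rfl fun s _ => ?_) (h.trans ?_)
    · change _ = F.wcomp c.dom 0 (_ * P.br c.dom (c.gen s) (c.gen l))
      have hgs := c.gen_mem s
      have hw := c.wt_le s
      split_ifs with hs
      · rw [hs] at hgs
        have := P.br_mem (m := 0) hgs hgl rfl
        rw [BigradedSheaf.wcomp_mul (BigradedSheaf.gr_le_weightPart _ _ _ this)]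
      -- If `s` has weight zero, the bracket with `l` has negative weight; if it has weight two,
      -- the bracket has weight one and does not contribute to the part of weight zero.
      · by_cases hs0 : c.wt s = 0
        · rw [P.br_eq_zero hgs hgl (by omega), mul_zero, map_zero]
        · have hs2 : c.wt s = 2 := by omega
          rw [hs2] at hgs
          have hm := P.br_mem (m := 1) hgs hgl rfl
          symm
          generalize N (Sum.inr j) (Sum.inr s) = x
          induction x using BigradedSheaf.homog_induction with
          | h0 => simp
          | hadd a b ha hb => rw [add_mul, map_add, ha, hb, add_zero]
          | hom i a ha =>
            exact BigradedSheaf.wcomp_of_mem_gr_ne (l := i.1 + 1) (p := i.2 + _)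
              (F.mul_mem ha hm) (by omega)
    · simp only [Sum.inr.injEq]
      split_ifs
      · exact BigradedSheaf.wcomp_of_mem_gr (F.one_mem _)
      · exact map_zero _
  · intro a _
    have : P.br c.dom (c.emb c.dom le_rfl (c.coord a)) (c.gen l) = 0 :=
      P.br_eq_zero (c.emb_mem _ _ _) hgl (by omega)
    change F.wcomp c.dom 0 (_ * P.br c.dom (c.emb c.dom le_rfl (c.coord a)) (c.gen l)) = 0
    rw [this, mul_zero, map_zero]

end PoissonBracket

namespace GradedSubbundle

open BigradedSheaf

variable {n : ℕ} {X : Type u} [TopologicalSpace X] [ChartedSpace (EuclideanSpace ℝ (Fin n)) X]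
  {F : GradedSuperBundle.{u, v} n X 2} {m : ℕ} {Y : Type u} [TopologicalSpace Y]
  [ChartedSpace (EuclideanSpace ℝ (Fin m)) Y] (S : GradedSubbundle F m Y) (P : PoissonBracket F)

theorem pull_comp {U : Opens X} (i : ℕ × ZMod 2) (a : F.A U) :
    S.pull U (F.comp U i a) = S.D.comp (Opens.comap S.i U) i (S.pull U a) :=
  (comp_map (S.pull U).toLinearMap (fun _ _ ha => S.pull_mem ha) i a).symm

theorem pull_weightPart {U : Opens X} {k : ℕ} {a : F.A U} (ha : a ∈ F.weightPart U k) :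
    S.pull U a ∈ S.D.weightPart (Opens.comap S.i U) k :=
  weight_induction (P := fun a => S.pull U a ∈ S.D.weightPart (Opens.comap S.i U) k)
    (fun a b ha hb => by rw [map_add]; exact add_mem ha hb)
    (fun p a ha => gr_le_weightPart _ _ _ (S.pull_mem ha)) ha

theorem exists_comap_le {W : Opens X} {N : Opens Y} (hN : N ≤ Opens.comap S.i W) {y : Y}
    (hy : y ∈ N) : ∃ O : Opens X, O ≤ W ∧ S.i y ∈ O ∧ Opens.comap S.i O ≤ N := by
  obtain ⟨t, ht, htN⟩ := S.isEmbedding.isOpen_iff.1 N.isOpen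
  refine ⟨⟨t, ht⟩ ⊓ W, inf_le_right, ⟨?_, hN hy⟩, fun z hz => ?_⟩
  · have : y ∈ S.i ⁻¹' t := by rw [htN]; exact hy
    exact this
  · have : z ∈ S.i ⁻¹' t := hz.1
    rw [htN] at this
    exact this

/-- Homogeneous functions on a subbundle locally extend, to homogeneous functions on an open set
contained in a given one. -/
theorem exists_lift {W : Opens X} {N : Opens Y} {y : Y} (hy : y ∈ N) (hW : S.i y ∈ W)
    {j : ℕ × ZMod 2} {b : S.D.A N} (hb : b ∈ S.D.gr N j) :
    ∃ (O : Opens X) (hO : Opens.comap S.i O ≤ N), O ≤ W ∧ S.i y ∈ O ∧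
      ∃ a ∈ F.gr O j, S.pull O a = S.D.res hO b := by
  obtain ⟨O, hO, a, hyO, ha⟩ := S.surj N b y hy
  refine ⟨O ⊓ W, (Opens.comap_mono S.i inf_le_left).trans hO, inf_le_right, ⟨hyO, hW⟩,
    F.comp _ j (F.res inf_le_left a), comp_mem _ _, ?_⟩
  rw [pull_comp, S.pull_res inf_le_left, ha, S.D.res_res, comp_of_mem (S.D.res_mem _ hb)]

/-- Finitely many functions on a subbundle locally extend simultaneously. -/
theorem exists_lift_fin {W : Opens X} {y : Y} (hW : S.i y ∈ W) {N : ℕ}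
    (b : Fin N → S.D.A (Opens.comap S.i W)) :
    ∃ (O : Opens X) (hO : O ≤ W), S.i y ∈ O ∧ ∃ a : Fin N → F.A O,
      ∀ t, S.pull O (a t) = S.D.res (Opens.comap_mono S.i hO) (b t) := by
  induction N with
  | zero => exact ⟨W, le_rfl, hW, fun t => t.elim0, fun t => t.elim0⟩
  | succ N ih =>
    obtain ⟨O, hO, hyO, a, ha⟩ := ih (fun t => b t.castSucc)
    obtain ⟨O', hO', a', hyO', ha'⟩ := S.surj _ (b (Fin.last N)) y hW
    refine ⟨O ⊓ O', inf_le_left.trans hO, ⟨hyO, hyO'⟩,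
      Fin.lastCases (F.res inf_le_right a') fun t => F.res inf_le_left (a t), fun t => ?_⟩
    refine Fin.lastCases ?_ (fun t => ?_) t
    · simp only [Fin.lastCases_last]
      rw [S.pull_res inf_le_right, ha', S.D.res_res]
    · simp only [Fin.lastCases_castSucc]
      rw [S.pull_res inf_le_left, ha, S.D.res_res]

/-- The Hamiltonian vector field of a multiple `b * g` of a function `g` which vanishes on `S`
is `b` times that of `g` along `S`, as the other term of the Leibniz rule contains `g`. -/
theorem pull_br_mul {U : Opens X} {g : F.A U} (hg : S.pull U g = 0) (b a : F.A U) :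
    S.pull U (P.br U (b * g) a) = S.pull U b * S.pull U (P.br U g a) := by
  induction a using homog_induction with
  | h0 => simp
  | hadd a a' h h' => simp [h, h', mul_add]
  | hom i a ha =>
    induction b using homog_induction with
    | h0 => simp
    | hadd b b' h h' => simp [h, h', add_mul]
    | hom j b hb =>
      obtain ⟨s, hs⟩ := exists_sum_comp g
      have key (l) : S.pull U (P.br U (b * F.comp U l g) a)
          = S.pull U b * S.pull U (P.br U (F.comp U l g) a) := by
        rw [P.mul_br hb (comp_mem l g) ha, map_add, map_smul, map_mul, map_mul, pull_comp, hg]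
        simp
      rw [hs]
      simp only [Finset.mul_sum, map_sum, LinearMap.sum_apply, key]

section HamTangent

variable {S P} {W : Opens X}

theorem HamTangent.res {W' : Opens X} (h : W' ≤ W) {θ : F.A W} (hθ : S.HamTangent P θ) :
    S.HamTangent P (F.res h θ) := fun V hV g hg => by
  rw [F.res_res]
  exact hθ V _ g hg

theorem HamTangent.add {θ θ' : F.A W} (hθ : S.HamTangent P θ) (hθ' : S.HamTangent P θ') :
    S.HamTangent P (θ + θ') := fun V hV g hg => by
  rw [map_add, map_add, LinearMap.add_apply, map_add, hθ V hV g hg, hθ' V hV g hg, add_zero]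

theorem HamTangent.smul (r : ℝ) {θ : F.A W} (hθ : S.HamTangent P θ) :
    S.HamTangent P (r • θ) := fun V hV g hg => by
  rw [map_smul, map_smul, LinearMap.smul_apply, map_smul, hθ V hV g hg, smul_zero]

theorem HamTangent.sub {θ θ' : F.A W} (hθ : S.HamTangent P θ) (hθ' : S.HamTangent P θ') :
    S.HamTangent P (θ - θ') := by
  have := hθ.add (hθ'.smul (-1))
  rwa [neg_one_smul, ← sub_eq_add_neg] at this

theorem HamTangent.br {i j : ℕ × ZMod 2} {θ θ' : F.A W} (hi : θ ∈ F.gr W i) (hj : θ' ∈ F.gr W j)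
    (hθ : S.HamTangent P θ) (hθ' : S.HamTangent P θ') :
    S.HamTangent P (P.br W θ θ') := fun V hV g hg => by
  have := P.jacobi g (F.res_mem hV hi) (F.res_mem hV hj)
  rw [P.br_res, ← sub_eq_iff_eq_add.2 this, map_sub, map_smul, hθ V hV _ (hθ' V hV g hg),
    hθ' V hV _ (hθ V hV g hg), smul_zero, sub_zero]

theorem HamTangent.pull_eq {θ : F.A W} (hθ : S.HamTangent P θ) {V : Opens X} (h : V ≤ W)
    {a b : F.A V} (hab : S.pull V a = S.pull V b) :
    S.pull V (P.br V (F.res h θ) a) = S.pull V (P.br V (F.res h θ) b) := by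
  have := hθ V h (a - b) (by rw [map_sub, hab, sub_self])
  rwa [map_sub, map_sub, sub_eq_zero] at this

/-- A Hamiltonian vector field tangent to a subbundle induces an operator on functions on it. -/
theorem HamTangent.exists_induced {i : ℕ × ZMod 2} {θ : F.A W} (hi : θ ∈ F.gr W i)
    (hθ : S.HamTangent P θ) :
    ∃ T : ∀ N : Opens Y, N ≤ Opens.comap S.i W → (S.D.A N →ₗ[ℝ] S.D.A N),
      (∀ N (hN : N ≤ Opens.comap S.i W) N' (h : N' ≤ N) a,
        T N' (h.trans hN) (S.D.res h a) = S.D.res h (T N hN a)) ∧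
      ∀ W' (h : W' ≤ W) (a : F.A W'), T (Opens.comap S.i W') (Opens.comap_mono S.i h) (S.pull W' a)
        = S.pull W' (P.br W' (F.res h θ) a) := by
  obtain ⟨T, -, hTres, hTR⟩ := exists_operator (F := S.D.toBigradedSheaf)
    (U := Opens.comap S.i W)
    (fun N hN a b => ∃ (W' : Opens X) (hW : W' ≤ W) (h : N ≤ Opens.comap S.i W') (a' : F.A W'),
      S.D.res h (S.pull W' a') = a ∧ S.D.res h (S.pull W' (P.br W' (F.res hW θ) a')) = b)
    (by
      rintro N hN _ _ N' h' ⟨W', hW, h, a', rfl, rfl⟩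
      exact ⟨W', hW, h'.trans h, a', by rw [S.D.res_res], by rw [S.D.res_res]⟩)
    (by
      rintro N hN _ _ _ ⟨W', hW, h, a', rfl, rfl⟩ ⟨W'', hW', h', a'', h1, rfl⟩
      refine eq_of_local fun y hy => ?_
      obtain ⟨O, hO, hyO, hON⟩ := S.exists_comap_le
        (W := W' ⊓ W'') (N := N) (le_inf h h') hy
      have hO' := hO.trans inf_le_left
      have hO'' := hO.trans inf_le_right
      refine ⟨Opens.comap S.i O, hON, hyO, ?_⟩
      have h2 := congrArg (S.D.res hON) h1
      rw [S.D.res_res, S.D.res_res, ← S.pull_res hO', ← S.pull_res hO''] at h2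
      rw [S.D.res_res, S.D.res_res, ← S.pull_res hO', ← S.pull_res hO'', P.br_res, P.br_res,
        F.res_res, F.res_res]
      exact hθ.pull_eq _ h2.symm)
    (by
      rintro N hN _ _ _ _ ⟨W', hW, h, a, rfl, rfl⟩ ⟨W'', hW', h', a', rfl, rfl⟩
      have h1 : W' ⊓ W'' ≤ W' := inf_le_left
      have h2 : W' ⊓ W'' ≤ W'' := inf_le_right
      have h3 : N ≤ Opens.comap S.i (W' ⊓ W'') := le_inf h h'
      refine ⟨W' ⊓ W'', h1.trans hW, h3, F.res h1 a + F.res h2 a', ?_, ?_⟩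
      · rw [map_add, map_add, S.pull_res, S.pull_res, S.D.res_res, S.D.res_res]
      · rw [map_add, map_add, map_add, ← F.res_res hW h1, ← P.br_res, F.res_res hW h1,
          ← F.res_res hW' h2, ← P.br_res, S.pull_res, S.pull_res, S.D.res_res, S.D.res_res])
    (by
      rintro N hN r _ _ ⟨W', hW, h, a, rfl, rfl⟩
      exact ⟨W', hW, h, r • a, by simp, by simp⟩)
    (fun j => ⟨i.1 + j.1 - 2, fun N hN a ha y hy => by
      obtain ⟨O, hO, hOW, hyO, a', ha', e⟩ := S.exists_lift (W := W) hy (hN hy) ha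
      refine ⟨Opens.comap S.i O, hO, hyO, S.pull O (P.br O (F.res hOW θ) a'),
        gr_le_weightPart _ _ _ (S.pull_mem (P.br_mem_sub (k := i.1) (l := j.1)
          (F.res_mem hOW hi) ha')), O, hOW, le_rfl, a', ?_, ?_⟩
      · rw [S.D.res_id, e]
      · rw [S.D.res_id]⟩)
  refine ⟨T, hTres, fun W' h a => hTR _ _ _ _ ⟨W', h, le_rfl, a, ?_, ?_⟩⟩
  · rw [S.D.res_id]
  · rw [S.D.res_id]

variable {i : ℕ × ZMod 2} {θ : F.A W} (hi : θ ∈ F.gr W i) (hθ : S.HamTangent P θ)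

/-- The vector field on a subbundle induced by a Hamiltonian vector field tangent to it. -/
noncomputable def HamTangent.induced (N : Opens Y) (hN : N ≤ Opens.comap S.i W) :
    S.D.A N →ₗ[ℝ] S.D.A N :=
  (HamTangent.exists_induced hi hθ).choose N hN

theorem HamTangent.induced_res {N N' : Opens Y} (hN : N ≤ Opens.comap S.i W) (h : N' ≤ N)
    (a : S.D.A N) :
    HamTangent.induced hi hθ N' (h.trans hN) (S.D.res h a)
      = S.D.res h (HamTangent.induced hi hθ N hN a) :=
  (HamTangent.exists_induced hi hθ).choose_spec.1 N hN N' h a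

theorem HamTangent.induced_pull {W' : Opens X} (h : W' ≤ W) (a : F.A W') :
    HamTangent.induced hi hθ (Opens.comap S.i W') (Opens.comap_mono S.i h) (S.pull W' a)
      = S.pull W' (P.br W' (F.res h θ) a) :=
  (HamTangent.exists_induced hi hθ).choose_spec.2 W' h a

theorem HamTangent.induced_mem {N : Opens Y} (hN : N ≤ Opens.comap S.i W) {l : ℕ} {q : ZMod 2}
    {a : S.D.A N} (ha : a ∈ S.D.gr N (l, q)) :
    HamTangent.induced hi hθ N hN a ∈ S.D.gr N (i.1 + l - 2, i.2 + q) := by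
  refine mem_gr_of_local fun y hy => ?_
  obtain ⟨O, hO, hOW, hyO, a', ha', e⟩ := S.exists_lift (W := W) hy (hN hy) ha
  refine ⟨Opens.comap S.i O, hO, hyO, ?_⟩
  rw [← HamTangent.induced_res hi hθ hN hO, ← e, HamTangent.induced_pull hi hθ hOW]
  exact S.pull_mem (P.br_mem_sub (F.res_mem hOW hi) ha')

theorem HamTangent.induced_mul {N : Opens Y} (hN : N ≤ Opens.comap S.i W) {j : ℕ × ZMod 2}
    {a : S.D.A N} (b : S.D.A N) (ha : a ∈ S.D.gr N j) :
    HamTangent.induced hi hθ N hN (a * b) = HamTangent.induced hi hθ N hN a * b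
      + sgn (i.2 * j.2) • (a * HamTangent.induced hi hθ N hN b) := by
  induction b using homog_induction with
  | h0 => simp
  | hadd b b' h h' => rw [mul_add, map_add, h, h', mul_add, map_add, mul_add, smul_add]; abel
  | hom l b hb =>
    refine eq_of_local fun y hy => ?_
    obtain ⟨O, hO, hOW, hyO, a', ha', e⟩ := S.exists_lift (W := W) hy (hN hy) ha
    obtain ⟨O', hO', hOW', hyO', b', hb', e'⟩ := S.exists_lift (W := O) hy hyO hb
    refine ⟨Opens.comap S.i O', hO', hyO', ?_⟩
    have e'' : S.D.res hO' a = S.pull O' (F.res hOW' a') := by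
      rw [S.pull_res hOW', e, S.D.res_res]
    simp only [map_add, map_smul, map_mul, ← HamTangent.induced_res hi hθ hN hO']
    rw [e'', ← e', ← map_mul, HamTangent.induced_pull hi hθ (hOW'.trans hOW),
      HamTangent.induced_pull hi hθ (hOW'.trans hOW), HamTangent.induced_pull hi hθ (hOW'.trans hOW),
      P.leibniz _ (F.res_mem _ hi) (F.res_mem _ ha')]
    simp

/-- The vector field on a subbundle induced by a Hamiltonian vector field tangent to it, as a
vector field. -/
noncomputable def HamTangent.inducedField : S.D.VectorField (Opens.comap S.i W) i.2 where
  app V hV := HamTangent.induced hi hθ V hV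
  app_res hV h a := HamTangent.induced_res hi hθ hV h a
  app_parity hV j _ ha := Submodule.mem_iSup_of_mem _
    (HamTangent.induced_mem hi hθ hV (l := j.1) (q := j.2) ha)
  leibniz hV _ _ b ha := HamTangent.induced_mul hi hθ hV b ha

end HamTangent

/-- On an isotropic subbundle, the component of weight `-1` of a vector field is locally the
restriction of the Hamiltonian vector field of a function of weight one which vanishes on the
subbundle: in the combination `∑ b t {g t, ·}` provided by isotropy, lift the coefficients to `B t`
and take the part of weight one of `∑ B t * g t`. -/
theorem IsIsotropic.exists_hamiltonian (hS : S.IsIsotropic P) {V : Opens Y} {q : ZMod 2}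
    (δ : S.D.VectorField V q) {W : Opens X} {y : Y} (hy : y ∈ V) (hyW : S.i y ∈ W) (p : ZMod 2) :
    ∃ (O : Opens X) (hO : Opens.comap S.i O ≤ V) (_ : O ≤ W), S.i y ∈ O ∧ ∃ τ ∈ F.gr O (1, p),
      S.pull O τ = 0 ∧ ∀ (O' : Opens X) (h : O' ≤ O) (w : ℕ) (r : ZMod 2),
        ∀ a ∈ F.gr O' (w + 1, r), S.pull O' (P.br O' (F.res h τ) a)
          = S.D.comp _ (w, p + r)
              (δ.app (Opens.comap S.i O') ((Opens.comap_mono S.i h).trans hO) (S.pull O' a)) := by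
  obtain ⟨W₁, hW₁, N, g, b, hy₁, hg, hδ⟩ := hS V q δ y hy
  obtain ⟨O₁, hO₁, hyO₁, B, hB⟩ := S.exists_lift_fin hy₁ b
  have hO : O₁ ⊓ W ≤ W₁ := inf_le_left.trans hO₁
  let G : F.A (O₁ ⊓ W) := ∑ t, F.res inf_le_left (B t) * F.res hO (g t)
  have hg' (O') (h : O' ≤ W₁) (t) : S.pull O' (F.res h (g t)) = 0 := by
    rw [S.pull_res, hg, map_zero]
  refine ⟨O₁ ⊓ W, (Opens.comap_mono S.i hO).trans hW₁, inf_le_right, ⟨hyO₁, hyW⟩,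
    F.comp _ (1, p) G, comp_mem _ _, ?_, fun O' h w r a ha => ?_⟩
  · rw [pull_comp, map_sum, Finset.sum_eq_zero fun t _ => ?_, map_zero]
    rw [map_mul, hg', mul_zero]
  · rw [← comp_res, ← P.comp_br ha, pull_comp, hδ O' (h.trans hO) a]
    congr 1
    rw [map_sum, map_sum, LinearMap.sum_apply, map_sum]
    refine Finset.sum_congr rfl fun t _ => ?_
    rw [map_mul, F.res_res, F.res_res, S.pull_br_mul P (hg' _ _ t),
      S.pull_res (h.trans inf_le_left), hB, S.D.res_res]

/-- A coordinate vector field of weight `-1` on an isotropic subbundle is, on functions of weight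
one, locally the restriction of a Hamiltonian vector field which is tangent to the subbundle. -/
theorem IsIsotropic.exists_coord_rep (hS : S.IsIsotropic P)
    (c : Chart m S.D.toBigradedSheaf 2) {j : Fin c.r} (hj : c.wt j = 1) {y : Y} (hy : y ∈ c.dom) :
    ∃ (O : Opens X) (hO : Opens.comap S.i O ≤ c.dom), S.i y ∈ O ∧ ∃ τ ∈ F.gr O (1, c.par j),
      S.pull O τ = 0 ∧ S.HamTangent P τ ∧ ∀ (O' : Opens X) (h : O' ≤ O),
        ∀ a ∈ F.weightPart O' 1, S.pull O' (P.br O' (F.res h τ) a)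
          = c.partialDeriv j ((Opens.comap_mono S.i h).trans hO) (S.pull O' a) := by
  obtain ⟨O, hO, -, hyO, τ, hτ, h0, H⟩ := hS.exists_hamiltonian S P (c.coordVectorField j)
    (W := ⊤) hy trivial (c.par j)
  refine ⟨O, hO, hyO, τ, hτ, h0, fun V h g hg => ?_, fun O' h a ha => ?_⟩
  · obtain ⟨s, hs⟩ := exists_sum_comp g
    rw [hs, map_sum, map_sum]
    refine Finset.sum_eq_zero fun i _ => ?_
    obtain ⟨w, r⟩ := i
    cases w with
    | zero => rw [P.br_eq_zero (F.res_mem h hτ) (comp_mem _ _) (by omega), map_zero]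
    | succ w =>
      rw [H V h w r _ (comp_mem _ _), pull_comp, hg, map_zero, map_zero, map_zero]
  · refine weight_induction (P := fun a => S.pull O' (P.br O' (F.res h τ) a)
      = c.partialDeriv j ((Opens.comap_mono S.i h).trans hO) (S.pull O' a))
      (fun a b ha hb => by simp only [map_add, ha, hb]) (fun r a ha => ?_) ha
    rw [H O' h 0 r a ha]
    exact comp_of_mem (c.partialDeriv_mem j _ hj (S.pull_mem ha))

/-- A function of weight one whose Hamiltonian vector field is tangent to an isotropic subbundle
vanishes on the subbundle: isotropic subbundles are coisotropic in weight one. -/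
theorem IsIsotropic.pull_eq_zero (hS : S.IsIsotropic P) {W : Opens X} {p : ZMod 2} {σ : F.A W}
    (hσ : σ ∈ F.gr W (1, p)) (ht : S.HamTangent P σ) : S.pull W σ = 0 := by
  refine eq_of_local fun y hy => ?_
  obtain ⟨c, hyc, hc⟩ := P.nondegenerate (S.i y)
  obtain ⟨O, hO, hOW, hyO, τ, hτ, h0, H⟩ := hS.exists_hamiltonian S P
    (HamTangent.inducedField hσ ht) (W := W ⊓ c.dom) hy ⟨hy, hyc⟩ p
  have hOW' := hOW.trans inf_le_left
  have hOc := hOW.trans inf_le_right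
  refine ⟨Opens.comap S.i O, hO, hyO, ?_⟩
  rw [← S.pull_res hOW', map_zero]
  -- The vector field induced by `σ` is also induced by `τ`, which vanishes on `S` by isotropy. The
  -- difference `ρ` then has vanishing brackets with all functions of weight one along `S`, and
  -- nondegeneracy shows that its coefficients vanish on `S`.
  set ρ := F.res hOW' σ - τ with hρ
  have hρm : ρ ∈ F.gr O (1, p) := sub_mem (F.res_mem _ hσ) hτ
  have h1 : S.pull O (F.res hOW' σ) = S.pull O ρ := by rw [hρ, map_sub, h0, sub_zero]
  rw [h1]
  have hbr (r : ZMod 2) (a) (ha : a ∈ F.gr O (1, r)) : S.pull O (P.br O a ρ) = 0 := by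
    have e : S.pull O (P.br O (F.res hOW' σ) a) = S.pull O (P.br O τ a) := by
      have := H O le_rfl 0 r a ha
      rw [F.res_id] at this
      rw [this]
      symm
      refine (comp_of_mem ?_).trans (HamTangent.induced_pull hσ ht hOW' a)
      exact HamTangent.induced_mem hσ ht (Opens.comap_mono S.i hOW') (S.pull_mem ha)
    rw [P.skew ha hρm, map_neg, map_smul, hρ, map_sub, LinearMap.sub_apply, map_sub, e, sub_self,
      smul_zero, neg_zero]
  obtain ⟨f, hf, hf0, hρf⟩ := c.exists_eq_sum_gen_mul hOc hρm
  obtain ⟨N, hN⟩ := P.exists_weight_one_inverse c hc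
  have hsum (s : Fin c.r) (hs : c.wt s = 1) :
      ∑ l, S.pull O (P.br O (c.genOn hOc s) (c.genOn hOc l)) * S.pull O (f l) = 0 := by
    have hgs := c.genOn_mem hOc s
    rw [hs] at hgs
    rw [← hbr _ _ hgs, hρf, map_sum, map_sum]
    refine Finset.sum_congr rfl fun l _ => ?_
    rw [P.leibniz _ hgs (c.genOn_mem hOc l), P.br_eq_zero hgs (hf l) (by omega), mul_zero, smul_zero,
      add_zero, map_mul]
  have hfj (j : Fin c.r) : S.pull O (f j) = 0 := by
    by_cases hj : c.wt j = 1
    · have e : S.pull O (f j) = ∑ l, (if j = l then 1 else 0) * S.pull O (f l) := by simp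
      have e' (l) : (if j = l then 1 else 0) * S.pull O (f l)
          = ∑ s, (if c.wt s = 1 then S.pull O (F.res hOc (N j s)) *
            (S.pull O (P.br O (c.genOn hOc s) (c.genOn hOc l)) * S.pull O (f l)) else 0) := by
        by_cases hl : c.wt l = 1
        · have := congrArg (S.pull O) (congrArg (F.res hOc) (hN j l hj hl))
          rw [map_sum, map_sum, apply_ite (F.res hOc), apply_ite (S.pull O), map_one, map_one,
            map_zero, map_zero] at this
          rw [← this, Finset.sum_mul]
          refine Finset.sum_congr rfl fun s _ => ?_
          split_ifs
          · rw [map_mul, map_mul, P.br_res, mul_assoc]; rfl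
          · simp
        · simp [hf0 l hl]
      rw [e]
      simp only [e']
      rw [Finset.sum_comm]
      refine Finset.sum_eq_zero fun s _ => ?_
      split_ifs with hs
      · rw [← Finset.mul_sum, hsum s hs, mul_zero]
      · simp
    · rw [hf0 j hj, map_zero]
  rw [hρf, map_sum]
  exact Finset.sum_eq_zero fun l _ => by rw [map_mul, hfj, mul_zero]

end GradedSubbundle

/-! ### Lifting functionals to vector fields -/

namespace GradedSubbundle

open BigradedSheaf

variable {n : ℕ} {X : Type u} [TopologicalSpace X] [ChartedSpace (EuclideanSpace ℝ (Fin n)) X]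
  {F : GradedSuperBundle.{u, v} n X 2} {m : ℕ} {Y : Type u} [TopologicalSpace Y]
  [ChartedSpace (EuclideanSpace ℝ (Fin m)) Y] (S : GradedSubbundle F m Y) (P : PoissonBracket F)

/-- A function of weight one and parity `p` which vanishes on `S` and whose Hamiltonian vector
field is tangent to `S`. -/
structure IsGenerator {O : Opens X} (p : ZMod 2) (σ : F.A O) : Prop where
  mem : σ ∈ F.gr O (1, p)
  pull_eq_zero : S.pull O σ = 0
  tangent : S.HamTangent P σ

namespace IsGenerator

variable {S P} {O : Opens X} {p : ZMod 2} {σ : F.A O}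

theorem res (h : S.IsGenerator P p σ) {O' : Opens X} (hO : O' ≤ O) :
    S.IsGenerator P p (F.res hO σ) :=
  ⟨F.res_mem _ h.mem, by rw [S.pull_res hO, h.pull_eq_zero, map_zero], h.tangent.res hO⟩

theorem zero : S.IsGenerator P p (0 : F.A O) :=
  ⟨zero_mem _, map_zero _, fun V hV g _ => by simp⟩

theorem sum {ι : Type*} {s : Finset ι} {σ : ι → F.A O} (h : ∀ i ∈ s, S.IsGenerator P p (σ i)) :
    S.IsGenerator P p (∑ i ∈ s, σ i) := by
  classical
  induction s using Finset.induction_on with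
  | empty => exact zero
  | insert i s hi ih =>
    have h1 := h i (Finset.mem_insert_self _ _)
    have h2 := ih fun j hj => h j (Finset.mem_insert_of_mem hj)
    rw [Finset.sum_insert hi]
    exact ⟨add_mem h1.mem h2.mem, by rw [map_add, h1.pull_eq_zero, h2.pull_eq_zero, add_zero],
      h1.tangent.add h2.tangent⟩

theorem base_mul (h : S.IsGenerator P p σ) {q : ZMod 2} {b : F.A O} (hb : b ∈ F.gr O (0, q)) :
    S.IsGenerator P (q + p) (b * σ) := by
  refine ⟨by simpa using F.mul_mem hb h.mem, by rw [map_mul, h.pull_eq_zero, mul_zero],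
    fun V hV g hg => ?_⟩
  rw [map_mul, S.pull_br_mul P (h.res hV).pull_eq_zero, h.tangent V hV g hg, mul_zero]

end IsGenerator

/-- Finitely many functions existing near a point exist on a common neighbourhood. -/
theorem exists_common {K : ℕ} {x : X} {O₀ : Opens X} (hx : x ∈ O₀)
    (Q : Fin K → ∀ O : Opens X, F.A O → Prop)
    (hres : ∀ j O O' (h : O' ≤ O) σ, Q j O σ → Q j O' (F.res h σ))
    (hex : ∀ j, ∃ O, x ∈ O ∧ ∃ σ, Q j O σ) :
    ∃ O ≤ O₀, x ∈ O ∧ ∃ σ : Fin K → F.A O, ∀ j, Q j O (σ j) := by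
  choose O hO σ hσ using hex
  refine ⟨O₀ ⊓ Finset.univ.inf O, inf_le_left, ⟨hx, ?_⟩,
    fun j => F.res (inf_le_right.trans (Finset.inf_le (Finset.mem_univ j))) (σ j),
    fun j => hres _ _ _ _ _ (hσ j)⟩
  exact Finset.inf_induction (p := fun U : Opens X => x ∈ U) trivial (fun _ h _ h' => ⟨h, h'⟩)
    fun j _ => hO j

section
variable [IsManifold (𝓡 m) ∞ Y] [T2Space Y]

/-- A lift, over `V`, of functionals to vector fields of weight `-1`, which is linear over the
base. The lift of a functional is required to be locally induced by a Hamiltonian vector field. -/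
structure LiftOn (V : Opens Y) where
  /-- The action of the lift on functions of weight two. -/
  lift : ∀ N, N ≤ V → (S.D.Functional N →ₗ[ℝ] S.D.A N →ₗ[ℝ] S.D.A N)
  lift_res : ∀ {N N'} (hN : N ≤ V) (h : N' ≤ N) (l : S.D.Functional N) (a : S.D.A N),
    lift N' (h.trans hN) (Functional.res h l) (S.D.res h a) = S.D.res h (lift N hN l a)
  lift_smul : ∀ {N} (hN : N ≤ V) (f : S.D.base N) (l : S.D.Functional N) (a : S.D.A N),
    lift N hN (f • l) a = f * lift N hN l a
  lift_of_ne : ∀ {N} (hN : N ≤ V) (l : S.D.Functional N) {i} {a : S.D.A N}, a ∈ S.D.gr N i →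
    i.1 ≠ 2 → lift N hN l a = 0
  exists_rep : ∀ {N} (hN : N ≤ V) {p} {l : S.D.Functional N}, l ∈ Functional.par N p →
    ∀ y ∈ N, ∃ (O : Opens X) (hO : Opens.comap S.i O ≤ N), S.i y ∈ O ∧ ∃ σ : F.A O,
      S.IsGenerator P (p + 1) σ ∧ ∀ (O' : Opens X) (h : O' ≤ O),
        (∀ a ∈ F.weightPart O' 1, S.pull O' (P.br O' (F.res h σ) a)
          = (Functional.res ((Opens.comap_mono S.i h).trans hO) l).op (S.pull O' a)) ∧
        ∀ a ∈ F.weightPart O' 2, S.pull O' (P.br O' (F.res h σ) a)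
          = lift _ (((Opens.comap_mono S.i h).trans hO).trans hN)
              (Functional.res ((Opens.comap_mono S.i h).trans hO) l) (S.pull O' a)

variable {S P}

omit [IsManifold (𝓡 m) ∞ Y] [T2Space Y] in
/-- Generators for the coordinate vector fields of weight `-1` of a chart, on a common
neighbourhood. -/
theorem IsIsotropic.exists_generators (hS : S.IsIsotropic P)
    (c : Chart m S.D.toBigradedSheaf 2) {y : Y} (hy : y ∈ c.dom) :
    ∃ (O : Opens X) (hO : Opens.comap S.i O ≤ c.dom), S.i y ∈ O ∧ ∃ σ : Fin c.r → F.A O,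
      ∀ j, S.IsGenerator P (c.par j) (σ j) ∧ (c.wt j = 1 → ∀ (O' : Opens X) (h : O' ≤ O),
        ∀ a ∈ F.weightPart O' 1, S.pull O' (P.br O' (F.res h (σ j)) a)
          = c.partialDeriv j ((Opens.comap_mono S.i h).trans hO) (S.pull O' a)) := by
  obtain ⟨O₀, -, hyO₀, hO₀⟩ := S.exists_comap_le (W := ⊤) (N := c.dom) le_top hy
  obtain ⟨O, hO, hyO, σ, hσ⟩ := exists_common (F := F) hyO₀
    (fun j O σ => S.IsGenerator P (c.par j) σ ∧ (c.wt j = 1 → ∀ (O' : Opens X) (h : O' ≤ O)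
      (h' : Opens.comap S.i O' ≤ c.dom), ∀ a ∈ F.weightPart O' 1,
        S.pull O' (P.br O' (F.res h σ) a) = c.partialDeriv j h' (S.pull O' a)))
    (fun j O O' h σ hσ => ⟨hσ.1.res h, fun hj O'' h'' => by
      rw [F.res_res]
      exact hσ.2 hj O'' _⟩)
    (fun j => by
      by_cases hj : c.wt j = 1
      · obtain ⟨O, hO, hyO, τ, hτ, h0, ht, H⟩ := hS.exists_coord_rep S P c hj hy
        exact ⟨O, hyO, τ, ⟨hτ, h0, ht⟩, fun _ O' h h' a ha => H O' h a ha⟩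
      · exact ⟨⊤, trivial, 0, .zero, fun h => absurd h hj⟩)
  exact ⟨O, (Opens.comap_mono S.i hO).trans hO₀, hyO, σ, fun j => ⟨(hσ j).1,
    fun hj O' h a ha => (hσ j).2 hj O' h _ a ha⟩⟩

/-- Lifts exist locally: lift the coordinate functionals and extend linearly. -/
theorem IsIsotropic.exists_local_lift (hS : S.IsIsotropic P) (y : Y) :
    ∃ V : Opens Y, y ∈ V ∧ Nonempty (LiftOn S P V) := by
  obtain ⟨c, hy⟩ := S.D.exists_chart y
  obtain ⟨O, hO, hyO, σ, hσ⟩ := hS.exists_generators c hy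
  let δ (j : Fin c.r) := HamTangent.induced (hσ j).1.mem (hσ j).1.tangent
  have hgen {N} (hN : N ≤ c.dom) (l : S.D.Functional N) (j) (hj : c.wt j ≠ 1) :
      l.op (c.genOn hN j) = 0 := l.apply_of_ne (c.genOn_mem hN j) hj
  let T (N : Opens Y) (hN : N ≤ Opens.comap S.i O) :
      S.D.Functional N →ₗ[ℝ] S.D.A N →ₗ[ℝ] S.D.A N :=
    LinearMap.mk₂ ℝ (fun l a => ∑ j, l.op (c.genOn (hN.trans hO) j) * δ j N hN (S.D.wcomp N 2 a))
      (fun l l' a => by simp [add_mul, Finset.sum_add_distrib])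
      (fun r l a => by simp [Finset.smul_sum])
      (fun l a a' => by simp [mul_add, Finset.sum_add_distrib])
      (fun r l a => by simp [Finset.smul_sum])
  have hT (N : Opens Y) (hN : N ≤ Opens.comap S.i O) (l : S.D.Functional N) (a : S.D.A N) :
    T N hN l a = ∑ j, l.op (c.genOn (hN.trans hO) j) * δ j N hN (S.D.wcomp N 2 a) := rfl
  refine ⟨Opens.comap S.i O, hyO, ⟨⟨T, fun {N N'} hN h l a => ?_, fun {N} hN f l a => ?_,
    fun {N} hN l i a ha hi => ?_, fun {N} hN p l hl z hz => ?_⟩⟩⟩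
  · rw [hT, hT, map_sum]
    refine Finset.sum_congr rfl fun j _ => ?_
    rw [map_mul, ← Functional.res_apply h, wcomp_res]
    congr 1
    · rw [Chart.genOn, Chart.genOn, S.D.res_res]
    · exact HamTangent.induced_res _ _ hN h _
  · rw [hT, hT, Finset.mul_sum]
    refine Finset.sum_congr rfl fun j _ => ?_
    rw [Functional.smul_apply, mul_assoc]
  · rw [hT]
    refine Finset.sum_eq_zero fun j _ => ?_
    rw [wcomp_of_mem_gr_ne (p := i.2) ha hi, map_zero, mul_zero]
  · obtain ⟨O₁, hO₁O, hzO₁, hO₁⟩ := S.exists_comap_le hN hz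
    obtain ⟨O₂, hO₂, hzO₂, B, hB⟩ := S.exists_lift_fin hzO₁
      (fun j => (S.D.res hO₁ (l.op (c.genOn (hN.trans hO) j))))
    have hN₂ : Opens.comap S.i O₂ ≤ N := (Opens.comap_mono S.i hO₂).trans hO₁
    let B' (j) := F.comp O₂ (0, p + 1 + c.par j) (B j)
    have hB' (j) : S.pull O₂ (B' j) = S.D.res hN₂ (l.op (c.genOn (hN.trans hO) j)) := by
      rw [pull_comp, hB, S.D.res_res]
      by_cases hj : c.wt j = 1
      · refine comp_of_mem (S.D.res_mem _ (hl _ _ ?_))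
        have := c.genOn_mem (hN.trans hO) j
        rwa [hj] at this
      · rw [hgen _ _ _ hj, map_zero, map_zero]
    have hO₂O := hO₂.trans hO₁O
    have key (O' : Opens X) (h : O' ≤ O₂) (a : F.A O') :
        S.pull O' (P.br O' (F.res h (∑ j, B' j * F.res hO₂O (σ j))) a)
          = ∑ j, (Functional.res ((Opens.comap_mono S.i h).trans hN₂) l).op
              (c.genOn ((((Opens.comap_mono S.i h).trans hN₂).trans hN).trans hO) j)
            * S.pull O' (P.br O' (F.res (h.trans hO₂O) (σ j)) a) := by
      rw [map_sum, map_sum, LinearMap.sum_apply, map_sum]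
      refine Finset.sum_congr rfl fun j _ => ?_
      rw [map_mul, F.res_res, S.pull_br_mul P ((hσ j).1.res _).pull_eq_zero, S.pull_res h, hB',
        S.D.res_res, ← Functional.res_apply, Chart.genOn, Chart.genOn, S.D.res_res]
    refine ⟨O₂, hN₂, hzO₂, ∑ j, B' j * F.res hO₂O (σ j), .sum fun j _ => ?_,
      fun O' h => ⟨fun a ha => ?_, fun a ha => ?_⟩⟩
    · have := ((hσ j).1.res hO₂O).base_mul (comp_mem (0, p + 1 + c.par j) (B j))
      rwa [add_assoc, ZMod.self_add_self, add_zero] at this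
    · rw [key]
      set l' := Functional.res ((Opens.comap_mono S.i h).trans hN₂) l
      have hdom := (((Opens.comap_mono S.i h).trans hN₂).trans hN).trans hO
      conv_rhs => rw [c.weight_one_eq_sum hdom (S.pull_weightPart ha), map_sum]
      refine Finset.sum_congr rfl fun j _ => ?_
      split_ifs with hj
      · rw [(hσ j).2 hj _ _ _ ha, l'.op_mul]
        refine weight_induction (P := fun a => c.partialDeriv j hdom a ∈ S.D.weightPart _ 0)
          (fun a b ha hb => by rw [map_add]; exact add_mem ha hb)
          (fun p a ha => gr_le_weightPart _ _ _ (c.partialDeriv_mem j hdom hj ha))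
          (S.pull_weightPart ha)
      · rw [hgen _ _ _ hj, zero_mul, map_zero]
    · rw [key, hT]
      refine Finset.sum_congr rfl fun j _ => ?_
      rw [wcomp_of_mem (S.pull_weightPart ha)]
      congr 1
      exact (HamTangent.induced_pull (hσ j).1.mem (hσ j).1.tangent (h.trans hO₂O) a).symm

namespace LiftOn

variable {V N : Opens Y} (L : LiftOn S P V) (hN : N ≤ V)

theorem lift_mem {p q : ZMod 2} {l : S.D.Functional N} {a : S.D.A N} (hl : l ∈ Functional.par N p)
    (ha : a ∈ S.D.gr N (2, q)) : L.lift N hN l a ∈ S.D.gr N (1, p + 1 + q) := by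
  refine mem_gr_of_local fun y hy => ?_
  obtain ⟨O, hO, hyO, σ, hσ, H⟩ := L.exists_rep hN hl y hy
  obtain ⟨O', hO', hO'O, hyO', a', ha', e⟩ := S.exists_lift hy hyO ha
  refine ⟨Opens.comap S.i O', hO', hyO', ?_⟩
  rw [← L.lift_res hN hO', ← e, ← (H O' hO'O).2 a' (gr_le_weightPart _ _ _ ha')]
  exact S.pull_mem (P.br_mem (F.res_mem _ hσ.mem) ha' rfl)

theorem lift_mem_weight (l : S.D.Functional N) {i : ℕ × ZMod 2} {a : S.D.A N}
    (ha : a ∈ S.D.gr N i) : L.lift N hN l a ∈ S.D.weightPart N 1 := by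
  by_cases hi : i.1 = 2
  · obtain ⟨w, q⟩ := i
    subst hi
    rw [← Functional.parityPart_add l, map_add, LinearMap.add_apply]
    exact add_mem
      (gr_le_weightPart _ _ _ (L.lift_mem hN (Functional.parityPart_mem _ _) ha))
      (gr_le_weightPart _ _ _ (L.lift_mem hN (Functional.parityPart_mem _ _) ha))
  · rw [L.lift_of_ne hN l ha hi]
    exact zero_mem _

theorem lift_mul {p q : ZMod 2} {l : S.D.Functional N} {a b : S.D.A N}
    (hl : l ∈ Functional.par N p) (ha : a ∈ S.D.gr N (1, q)) (hb : b ∈ S.D.weightPart N 1) :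
    L.lift N hN l (a * b) = l.op a * b + sgn ((p + 1) * q) • (a * l.op b) := by
  refine weight_induction (P := fun b => L.lift N hN l (a * b)
    = l.op a * b + sgn ((p + 1) * q) • (a * l.op b))
    (fun b b' h h' => by rw [mul_add, map_add, h, h', map_add, mul_add, mul_add, smul_add]; abel)
    (fun r b hb => eq_of_local fun y hy => ?_) hb
  obtain ⟨O, hO, hyO, σ, hσ, H⟩ := L.exists_rep hN hl y hy
  obtain ⟨O₁, hO₁, hO₁O, hyO₁, a', ha', e⟩ := S.exists_lift hy hyO ha
  obtain ⟨O', hO', hO'O₁, hyO', b', hb', e'⟩ := S.exists_lift hy hyO₁ hb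
  have e'' : S.D.res hO' a = S.pull O' (F.res hO'O₁ a') := by
    rw [S.pull_res hO'O₁, e, S.D.res_res]
  have ha'' := F.res_mem hO'O₁ ha'
  refine ⟨Opens.comap S.i O', hO', hyO', ?_⟩
  simp only [map_add, map_smul, map_mul, ← L.lift_res hN hO', ← Functional.res_apply hO']
  have hab := F.weightPart_mul_mem (gr_le_weightPart _ _ _ ha'') (gr_le_weightPart _ _ _ hb')
  rw [one_add_one_eq_two] at hab
  have k1 := (H O' (hO'O₁.trans hO₁O)).2 _ hab
  have k2 := (H O' (hO'O₁.trans hO₁O)).1 _ (gr_le_weightPart _ _ _ ha'')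
  have k3 := (H O' (hO'O₁.trans hO₁O)).1 _ (gr_le_weightPart _ _ _ hb')
  rw [P.leibniz _ (F.res_mem _ hσ.mem) ha'', map_add, map_smul, map_mul, map_mul, k2, k3, map_mul]
    at k1
  rw [e'', ← e']
  exact k1.symm

theorem lift_mul_base {q : ZMod 2} (l : S.D.Functional N) {a f : S.D.A N}
    (ha : a ∈ S.D.gr N (2, q)) (hf : f ∈ S.D.weightPart N 0) :
    L.lift N hN l (a * f) = L.lift N hN l a * f := by
  suffices H : ∀ p, ∀ l ∈ Functional.par N p, L.lift N hN l (a * f) = L.lift N hN l a * f by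
    rw [← Functional.parityPart_add l, map_add, LinearMap.add_apply, LinearMap.add_apply, add_mul,
      H _ _ (Functional.parityPart_mem _ _), H _ _ (Functional.parityPart_mem _ _)]
  intro p l hl
  refine weight_induction (P := fun f => L.lift N hN l (a * f) = L.lift N hN l a * f)
    (fun b b' h h' => by rw [mul_add, map_add, h, h', mul_add])
    (fun r f hf => eq_of_local fun y hy => ?_) hf
  obtain ⟨O, hO, hyO, σ, hσ, H⟩ := L.exists_rep hN hl y hy
  obtain ⟨O₁, hO₁, hO₁O, hyO₁, a', ha', e⟩ := S.exists_lift hy hyO ha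
  obtain ⟨O', hO', hO'O₁, hyO', f', hf', e'⟩ := S.exists_lift hy hyO₁ hf
  have e'' : S.D.res hO' a = S.pull O' (F.res hO'O₁ a') := by
    rw [S.pull_res hO'O₁, e, S.D.res_res]
  have ha'' := F.res_mem hO'O₁ ha'
  refine ⟨Opens.comap S.i O', hO', hyO', ?_⟩
  simp only [map_mul, ← L.lift_res hN hO']
  have k1 := (H O' (hO'O₁.trans hO₁O)).2 (F.res hO'O₁ a' * f') (mul_base_mem
    (gr_le_weightPart _ _ _ ha'') (gr_le_weightPart _ _ _ hf'))
  have k2 := (H O' (hO'O₁.trans hO₁O)).2 _ (gr_le_weightPart _ _ _ ha'')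
  rw [P.leibniz _ (F.res_mem _ hσ.mem) ha'', P.br_eq_zero (F.res_mem _ hσ.mem) hf' (by omega),
    mul_zero, smul_zero, add_zero, map_mul, k2, map_mul] at k1
  rw [e'', ← e']
  exact k1.symm

end LiftOn

section Global
variable [SigmaCompactSpace Y]

/-- A countable family of even functions on the base which sums to one and is finite near every
point, subordinate to a cover. The functions are `χ i * ∏ j < i, (1 - χ j)` for bump functions
`χ i`. -/
theorem exists_partition [Nonempty Y] {k : ℕ} (D : GradedSuperBundle.{u, v} m Y k)
    (V : Y → Opens Y) (hV : ∀ y, y ∈ V y) :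
    ∃ (c : ℕ → Y) (N : ℕ → Opens Y) (w : ℕ → D.A ⊤), (∀ i, w i ∈ D.gr ⊤ (0, 0)) ∧
      (∀ y, ∃ j, y ∈ N j) ∧ (∀ i j, j < i → D.res le_top (w i) = (0 : D.A (N j))) ∧
      (∀ i, ∃ O, V (c i) ⊔ O = ⊤ ∧ D.res le_top (w i) = (0 : D.A O)) ∧
      ∀ j K, j < K → ∑ i ∈ Finset.range K, D.res le_top (w i) = (1 : D.A (N j)) := by
  have hbump (y : Y) : ∃ (χ : D.A ⊤) (N O : Opens Y), χ ∈ D.gr ⊤ (0, 0) ∧ y ∈ N ∧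
      D.res le_top χ = (1 : D.A N) ∧ V y ⊔ O = ⊤ ∧ D.res le_top χ = (0 : D.A O) := by
    obtain ⟨χ, hχ, ⟨N, -, hN, h1⟩, O, hO, h0⟩ := exists_bump D (hV y)
    exact ⟨χ, N, O, hχ, hN, h1, hO, h0⟩
  choose χ N O hχ hN h1 hO h0 using hbump
  obtain ⟨s, hs, hcov⟩ := countable_cover_nhds_of_sigmaCompact
    (f := fun y => (N y : Set Y)) fun y => (N y).isOpen.mem_nhds (hN y)
  have hne : s.Nonempty := by
    obtain ⟨y⟩ := ‹Nonempty Y›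
    have : y ∈ ⋃ x ∈ s, (N x : Set Y) := hcov ▸ Set.mem_univ y
    obtain ⟨x, hx, -⟩ := Set.mem_iUnion₂.1 this
    exact ⟨x, hx⟩
  obtain ⟨c, rfl⟩ := hs.exists_eq_range hne
  let r : ℕ → D.A ⊤ := fun i => Nat.rec 1 (fun i x => x * (1 - χ (c i))) i
  have hr (i) : r (i + 1) = r i * (1 - χ (c i)) := rfl
  have h00 {a b : D.A ⊤} (ha : a ∈ D.gr ⊤ (0, 0)) (hb : b ∈ D.gr ⊤ (0, 0)) :
      a * b ∈ D.gr ⊤ (0, 0) := by simpa using D.mul_mem ha hb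
  have hrm (i) : r i ∈ D.gr ⊤ (0, 0) := by
    induction i with
    | zero => exact D.one_mem ⊤
    | succ i ih => exact h00 ih (sub_mem (D.one_mem ⊤) (hχ _))
  have hr0 (i j) (h : j < i) : D.res le_top (r i) = (0 : D.A (N (c j))) := by
    induction i with
    | zero => omega
    | succ i ih =>
      rw [hr, map_mul]
      rcases Nat.lt_succ_iff_lt_or_eq.1 h with h | rfl
      · rw [ih h, zero_mul]
      · rw [map_sub, map_one, h1, sub_self, mul_zero]
  refine ⟨c, fun i => N (c i), fun i => r i * χ (c i), fun i => h00 (hrm i) (hχ _), fun y => ?_,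
    fun i j h => by rw [map_mul, hr0 i j h, zero_mul], fun i => ⟨O (c i), hO (c i), by
      rw [map_mul, h0, mul_zero]⟩, fun j K h => ?_⟩
  · have : y ∈ ⋃ x ∈ Set.range c, (N x : Set Y) := hcov ▸ Set.mem_univ y
    obtain ⟨x, ⟨j, rfl⟩, hx⟩ := Set.mem_iUnion₂.1 this
    exact ⟨j, hx⟩
  · have hsum (K) : ∑ i ∈ Finset.range K, r i * χ (c i) = 1 - r K := by
      induction K with
      | zero => exact (sub_self 1).symm
      | succ K ih =>
        rw [Finset.sum_range_succ, ih, hr, mul_sub, mul_one]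
        abel
    rw [← map_sum, hsum, map_sub, map_one, hr0 K j h, sub_zero]

/-- Local lifts are patched together to a global one. -/
theorem exists_lift_of_local (H : ∀ y : Y, ∃ V : Opens Y, y ∈ V ∧ Nonempty (LiftOn S P V)) :
    Nonempty (LiftOn S P ⊤) := by
  classical
  rcases isEmpty_or_nonempty Y with hY | hY
  · exact ⟨⟨fun _ _ => 0, fun _ _ _ _ => by simp, fun _ _ _ _ => by simp, fun _ _ _ _ _ _ => rfl,
      fun _ _ _ _ y => (hY.false y).elim⟩⟩
  choose V hV L using H
  obtain ⟨c, N, w, hw, hcov, hwN, hwO, hsum⟩ := exists_partition S.D V hV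
  let L' (i) : LiftOn S P (V (c i)) := (L (c i)).some
  -- The term `i` of the sum; it is zero unless the lift `L' i` is defined on `M`.
  let t (i : ℕ) (M : Opens Y) : S.D.Functional M →ₗ[ℝ] S.D.A M →ₗ[ℝ] S.D.A M :=
    if h : M ≤ V (c i) then
      ((L' i).lift M h).compr₂ (LinearMap.mulLeft ℝ (S.D.res le_top (w i))) else 0
  have ht {i : ℕ} {M : Opens Y} (h : M ≤ V (c i)) (l : S.D.Functional M) (a : S.D.A M) :
      t i M l a = S.D.res le_top (w i) * (L' i).lift M h l a := by
    simp [t, h]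
  have ht0 {i : ℕ} {M : Opens Y} (h : S.D.res le_top (w i) = (0 : S.D.A M))
      (l : S.D.Functional M) (a : S.D.A M) : t i M l a = 0 := by
    by_cases hM : M ≤ V (c i)
    · rw [ht hM, h, zero_mul]
    · simp [t, hM]
  -- On such `M` the sum of the first `K` terms is defined and all later terms vanish.
  let Good (M : Opens Y) (K : ℕ) : Prop := (∃ j < K, M ≤ N j) ∧
    ∀ i < K, M ≤ V (c i) ∨ S.D.res le_top (w i) = (0 : S.D.A M)
  have zres {i : ℕ} {M M' : Opens Y} (h : M' ≤ M) (h0 : S.D.res le_top (w i) = (0 : S.D.A M)) :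
      S.D.res le_top (w i) = (0 : S.D.A M') := by
    rw [← S.D.res_res le_top h, h0, map_zero]
  have good_res {M M' : Opens Y} {K : ℕ} (h : M' ≤ M) (hM : Good M K) : Good M' K :=
    ⟨hM.1.imp fun j hj => ⟨hj.1, h.trans hj.2⟩, fun i hi =>
      (hM.2 i hi).imp (fun h' => h.trans h') (zres h)⟩
  have good_ex (U : Opens Y) (y : Y) (hy : y ∈ U) : ∃ M ≤ U, y ∈ M ∧ ∃ K, Good M K := by
    obtain ⟨j, hj⟩ := hcov y
    have key (K : ℕ) : ∃ M ≤ U, y ∈ M ∧ M ≤ N j ∧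
        ∀ i < K, M ≤ V (c i) ∨ S.D.res le_top (w i) = (0 : S.D.A M) := by
      induction K with
      | zero => exact ⟨U ⊓ N j, inf_le_left, ⟨hy, hj⟩, inf_le_right, fun i hi => by omega⟩
      | succ K ih =>
        obtain ⟨M, hM, hyM, hMj, h⟩ := ih
        obtain ⟨O, hO, h0⟩ := hwO K
        have hyO : y ∈ V (c K) ⊔ O := hO ▸ trivial
        have step (M' : Opens Y) (hyM' : y ∈ M')
            (hM' : M ⊓ M' ≤ V (c K) ∨ S.D.res le_top (w K) = (0 : S.D.A (M ⊓ M'))) :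
            ∃ M ≤ U, y ∈ M ∧ M ≤ N j ∧
              ∀ i < K + 1, M ≤ V (c i) ∨ S.D.res le_top (w i) = (0 : S.D.A M) := by
          refine ⟨M ⊓ M', inf_le_left.trans hM, ⟨hyM, hyM'⟩, inf_le_left.trans hMj, fun i hi => ?_⟩
          rcases Nat.lt_succ_iff_lt_or_eq.1 hi with hi | rfl
          · exact (h i hi).imp (fun h' => inf_le_left.trans h') (zres inf_le_left)
          · exact hM'
        rcases hyO with h | h
        · exact step _ h (Or.inl inf_le_right)
        · exact step _ h (Or.inr (zres inf_le_right h0))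
    obtain ⟨M, hM, hyM, hMj, h⟩ := key (j + 1)
    exact ⟨M, hM, hyM, j + 1, ⟨j, by omega, hMj⟩, h⟩
  have t_res {i K : ℕ} {M M' : Opens Y} (h : M' ≤ M) (hM : Good M K) (hi : i < K)
      (l : S.D.Functional M) (a : S.D.A M) :
      t i M' (Functional.res h l) (S.D.res h a) = S.D.res h (t i M l a) := by
    rcases hM.2 i hi with h' | h'
    · rw [ht h', ht (h.trans h'), map_mul, S.D.res_res, (L' i).lift_res h' h]
    · rw [ht0 h', ht0 (zres h h'), map_zero]
  have sum_eq {M : Opens Y} {K K' : ℕ} (hM : Good M K) (hK : K ≤ K') (l : S.D.Functional M)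
      (a : S.D.A M) : ∑ i ∈ Finset.range K', t i M l a = ∑ i ∈ Finset.range K, t i M l a := by
    symm
    refine Finset.sum_subset (Finset.range_mono hK) fun i _ hi => ?_
    obtain ⟨j, hj, hMj⟩ := hM.1
    exact ht0 (zres hMj (hwN i j (by rw [Finset.mem_range] at hi; omega))) _ _
  have sum_eq' {M : Opens Y} {K K' : ℕ} (hM : Good M K) (hM' : Good M K') (l : S.D.Functional M)
      (a : S.D.A M) : ∑ i ∈ Finset.range K', t i M l a = ∑ i ∈ Finset.range K, t i M l a := by
    rcases le_total K K' with h | h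
    exacts [sum_eq hM h l a, (sum_eq hM' h l a).symm]
  have hop (U : Opens Y) (l : S.D.Functional U) : ∃ T : S.D.A U →ₗ[ℝ] S.D.A U,
      ∀ M (h : M ≤ U) K, Good M K → ∀ a, S.D.res h (T a)
        = ∑ i ∈ Finset.range K, t i M (Functional.res h l) (S.D.res h a) := by
    obtain ⟨T, -, hTres, hTR⟩ := exists_operator (F := S.D.toBigradedSheaf) (U := U)
      (fun M hM a b => ∃ K, Good M K ∧ b = ∑ i ∈ Finset.range K, t i M (Functional.res hM l) a)
      (by
        rintro M hM a _ M' h ⟨K, hK, rfl⟩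
        refine ⟨K, good_res h hK, ?_⟩
        rw [map_sum, ← Functional.res_trans hM h]
        exact Finset.sum_congr rfl fun i hi => (t_res h hK (Finset.mem_range.1 hi) _ _).symm)
      (by
        rintro M hM a _ _ ⟨K, hK, rfl⟩ ⟨K', hK', rfl⟩
        exact (sum_eq' hK hK' _ _).symm)
      (by
        rintro M hM a a' _ _ ⟨K, hK, rfl⟩ ⟨K', hK', rfl⟩
        refine ⟨K, hK, ?_⟩
        rw [sum_eq' hK hK', ← Finset.sum_add_distrib]
        simp only [map_add])
      (by
        rintro M hM r a _ ⟨K, hK, rfl⟩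
        refine ⟨K, hK, ?_⟩
        rw [Finset.smul_sum]
        simp only [map_smul])
      (fun j => ⟨1, fun M hM a ha y hy => by
        obtain ⟨M', hM', hyM', K, hK⟩ := good_ex M y hy
        refine ⟨M', hM', hyM', _, Submodule.sum_mem _ fun i hi => ?_, K, hK, rfl⟩
        rcases hK.2 i (Finset.mem_range.1 hi) with h | h
        · rw [ht h]
          exact base_mul_mem (gr_le_weightPart _ _ _ (S.D.res_mem _ (hw i)))
            ((L' i).lift_mem_weight h _ (S.D.res_mem _ ha))
        · rw [ht0 h]
          exact zero_mem _⟩)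
    refine ⟨T U le_rfl, fun M h K hK a => ?_⟩
    rw [← hTres]
    exact hTR _ _ _ _ ⟨K, hK, rfl⟩
  choose T hT using hop
  have local_ext {U : Opens Y} {a b : S.D.A U}
      (h : ∀ M (h : M ≤ U) K, Good M K → S.D.res h a = S.D.res h b) : a = b :=
    eq_of_local fun y hy => by
      obtain ⟨M, hM, hyM, K, hK⟩ := good_ex U y hy
      exact ⟨M, hM, hyM, h M hM K hK⟩
  let lift (U : Opens Y) : S.D.Functional U →ₗ[ℝ] S.D.A U →ₗ[ℝ] S.D.A U :=
    { toFun := T U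
      map_add' := fun l l' => LinearMap.ext fun a => local_ext fun M h K hK => by
        rw [LinearMap.add_apply, map_add, hT _ _ _ _ _ hK, hT _ _ _ _ _ hK, hT _ _ _ _ _ hK,
          ← Finset.sum_add_distrib]
        simp only [map_add, LinearMap.add_apply]
      map_smul' := fun r l => LinearMap.ext fun a => local_ext fun M h K hK => by
        rw [RingHom.id_apply, LinearMap.smul_apply, map_smul, hT _ _ _ _ _ hK, hT _ _ _ _ _ hK,
          Finset.smul_sum]
        simp only [map_smul, LinearMap.smul_apply] }
  have hlift {U M : Opens Y} (h : M ≤ U) {K : ℕ} (hK : Good M K) (l : S.D.Functional U)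
      (a : S.D.A U) : S.D.res h (lift U l a)
        = ∑ i ∈ Finset.range K, t i M (Functional.res h l) (S.D.res h a) := hT U l M h K hK a
  refine ⟨⟨fun U _ => lift U, fun {U U'} _ h l a => local_ext fun M hM K hK => ?_,
    fun {U} _ f l a => local_ext fun M hM K hK => ?_, fun {U} _ l i a ha hi =>
      local_ext fun M hM K hK => ?_, fun {U} _ p l hl y hy => ?_⟩⟩
  · rw [hlift hM hK, S.D.res_res _ hM (lift U l a), hlift (hM.trans h) hK, S.D.res_res,
      Functional.res_trans]
  · rw [hlift hM hK, map_mul, hlift hM hK, Finset.mul_sum]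
    refine Finset.sum_congr rfl fun i hi => ?_
    rcases hK.2 i (Finset.mem_range.1 hi) with h' | h'
    · rw [ht h', ht h', Functional.res_smul, (L' i).lift_smul, ← mul_assoc, ← mul_assoc,
        even_comm (S.D.res_mem _ (hw i))]
      rfl
    · rw [ht0 h', ht0 h', mul_zero]
  · rw [hlift hM hK, map_zero]
    refine Finset.sum_eq_zero fun j hj => ?_
    by_cases h' : M ≤ V (c j)
    · rw [ht h', (L' j).lift_of_ne h' _ (S.D.res_mem _ ha) hi, mul_zero]
    · simp [t, h']
  · obtain ⟨M, hM, hyM, K, hK⟩ := good_ex U y hy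
    obtain ⟨O₀, -, hyO₀, hO₀⟩ := S.exists_comap_le (W := ⊤) (N := M) le_top hyM
    obtain ⟨O, hO, hyO, σ, hσ⟩ := exists_common (F := F) (K := K) hyO₀
      (fun j O σ => S.IsGenerator P (p + 1) σ ∧ ∀ (O' : Opens X) (h : O' ≤ O)
        (h' : Opens.comap S.i O' ≤ M),
        (∀ a ∈ F.weightPart O' 1, S.pull O' (P.br O' (F.res h σ) a) = S.D.res le_top (w j)
          * (Functional.res (h'.trans hM) l).op (S.pull O' a)) ∧
        ∀ a ∈ F.weightPart O' 2, S.pull O' (P.br O' (F.res h σ) a)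
          = t j _ (Functional.res (h'.trans hM) l) (S.pull O' a))
      (fun j O O' h σ hσ => ⟨hσ.1.res h, fun O'' h'' => by
        rw [F.res_res]
        exact hσ.2 O'' _⟩)
      (fun j => by
        rcases hK.2 j j.2 with h' | h'
        · obtain ⟨O, hO, hyO, σ, hσ, H⟩ := (L' j).exists_rep h' (Functional.res_mem hM hl) y hyM
          obtain ⟨O₁, hO₁, hO₁O, hyO₁, b, hb, hbw⟩ := S.exists_lift (W := O) hyM hyO
            (S.D.res_mem (le_top : M ≤ ⊤) (hw j))
          refine ⟨O₁, hyO₁, b * F.res hO₁O σ, ?_, fun O' h hM' => ?_⟩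
          · simpa using (hσ.res hO₁O).base_mul hb
          · have e (a : F.A O') : S.pull O' (P.br O' (F.res h (b * F.res hO₁O σ)) a)
                = S.D.res le_top (w j) * S.pull O' (P.br O' (F.res (h.trans hO₁O) σ) a) := by
              rw [map_mul, F.res_res, S.pull_br_mul P (hσ.res _).pull_eq_zero, S.pull_res h, hbw,
                S.D.res_res, S.D.res_res]
            refine ⟨fun a ha => ?_, fun a ha => ?_⟩
            · rw [e, (H O' _).1 a ha, Functional.res_trans]
            · rw [e, (H O' _).2 a ha, Functional.res_trans, ht (hM'.trans h')]
        · refine ⟨⊤, trivial, 0, .zero, fun O' h hM' => ⟨fun a ha => ?_, fun a ha => ?_⟩⟩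
          · rw [zres hM' h', zero_mul]; simp
          · rw [ht0 (zres hM' h')]; simp)
    have hOM : Opens.comap S.i O ≤ M := (Opens.comap_mono S.i hO).trans hO₀
    refine ⟨O, hOM.trans hM, hyO, ∑ j, σ j, .sum fun j _ => (hσ j).1,
      fun O' h => ⟨fun a ha => ?_, fun a ha => ?_⟩⟩
    · have h' := (Opens.comap_mono S.i h).trans hOM
      rw [map_sum, map_sum, LinearMap.sum_apply, map_sum]
      simp only [((hσ _).2 O' h h').1 a ha]
      obtain ⟨j, hj, hMj⟩ := hK.1
      have h1 := congrArg (S.D.res (h'.trans hMj)) (hsum j K hj)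
      simp only [map_sum, S.D.res_res, map_one] at h1
      rw [← Finset.sum_mul, Fin.sum_univ_eq_sum_range (fun j => S.D.res le_top (w j)), h1, one_mul]
    · have h' := (Opens.comap_mono S.i h).trans hOM
      have h1 := hlift le_rfl (good_res h' hK)
        (Functional.res ((Opens.comap_mono S.i h).trans (hOM.trans hM)) l) (S.pull O' a)
      rw [S.D.res_id, S.D.res_id, Functional.res_self] at h1
      rw [h1, map_sum, map_sum, LinearMap.sum_apply, map_sum,
        ← Fin.sum_univ_eq_sum_range (fun j => t j _ _ _)]
      exact Finset.sum_congr rfl fun j _ => ((hσ j).2 O' h h').2 a ha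

end Global

end

end GradedSubbundle

/-! ### The induced almost Lie algebroid -/

namespace SubDirac

open BigradedSheaf GradedSubbundle

variable {n : ℕ} {X : Type u} [TopologicalSpace X] [ChartedSpace (EuclideanSpace ℝ (Fin n)) X]
  {C : PreCourantAlgebroid.{u, v} n X} {m : ℕ} {Y : Type u} [TopologicalSpace Y]
  [ChartedSpace (EuclideanSpace ℝ (Fin m)) Y] (S : SubDirac C m Y)

theorem _root_.PreCourantAlgebroid.res_Θ_mem (C : PreCourantAlgebroid.{u, v} n X) (U : Opens X) :
    C.F.res le_top C.Θ ∈ C.F.gr U (3, 1) := C.F.res_mem _ C.Θ_mem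

theorem _root_.PreCourantAlgebroid.Q_mem (C : PreCourantAlgebroid.{u, v} n X) {U : Opens X}
    {k : ℕ} {p : ZMod 2} {a : C.F.A U} (ha : a ∈ C.F.gr U (k, p)) :
    C.Q U a ∈ C.F.gr U (k + 1, p + 1) := by
  rw [add_comm p]
  exact C.P.br_mem (C.res_Θ_mem U) ha (by omega)

theorem _root_.PreCourantAlgebroid.Q_res (C : PreCourantAlgebroid.{u, v} n X) {U V : Opens X}
    (h : V ≤ U) (a : C.F.A U) : C.Q V (C.F.res h a) = C.F.res h (C.Q U a) := by
  rw [PreCourantAlgebroid.Q, PreCourantAlgebroid.Q, C.P.br_res, C.F.res_res]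

theorem _root_.PreCourantAlgebroid.preBracket_res (C : PreCourantAlgebroid.{u, v} n X)
    {U V : Opens X} (h : V ≤ U) (p : ZMod 2) (σ ψ : C.F.A U) :
    C.F.res h (C.preBracket U p σ ψ) = C.preBracket V p (C.F.res h σ) (C.F.res h ψ) := by
  rw [PreCourantAlgebroid.preBracket, PreCourantAlgebroid.preBracket, map_smul, C.P.br_res,
    C.Q_res]

theorem _root_.PreCourantAlgebroid.Q_Q (C : PreCourantAlgebroid.{u, v} n X) {U : Opens X}
    {f : C.F.A U} (hf : f ∈ C.F.weightPart U 0) : C.Q U (C.Q U f) = 0 := by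
  have h := C.P.jacobi f (C.res_Θ_mem U) (C.res_Θ_mem U)
  rw [← C.P.br_res, C.almost U f hf, zero_add, mul_one, sgn_one, neg_one_smul] at h
  have h2 : (2 : ℝ) • C.Q U (C.Q U f) = 0 := by
    rw [two_smul]
    exact eq_neg_iff_add_eq_zero.1 h
  exact (smul_eq_zero.1 h2).resolve_left two_ne_zero

/-- The vector field induced by `Q_Θ` on a sub-Dirac structure. -/
noncomputable def inducedQ (V : Opens Y) : S.D.A V →ₗ[ℝ] S.D.A V :=
  HamTangent.induced C.Θ_mem S.tangent V fun _ _ => trivial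

theorem inducedQ_res {V W : Opens Y} (h : W ≤ V) (a : S.D.A V) :
    S.inducedQ W (S.D.res h a) = S.D.res h (S.inducedQ V a) :=
  HamTangent.induced_res C.Θ_mem S.tangent _ h a

theorem inducedQ_pull (W : Opens X) (a : C.F.A W) :
    S.inducedQ (Opens.comap S.i W) (S.pull W a) = S.pull W (C.Q W a) :=
  HamTangent.induced_pull C.Θ_mem S.tangent le_top a

theorem inducedQ_mem {V : Opens Y} {w : ℕ} {p : ZMod 2} {a : S.D.A V} (ha : a ∈ S.D.gr V (w, p)) :
    S.inducedQ V a ∈ S.D.gr V (w + 1, p + 1) := by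
  have := HamTangent.induced_mem C.Θ_mem S.tangent (N := V) (fun _ _ => trivial) ha
  rwa [show ((3, 1) : ℕ × ZMod 2).1 + w - 2 = w + 1 from by dsimp only; omega, add_comm _ p] at this

theorem inducedQ_inducedQ {V : Opens Y} {f : S.D.A V} (hf : f ∈ S.D.weightPart V 0) :
    S.inducedQ V (S.inducedQ V f) = 0 := by
  refine weight_induction (P := fun f => S.inducedQ V (S.inducedQ V f) = 0)
    (fun a b ha hb => by rw [map_add, map_add, ha, hb, add_zero])
    (fun p f hf => eq_of_local fun y hy => ?_) hf
  obtain ⟨O, hO, -, hyO, f', hf', e⟩ := S.exists_lift (W := ⊤) hy trivial hf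
  refine ⟨Opens.comap S.i O, hO, hyO, ?_⟩
  rw [← S.inducedQ_res hO, ← S.inducedQ_res hO, ← e, S.inducedQ_pull, S.inducedQ_pull,
    C.Q_Q (gr_le_weightPart _ _ _ hf'), map_zero, map_zero]

section
variable [IsManifold (𝓡 m) ∞ Y] [T2Space Y]

/-- The data from which the almost Lie algebroid of a sub-Dirac structure is derived. -/
noncomputable def derivedData (L : LiftOn S.toGradedSubbundle C.P ⊤) : DerivedData S.D where
  Q := S.inducedQ
  Q_res := S.inducedQ_res
  Q_mem := S.inducedQ_mem
  Q_mul {V w p a} b ha := by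
    have := HamTangent.induced_mul C.Θ_mem S.tangent (N := V) (fun _ _ => trivial) b ha
    rwa [one_mul] at this
  Q_sq := S.inducedQ_inducedQ
  lift V := L.lift V le_top
  lift_res h := L.lift_res le_top h
  lift_smul := L.lift_smul le_top
  lift_of_ne := L.lift_of_ne le_top
  lift_mem := L.lift_mem le_top
  lift_mul := L.lift_mul le_top
  lift_mul_base := L.lift_mul_base le_top

variable {S} (L : LiftOn S.toGradedSubbundle C.P ⊤)

theorem represents_iff {W : Opens X} (σ : C.F.A W) (s : S.D.Functional (Opens.comap S.i W)) :
    S.Represents (dualPairing S.D) σ s ↔ S.HamTangent C.P σ ∧ ∀ (V : Opens X) (h : V ≤ W),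
      ∀ a ∈ C.F.weightPart V 1, (Functional.res (Opens.comap_mono S.i h) s).op (S.pull V a)
        = S.pull V (C.P.br V (C.F.res h σ) a) := by
  refine and_congr_right fun _ => ⟨fun H V h a ha => ?_, fun H V h a α ha hα => ?_⟩
  · exact H V h a ⟨S.pull V a, S.pull_weightPart ha⟩ ha rfl
  · refine Eq.trans ?_ (H V h a ha)
    rw [← hα]
    rfl

/-- The Jacobi identity for `Θ` and a function of weight one, applied to a function. -/
theorem br_Q {U : Opens X} {p : ZMod 2} {σ : C.F.A U} (hσ : σ ∈ C.F.gr U (1, p)) (x : C.F.A U) :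
    C.P.br U (C.Q U σ) x
      = C.Q U (C.P.br U σ x) - sgn p • C.P.br U σ (C.Q U x) := by
  have h := C.P.jacobi x (C.res_Θ_mem U) hσ
  rw [one_mul] at h
  exact eq_sub_of_add_eq h.symm

/-- The action of the derived bracket on functions of weight one. -/
theorem br_preBracket {U : Opens X} {p q r : ZMod 2} {σ ψ a : C.F.A U}
    (hσ : σ ∈ C.F.gr U (1, p)) (hψ : ψ ∈ C.F.gr U (1, q)) (ha : a ∈ C.F.gr U (1, r)) :
    C.P.br U (C.preBracket U p σ ψ) a = -C.P.br U σ (C.Q U (C.P.br U ψ a))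
      + sgn ((p + 1) * (q + 1)) • C.P.br U ψ (C.Q U (C.P.br U σ a))
      + sgn ((p + 1) * q) • C.P.br U ψ (C.P.br U σ (C.Q U a)) := by
  have h := C.P.jacobi a (C.Q_mem hσ) hψ
  have h0 : C.P.br U σ (C.P.br U ψ a) = 0 :=
    C.P.br_eq_zero hσ (C.P.br_mem (m := 0) hψ ha rfl) (by omega)
  rw [br_Q hσ (C.P.br U ψ a), br_Q hσ a, h0, map_zero, zero_sub, map_sub, map_smul] at h
  rw [PreCourantAlgebroid.preBracket, map_smul, LinearMap.smul_apply,
    ← sub_eq_iff_eq_add.2 h]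
  rcases p.eq_zero_or_one with rfl | rfl <;> rcases q.eq_zero_or_one with rfl | rfl <;>
    simp [ZMod.self_add_self] <;> abel

/-- The function whose derived bracket with `Θ` corrects the derived bracket of two
representatives `σ`, `ψ`, where `σ₀`, `ψ₀` are the representatives which generate the lifts. -/
noncomputable def correction (C : PreCourantAlgebroid.{u, v} n X) {U : Opens X} (p q : ZMod 2)
    (σ σ₀ ψ ψ₀ : C.F.A U) : C.F.A U :=
  (sgn (p + q) * sgn ((p + 1) * q)) •
    (C.P.br U ψ (σ - σ₀) + (2⁻¹ : ℝ) • C.P.br U ψ₀ σ₀)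

theorem correction_mem {U : Opens X} {p q : ZMod 2} {σ σ₀ ψ ψ₀ : C.F.A U}
    (hσ : σ ∈ C.F.gr U (1, p)) (hσ₀ : σ₀ ∈ C.F.gr U (1, p))
    (hψ : ψ ∈ C.F.gr U (1, q)) (hψ₀ : ψ₀ ∈ C.F.gr U (1, q)) :
    correction C p q σ σ₀ ψ ψ₀ ∈ C.F.gr U (0, p + q) := by
  rw [add_comm]
  exact Submodule.smul_mem _ _ (add_mem (C.P.br_mem hψ (sub_mem hσ hσ₀) rfl)
    (Submodule.smul_mem _ _ (C.P.br_mem hψ₀ hσ₀ rfl)))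

theorem correction_res {U U' : Opens X} (h : U' ≤ U) (p q : ZMod 2) (σ σ₀ ψ ψ₀ : C.F.A U) :
    C.F.res h (correction C p q σ σ₀ ψ ψ₀)
      = correction C p q (C.F.res h σ) (C.F.res h σ₀) (C.F.res h ψ) (C.F.res h ψ₀) := by
  simp only [correction, map_smul, map_add, map_sub, C.P.br_res]

/-- The bracket of the sections `s`, `t` represented by `σ`, `ψ` acts on functions of weight one
as the derived bracket of `σ`, `ψ` corrected by `{Θ, f}`, where `f` is the `correction`. By the
Jacobi identity, `{ψ, σ - σ₀}` accounts for using `σ` instead of the generator `σ₀` of the lift, and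
`{ψ₀, σ₀} / 2` for the skew-symmetrization. -/
theorem bracket_pull {U : Opens X} {p q r : ZMod 2} {σ σ₀ ψ ψ₀ a : C.F.A U}
    {s t : S.D.Functional (Opens.comap S.i U)}
    (hs : s ∈ Functional.par (Opens.comap S.i U) (p + 1))
    (ht : t ∈ Functional.par (Opens.comap S.i U) (q + 1))
    (hσ : σ ∈ C.F.gr U (1, p)) (hσ₀ : σ₀ ∈ C.F.gr U (1, p))
    (hψ : ψ ∈ C.F.gr U (1, q)) (hψ₀ : ψ₀ ∈ C.F.gr U (1, q)) (ha : a ∈ C.F.gr U (1, r))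
    (hsσ : ∀ a ∈ C.F.weightPart U 1, s.op (S.pull U a) = S.pull U (C.P.br U σ a))
    (hsσ₀ : ∀ a ∈ C.F.weightPart U 1, s.op (S.pull U a) = S.pull U (C.P.br U σ₀ a))
    (htψ : ∀ a ∈ C.F.weightPart U 1, t.op (S.pull U a) = S.pull U (C.P.br U ψ a))
    (htψ₀ : ∀ a ∈ C.F.weightPart U 1, t.op (S.pull U a) = S.pull U (C.P.br U ψ₀ a))
    (hLs : ∀ a ∈ C.F.weightPart U 2, L.lift _ le_top s (S.pull U a) = S.pull U (C.P.br U σ₀ a))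
    (hLt : ∀ a ∈ C.F.weightPart U 2, L.lift _ le_top t (S.pull U a) = S.pull U (C.P.br U ψ₀ a)) :
    ((S.derivedData L).bracket _ s t).op (S.pull U a) = S.pull U (C.P.br U
      (C.preBracket U p σ ψ + C.Q U (correction C p q σ σ₀ ψ ψ₀)) a) := by
  have e : p + (1 + 1) = p := by rw [ZMod.self_add_self, add_zero]
  have gw {k : ℕ} {p : ZMod 2} {a : C.F.A U} (h : a ∈ C.F.gr U (k, p)) :
    a ∈ C.F.weightPart U k := gr_le_weightPart _ _ _ h
  have hx := C.Q_mem ha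
  rw [one_add_one_eq_two] at hx
  set x := C.Q U a with hxdef
  have w1 {σ : C.F.A U} {p : ZMod 2} (hσ : σ ∈ C.F.gr U (1, p)) :
    C.P.br U σ x ∈ C.F.weightPart U 1 := gw (C.P.br_mem hσ hx rfl)
  have w1' {σ : C.F.A U} {p : ZMod 2} (hσ : σ ∈ C.F.gr U (1, p)) :
    C.Q U (C.P.br U σ a) ∈ C.F.weightPart U 1 := gw (C.Q_mem (C.P.br_mem (m := 0) hσ ha rfl))
  have hf : C.P.br U (C.Q U (correction C p q σ σ₀ ψ ψ₀)) a
      = -(sgn (p + q) • C.P.br U (correction C p q σ σ₀ ψ ψ₀) x) := by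
    have hm := correction_mem hσ hσ₀ hψ hψ₀
    have h := C.P.jacobi a (C.res_Θ_mem U) hm
    rw [C.P.br_eq_zero hm ha (by omega), map_zero, one_mul] at h
    exact eq_neg_of_add_eq_zero_left h.symm
  have h1 : S.pull U (C.P.br U (C.P.br U ψ (σ - σ₀)) x)
      = S.pull U (C.P.br U ψ (C.P.br U σ x)) - S.pull U (C.P.br U ψ (C.P.br U σ₀ x)) := by
    have h := C.P.jacobi x hψ (sub_mem hσ hσ₀)
    rw [map_sub (C.P.br U) σ, LinearMap.sub_apply, LinearMap.sub_apply, map_sub] at h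
    rw [← sub_eq_iff_eq_add.2 h, map_sub, map_sub, map_smul, map_sub, ← hsσ _ (w1 hψ),
      ← hsσ₀ _ (w1 hψ), sub_self, smul_zero, sub_zero]
  have h2 : S.pull U (C.P.br U (C.P.br U ψ₀ σ₀) x) = S.pull U (C.P.br U ψ (C.P.br U σ₀ x))
      - sgn (q * p) • S.pull U (C.P.br U σ (C.P.br U ψ₀ x)) := by
    rw [← sub_eq_iff_eq_add.2 (C.P.jacobi x hψ₀ hσ₀), map_sub, map_smul, ← htψ₀ _ (w1 hσ₀),
      ← htψ _ (w1 hσ₀), ← hsσ₀ _ (w1 hψ₀), ← hsσ _ (w1 hψ₀)]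
  rw [map_add (C.P.br U), LinearMap.add_apply, hf, br_preBracket hσ hψ ha, correction]
  simp only [map_add, map_neg, map_smul, LinearMap.add_apply, LinearMap.smul_apply, h1, h2]
  rw [(S.derivedData L).bracket_apply hs ht]
  change -s.op (S.inducedQ _ (t.op _)) + sgn _ • t.op (S.inducedQ _ (s.op _))
    + (2⁻¹ : ℝ) • (sgn _ • t.op (L.lift _ le_top s (S.inducedQ _ _))
      - sgn _ • s.op (L.lift _ le_top t (S.inducedQ _ _))) = _
  rw [htψ a (gw ha), hsσ a (gw ha), S.inducedQ_pull, S.inducedQ_pull, S.inducedQ_pull,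
    hsσ _ (w1' hψ), htψ _ (w1' hσ), ← hxdef, hLs x (gw hx), hLt x (gw hx), htψ _ (w1 hσ₀),
    hsσ _ (w1 hψ₀)]
  generalize S.pull U (C.P.br U σ (C.Q U (C.P.br U ψ a))) = x1
  generalize S.pull U (C.P.br U ψ (C.Q U (C.P.br U σ a))) = x2
  generalize S.pull U (C.P.br U ψ (C.P.br U σ x)) = x3
  generalize S.pull U (C.P.br U ψ (C.P.br U σ₀ x)) = x4
  generalize S.pull U (C.P.br U σ (C.P.br U ψ₀ x)) = x5
  rcases p.eq_zero_or_one with rfl | rfl <;> rcases q.eq_zero_or_one with rfl | rfl <;>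
    simp [ZMod.self_add_self] <;> module

/-- The almost Lie algebroid derived from a lift of functionals is induced by the pre-Courant
algebroid. The correction vanishes on `S`, because `σ - σ₀` and `σ₀` do and the
Hamiltonian vector fields of `ψ` and `ψ₀` are tangent to `S`. -/
theorem isInduced : S.IsInduced (S.derivedData L).almostLieAlgebroid (dualPairing S.D) where
  exists_rep V p s hs y hy := by
    obtain ⟨O, hO, hyO, σ, hσ, H⟩ := L.exists_rep (N := V) le_top hs y hy
    have hm := hσ.mem
    rw [add_assoc p, ZMod.self_add_self, add_zero] at hm
    refine ⟨O, hO, hyO, σ, hm, (represents_iff σ _).2 ⟨hσ.tangent, fun W h a ha => ?_⟩⟩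
    rw [(H W h).1 a ha]
    exact congrArg (fun l => Functional.op l _) (Functional.res_trans hO (Opens.comap_mono S.i h) s)
  anchor_eq W p σ hσ s hs hrep f hf g hg := by
    obtain ⟨-, H⟩ := (represents_iff σ s).1 hrep
    change -(Functional.op (B := S.D.toBigradedSheaf) s) (S.inducedQ _ g.1) = _
    have h1 : Functional.op (B := S.D.toBigradedSheaf) s (S.pull W (C.Q W f))
        = S.pull W (C.P.br W σ (C.Q W f)) := by
      have h := H W le_rfl (C.Q W f)
        (weight_induction (P := fun f => C.Q W f ∈ C.F.weightPart W 1)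
          (fun a b ha hb => by rw [map_add]; exact add_mem ha hb)
          (fun p a ha => gr_le_weightPart _ _ _ (C.Q_mem ha)) hf)
      rw [C.F.res_id] at h
      exact (congrArg (fun l => Functional.op l _) (Functional.res_self s)).symm.trans h
    have h0 : C.P.br W σ f = 0 :=
      weight_induction (P := fun f => C.P.br W σ f = 0)
        (fun a b ha hb => by rw [map_add, ha, hb, add_zero])
        (fun p a ha => C.P.br_eq_zero hσ ha (by omega)) hf
    rw [hg, S.inducedQ_pull, h1, PreCourantAlgebroid.anchor, br_Q hσ, h0, map_zero, zero_sub,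
      smul_neg, sgn_smul_sgn_smul, map_neg]
  bracket_eq W p q σ hσ ψ hψ s hs t ht hrs hrt y hy := by
    obtain ⟨htσ, Hσ⟩ := (represents_iff σ s).1 hrs
    obtain ⟨htψ, Hψ⟩ := (represents_iff ψ t).1 hrt
    obtain ⟨O₁, hO₁, hyO₁, σ₀, hσ₀, H₁⟩ := L.exists_rep (N := Opens.comap S.i W) le_top hs y hy
    obtain ⟨O₂, hO₂, hyO₂, ψ₀, hψ₀, H₂⟩ := L.exists_rep (N := Opens.comap S.i W) le_top ht y hy
    rw [add_assoc, ZMod.self_add_self, add_zero] at hσ₀ hψ₀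
    have hV₁ : O₁ ⊓ O₂ ⊓ W ≤ O₁ := inf_le_left.trans inf_le_left
    have hV₂ : O₁ ⊓ O₂ ⊓ W ≤ O₂ := inf_le_left.trans inf_le_right
    have hV : O₁ ⊓ O₂ ⊓ W ≤ W := inf_le_right
    have hyV : S.i y ∈ O₁ ⊓ O₂ ⊓ W := ⟨⟨hyO₁, hyO₂⟩, hy⟩
    generalize O₁ ⊓ O₂ ⊓ W = V at hV₁ hV₂ hV hyV
    have hσV := C.F.res_mem hV hσ
    have hψV := C.F.res_mem hV hψ
    have hσ₀V := hσ₀.res hV₁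
    have hψ₀V := hψ₀.res hV₂
    have hdiff := htσ.res hV |>.sub hσ₀V.tangent
    have hdiffm := sub_mem hσV hσ₀V.mem
    have htf : S.HamTangent C.P (correction C p q (C.F.res hV σ) (C.F.res hV₁ σ₀) (C.F.res hV ψ)
        (C.F.res hV₂ ψ₀)) :=
      ((HamTangent.br hψV hdiffm (htψ.res hV) hdiff).add
        ((HamTangent.br hψ₀V.mem hσ₀V.mem hψ₀V.tangent hσ₀V.tangent).smul _)).smul _
    refine ⟨V, hV, hyV, correction C p q (C.F.res hV σ) (C.F.res hV₁ σ₀) (C.F.res hV ψ)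
      (C.F.res hV₂ ψ₀), correction_mem hσV hσ₀V.mem hψV hψ₀V.mem, ?_, htf, ?_⟩
    · rw [correction, map_smul, map_add, map_smul, htψ V hV _ (S.isotropic.pull_eq_zero _ _ hdiffm
        hdiff)]
      have := hψ₀V.tangent V le_rfl _ hσ₀V.pull_eq_zero
      rw [C.F.res_id] at this
      rw [this]
      simp
    · have hc := correction_mem hσV hσ₀V.mem hψV hψ₀V.mem
      refine (represents_iff _ _).2 ⟨?_, fun V' h a ha => ?_⟩
      · exact ((HamTangent.br (C.Q_mem hσ) hψ (HamTangent.br (C.res_Θ_mem W) hσ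
          (S.tangent.res le_top) htσ) htψ).smul _ |>.res hV).add
          (HamTangent.br (C.res_Θ_mem V) hc (S.tangent.res le_top) htf)
      · have hVW := Opens.comap_mono S.i (h.trans hV)
        have hres {l : S.D.Functional (Opens.comap S.i W)} :
            Functional.res (Opens.comap_mono S.i h) (Functional.res (Opens.comap_mono S.i hV) l)
              = Functional.res hVW l := Functional.res_trans _ _ l
        refine (congrArg (fun l => Functional.op l (S.pull V' a)) (hres.trans
          ((S.derivedData L).bracket_res hVW s t))).trans ?_
        rw [map_add (C.F.res h), ← C.Q_res, correction_res, C.preBracket_res, C.preBracket_res]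
        refine weight_induction (P := fun a => Functional.op _ (S.pull V' a)
          = S.pull V' (C.P.br V' _ a)) (fun a b ha hb => by simp only [map_add, ha, hb])
          (fun r a ha => ?_) ha
        refine bracket_pull L (Functional.res_mem hVW hs) (Functional.res_mem hVW ht)
          (C.F.res_mem h hσV) (hσ₀V.res h).mem (C.F.res_mem h hψV) (hψ₀V.res h).mem ha
          (fun a ha => ?_) (fun a ha => ?_) (fun a ha => ?_) (fun a ha => ?_)
          (fun a ha => ?_) (fun a ha => ?_)
        · rw [C.F.res_res]; exact Hσ V' (h.trans hV) a ha
        · rw [C.F.res_res]; exact ((H₁ V' (h.trans hV₁)).1 a ha).symm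
        · rw [C.F.res_res]; exact Hψ V' (h.trans hV) a ha
        · rw [C.F.res_res]; exact ((H₂ V' (h.trans hV₂)).1 a ha).symm
        · rw [C.F.res_res]; exact ((H₁ V' (h.trans hV₁)).2 a ha).symm
        · rw [C.F.res_res]; exact ((H₂ V' (h.trans hV₂)).2 a ha).symm

/-- A sub-Dirac structure carries an induced almost Lie algebroid. -/
theorem exists_isInduced [SigmaCompactSpace Y] (S : SubDirac C m Y) :
    ∃ (L : AlmostLieAlgebroid.{u, v, v} S.D.toBigradedSheaf)
      (e : LinearFunctionsPairing L.toSuperVectorBundle), S.IsInduced L e := by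
  obtain ⟨L⟩ := exists_lift_of_local fun y => S.isotropic.exists_local_lift y
  exact ⟨_, _, isInduced L⟩

end

end SubDirac

/-! ### Graded super bundles over a point -/

/-- A supercommutative algebra with a compatible weight grading, given by its bihomogeneous
components and the projections to them. -/
structure BigradedAlgebra where
  R : Type
  [ring : Ring R]
  [algebra : Algebra ℝ R]
  /-- `gr (w, p)` are the elements of weight `w` and parity `p`. -/
  gr : ℕ × ZMod 2 → Submodule ℝ R
  one_mem : 1 ∈ gr (0, 0)
  mul_mem : ∀ {i j} {a b : R}, a ∈ gr i → b ∈ gr j → a * b ∈ gr (i + j)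
  supercomm : ∀ {i j} {a b : R}, a ∈ gr i → b ∈ gr j → a * b = sgn (i.2 * j.2) • (b * a)
  /-- The projection to a component. -/
  proj : ℕ × ZMod 2 → R →ₗ[ℝ] R
  proj_of_mem : ∀ {i} {a : R}, a ∈ gr i → proj i a = a
  proj_of_mem_ne : ∀ {i j} {a : R}, a ∈ gr j → j ≠ i → proj i a = 0
  iSup_gr : ⨆ i, gr i = ⊤

attribute [instance] BigradedAlgebra.ring BigradedAlgebra.algebra

/-- The manifold consisting of one point. -/
abbrev Pt : Type := EuclideanSpace ℝ (Fin 0)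

theorem isInternal_of_iSup_eq_top {ι M : Type*} [DecidableEq ι] [AddCommGroup M] [Module ℝ M]
    (S : ι → Submodule ℝ M) (P : ι → M →ₗ[ℝ] M) (hS : ∀ i, ∀ a ∈ S i, P i a = a)
    (hne : ∀ i j, ∀ a ∈ S j, j ≠ i → P i a = 0) (htop : ⨆ i, S i = ⊤) :
    DirectSum.IsInternal S := by
  rw [DirectSum.isInternal_submodule_iff_iSupIndep_and_iSup_eq_top]
  refine ⟨iSupIndep_def.2 fun i => Submodule.disjoint_def.2 fun a ha ha' => ?_, htop⟩
  rw [← hS i a ha]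
  have : ⨆ j, ⨆ (_ : j ≠ i), S j ≤ LinearMap.ker (P i) :=
    iSup₂_le fun j hj b hb => hne i j b hb hj
  exact this ha'

namespace BigradedAlgebra

variable (G : BigradedAlgebra)

/-- The functions on an open subset of a point with values in a bigraded algebra. -/
def sheaf : BigradedSheaf.{0, 0} Pt where
  A U := U → G.R
  gr U i := Submodule.pi Set.univ fun _ => G.gr i
  one_mem U := by simpa using fun _ _ => G.one_mem
  mul_mem {U i j a b} ha hb := by
    simp only [Submodule.mem_pi, Set.mem_univ, forall_const] at ha hb ⊢
    exact fun y => G.mul_mem (ha y) (hb y)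
  internal U := by
    refine isInternal_of_iSup_eq_top _ (fun i => LinearMap.pi fun y => G.proj i ∘ₗ LinearMap.proj y)
      (fun i a ha => funext fun y => ?_) (fun i j a ha h => funext fun y => ?_) ?_
    · exact G.proj_of_mem (ha y trivial)
    · exact G.proj_of_mem_ne (ha y trivial) h
    · rw [eq_top_iff]
      intro a _
      rcases isEmpty_or_nonempty U with hU | ⟨⟨y⟩⟩
      · rw [Subsingleton.elim a 0]
        exact zero_mem _
      · let c : G.R →ₗ[ℝ] U → G.R := LinearMap.pi fun _ => LinearMap.id
        have hc : a = c (a y) := funext fun z => congrArg a (Subsingleton.elim z y)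
        have h1 : a y ∈ ⨆ i, G.gr i := G.iSup_gr ▸ trivial
        have h2 := Submodule.mem_map_of_mem (f := c) h1
        rw [Submodule.map_iSup, ← hc] at h2
        have hle (i) : (G.gr i).map c ≤ Submodule.pi Set.univ fun _ => G.gr i := by
          rintro _ ⟨b, hb, rfl⟩ z _
          exact hb
        have h3 := iSup_mono hle
        exact h3 h2
  supercomm ha hb := funext fun y => G.supercomm (ha y trivial) (hb y trivial)
  res h :=
    { toFun := fun a y => a ⟨y.1, h y.2⟩
      map_one' := rfl
      map_mul' := fun _ _ => rfl
      map_zero' := rfl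
      map_add' := fun _ _ => rfl
      commutes' := fun _ => rfl }
  res_mem h i a ha y _ := ha ⟨y.1, h y.2⟩ trivial
  res_id _ := rfl
  res_res _ _ _ := rfl
  gluing {ι} U i s hs hcomp := by
    have hex (y : (iSup U : Opens Pt)) : ∃ k, y.1 ∈ U k := Opens.mem_iSup.1 y.2
    choose k hk using hex
    have key (l : ι) (y : U l) (z : (iSup U : Opens Pt)) (hz : z.1 = y.1) :
        s (k z) ⟨z.1, hk z⟩ = s l y := by
      have h := congrFun (hcomp (k z) l) ⟨z.1, hk z, hz ▸ y.2⟩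
      have e : (⟨z.1, hz ▸ y.2⟩ : U l) = y := Subtype.ext hz
      exact h.trans (congrArg (s l) e)
    refine ⟨fun z => s (k z) ⟨z.1, hk z⟩, ⟨fun z _ => hs _ _ trivial, fun l => funext fun y =>
      key l y _ rfl⟩, fun t ht => funext fun z => ?_⟩
    exact congrFun (ht.2 (k z)) ⟨z.1, hk z⟩

variable {G}

/-- Homogeneous generators of a bigraded algebra whose ordered monomials form a basis. -/
structure Coordinates (G : BigradedAlgebra) where
  r : ℕ
  wt : Fin r → ℕ
  par : Fin r → ZMod 2
  wt_pos : ∀ j, wt j ≠ 0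
  wt_le : ∀ j, wt j ≤ 2
  gen : Fin r → G.R
  gen_mem : ∀ j, gen j ∈ G.gr (wt j, par j)
  basis : Module.Basis {m : Fin r → ℕ // ∀ j, par j = 1 → m j ≤ 1} ℝ G.R
  basis_eq : ∀ m, basis m = (List.ofFn fun j => gen j ^ m.1 j).prod

/-- Real numbers as smooth functions on an open subset of a point. -/
def constSmooth (V : Opens Pt) : ℝ →ₗ[ℝ] C^∞⟮𝓡 0, V; 𝓘(ℝ, ℝ), ℝ⟯ where
  toFun t := ⟨fun _ => t, contMDiff_const⟩
  map_add' _ _ := rfl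
  map_smul' _ _ := rfl

/-- Coordinates on a bigraded algebra are coordinates on the bundle over a point. -/
noncomputable def Coordinates.chart (c : Coordinates G) : BigradedSheaf.Chart 0 G.sheaf 2 where
  dom := ⊤
  φ := OpenPartialHomeomorph.refl _
  φ_mem := IsManifold.subset_maximalAtlas (chartedSpaceSelf_atlas.2 rfl)
  dom_le := le_rfl
  coord a := a.elim0
  coord_eq a := a.elim0
  emb V _ :=
    { toFun := fun f y => algebraMap ℝ G.R (f y)
      map_one' := funext fun _ => map_one _
      map_mul' := fun f g => funext fun y => map_mul _ (f y) (g y)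
      map_zero' := funext fun _ => map_zero _
      map_add' := fun f g => funext fun y => map_add _ (f y) (g y)
      commutes' := fun _ => rfl }
  emb_mem V _ f y _ := by
    change algebraMap ℝ G.R (f y) ∈ G.gr (0, 0)
    rw [Algebra.algebraMap_eq_smul_one]
    exact Submodule.smul_mem _ _ G.one_mem
  emb_res _ _ _ _ _ := rfl
  r := c.r
  wt := c.wt
  par := c.par
  wt_le := c.wt_le
  odd_of_wt_zero j h := absurd h (c.wt_pos j)
  gen j := fun _ => c.gen j
  gen_mem j y _ := c.gen_mem j
  expand V _ a := by
    let emb (f : C^∞⟮𝓡 0, V; 𝓘(ℝ, ℝ), ℝ⟯) : V → G.R := fun y => algebraMap ℝ G.R (f y)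
    have heval (b : {m : Fin c.r → ℕ // ∀ j, c.par j = 1 → m j ≤ 1} →₀
        C^∞⟮𝓡 0, V; 𝓘(ℝ, ℝ), ℝ⟯) (y : V) :
        (b.sum fun m f => emb f * (List.ofFn fun j => (fun _ : V => c.gen j) ^ m.1 j).prod) y
          = b.sum fun m f => f y • c.basis m := by
      rw [Finsupp.sum, Finset.sum_apply]
      refine Finset.sum_congr rfl fun m _ => ?_
      change _ = b m y • c.basis m
      rw [c.basis_eq, Algebra.smul_def]
      refine congrArg (algebraMap ℝ G.R (b m y) * ·) ?_
      have := map_list_prod (Pi.evalMonoidHom (fun _ : V => G.R) y)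
        (List.ofFn fun j => (fun _ : V => c.gen j) ^ m.1 j)
      rw [List.map_ofFn] at this
      exact this
    have hrepr (b : {m : Fin c.r → ℕ // ∀ j, c.par j = 1 → m j ≤ 1} →₀
        C^∞⟮𝓡 0, V; 𝓘(ℝ, ℝ), ℝ⟯) (y : V) (m) :
        c.basis.repr (b.sum fun m f => f y • c.basis m) m = b m y := by
      rw [map_finsuppSum, Finsupp.sum, Finsupp.finsetSum_apply]
      simp only [map_smul, Module.Basis.repr_self, Finsupp.smul_apply, Finsupp.single_apply, smul_eq_mul,
        mul_ite, mul_one, mul_zero]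
      rw [Finset.sum_ite_eq']
      split_ifs with h
      · rfl
      · rw [Finsupp.notMem_support_iff.1 h]; rfl
    rcases isEmpty_or_nonempty V with hV | ⟨⟨y⟩⟩
    · refine ⟨0, funext fun y => (hV.false y).elim, fun b _ => Finsupp.ext fun m => ?_⟩
      exact ContMDiffMap.ext fun y => (hV.false y).elim
    · refine ⟨(c.basis.repr (a y)).mapRange (constSmooth V) (map_zero _), funext fun z => ?_,
        fun b hb => Finsupp.ext fun m => ContMDiffMap.ext fun z => ?_⟩
      · obtain rfl := Subsingleton.elim y z
        refine Eq.trans ?_ (heval _ y).symm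
        refine Eq.trans ?_ (Finsupp.sum_mapRange_index 
          (h := fun m (f : C^∞⟮𝓡 0, V; 𝓘(ℝ, ℝ), ℝ⟯) => f y • c.basis m)
          fun m => zero_smul ℝ _).symm
        exact (c.basis.linearCombination_repr (a y)).symm
      · obtain rfl := Subsingleton.elim y z
        rw [← hrepr b y m, ← heval, Finsupp.mapRange_apply]
        change _ = c.basis.repr (a y) m
        rw [congrFun hb y]
        rfl

/-- The graded super bundle over a point given by a bigraded algebra with coordinates. -/
noncomputable def Coordinates.bundle (c : Coordinates G) : GradedSuperBundle.{0, 0} 0 Pt 2 where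
  toBigradedSheaf := G.sheaf
  exists_chart _ := ⟨c.chart, trivial⟩

end BigradedAlgebra

/-! ### Homogeneous polynomials -/

/-- All monomials of `f`, in a component of weight `c`, have total weight `w`. -/
def HasWeight {σ : Type*} (c w : ℕ) (f : MvPolynomial σ ℝ) : Prop :=
  ∀ m, f.coeff m ≠ 0 → m.degree + c = w

namespace HasWeight

variable {σ : Type*} {c c' w w' : ℕ} {f g : MvPolynomial σ ℝ}

theorem zero : HasWeight c w (0 : MvPolynomial σ ℝ) := fun m h => absurd (MvPolynomial.coeff_zero m) h

theorem add (hf : HasWeight c w f) (hg : HasWeight c w g) : HasWeight c w (f + g) := fun m h => by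
  rw [MvPolynomial.coeff_add] at h
  by_cases h0 : f.coeff m = 0
  · exact hg m fun h1 => h (by rw [h0, h1, add_zero])
  · exact hf m h0

theorem smul (r : ℝ) (hf : HasWeight c w f) : HasWeight c w (r • f) := fun m h =>
  hf m fun h0 => h (by rw [MvPolynomial.coeff_smul, h0, smul_zero])

theorem neg (hf : HasWeight c w f) : HasWeight c w (-f) := by
  simpa using hf.smul (-1)

theorem sub (hf : HasWeight c w f) (hg : HasWeight c w g) : HasWeight c w (f - g) := by
  rw [sub_eq_add_neg]; exact hf.add hg.neg

theorem mul (hf : HasWeight c w f) (hg : HasWeight c' w' g) :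
    HasWeight (c + c') (w + w') (f * g) := fun m h => by
  classical
  rw [MvPolynomial.coeff_mul] at h
  obtain ⟨⟨m₁, m₂⟩, hm, h⟩ := Finset.exists_ne_zero_of_sum_ne_zero h
  replace hm := Finset.HasAntidiagonal.mem_antidiagonal.1 hm
  have h1 := hf m₁ (left_ne_zero_of_mul h)
  have h2 := hg m₂ (right_ne_zero_of_mul h)
  rw [← hm, map_add]
  dsimp only
  omega

theorem pderiv (i : σ) (hf : HasWeight c w f) : HasWeight (c + 1) w (MvPolynomial.pderiv i f) :=
  fun m h => by
    rw [MvPolynomial.coeff_pderiv] at h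
    have := hf _ (left_ne_zero_of_mul h)
    rw [map_add, Finsupp.degree_single] at this
    omega

theorem eq_zero (hf : HasWeight c w f) (h : w < c) : f = 0 :=
  MvPolynomial.ext _ _ fun m => by
    by_contra h'
    have := hf m h'
    omega

theorem cast (hf : HasWeight c w f) (h : c + w' = c' + w) : HasWeight c' w' f := fun m hm => by
  have := hf m hm
  omega

theorem C (r : ℝ) : HasWeight 0 0 (MvPolynomial.C r : MvPolynomial σ ℝ) := fun m h => by
  classical
  rw [MvPolynomial.coeff_C] at h
  have : m = 0 := by
    by_contra h'
    exact h (if_neg fun e => h' e.symm)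
  simp [this]

theorem eq_C (hf : HasWeight 0 0 f) : f = MvPolynomial.C (f.coeff 0) := by
  classical
  ext m
  rw [MvPolynomial.coeff_C]
  split_ifs with h
  · rw [h]
  · by_contra h'
    have := hf m h'
    exact h ((Finsupp.degree_eq_zero_iff m).1 (by omega)).symm

theorem monomial (m : σ →₀ ℕ) (r : ℝ) (c : ℕ) :
    HasWeight c (m.degree + c) (MvPolynomial.monomial m r) := fun m' h => by
  classical
  rw [MvPolynomial.coeff_monomial] at h
  have : m = m' := by
    by_contra h'
    exact h (if_neg h')
  rw [this]

theorem X (i : σ) : HasWeight 0 1 (MvPolynomial.X i : MvPolynomial σ ℝ) := by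
  have := monomial (Finsupp.single i 1) 1 0
  rwa [Finsupp.degree_single] at this

end HasWeight

/-- The part of weight `w` of a polynomial in a component of weight `c`. -/
noncomputable def weightProj {σ : Type*} (c w : ℕ) : MvPolynomial σ ℝ →ₗ[ℝ] MvPolynomial σ ℝ :=
  if c ≤ w then MvPolynomial.homogeneousComponent (w - c) else 0

theorem weightProj_of_hasWeight {σ : Type*} {c w : ℕ} {f : MvPolynomial σ ℝ}
    (hf : HasWeight c w f) : weightProj c w f = f := by
  classical
  unfold weightProj
  split_ifs with h
  · ext m
    rw [MvPolynomial.coeff_homogeneousComponent]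
    split_ifs with hm
    · rfl
    · by_contra h'
      have := hf m (Ne.symm h')
      omega
  · rw [hf.eq_zero (by omega)]; rfl

theorem weightProj_of_hasWeight_ne {σ : Type*} {c w w' : ℕ} {f : MvPolynomial σ ℝ}
    (hf : HasWeight c w' f) (h : w' ≠ w) : weightProj c w f = 0 := by
  classical
  unfold weightProj
  split_ifs with h'
  · ext m
    rw [MvPolynomial.coeff_homogeneousComponent]
    split_ifs with hm
    · by_contra h''
      have := hf m h''
      omega
    · rw [MvPolynomial.coeff_zero]
  · rfl

/-! ### Polynomials in two even and two odd variables -/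

theorem MvPolynomial.pderiv_pderiv_comm {σ : Type*} (i j : σ) (f : MvPolynomial σ ℝ) :
    MvPolynomial.pderiv i (MvPolynomial.pderiv j f)
      = MvPolynomial.pderiv j (MvPolynomial.pderiv i f) := by
  classical
  have h : ⁅(MvPolynomial.pderiv i : Derivation ℝ (MvPolynomial σ ℝ) (MvPolynomial σ ℝ)),
      (MvPolynomial.pderiv j : Derivation ℝ (MvPolynomial σ ℝ) (MvPolynomial σ ℝ))⁆ = 0 := by
    refine MvPolynomial.derivation_ext fun k => ?_
    rw [Derivation.commutator_apply, MvPolynomial.pderiv_X, MvPolynomial.pderiv_X]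
    simp only [Pi.single_apply]
    split_ifs <;> simp
  have := DFunLike.congr_fun h f
  rw [Derivation.commutator_apply] at this
  exact sub_eq_zero.1 this

/-- A linear map on polynomials takes values in a submodule if it does so on monomials. -/
theorem MvPolynomial.linearMap_mem {σ M : Type*} [AddCommGroup M] [Module ℝ M]
    (c : MvPolynomial σ ℝ →ₗ[ℝ] M) (S : Submodule ℝ M)
    (h : ∀ m r, c (MvPolynomial.monomial m r) ∈ S) (f : MvPolynomial σ ℝ) : c f ∈ S := by
  rw [f.as_sum, map_sum]
  exact Submodule.sum_mem _ fun m _ => h m _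

namespace Darboux

open MvPolynomial

/-- Polynomials in the even variables `x` and `y`. -/
abbrev Even : Type := MvPolynomial (Fin 2) ℝ

/-- The functions `a.re + a.imI ξ + a.imJ η + a.imK ξη` of two even variables `x`, `y` and two odd
variables `ξ`, `η`, which satisfy the relations of the units `i`, `j`, `k` of the quaternion
algebra with all parameters zero. -/
abbrev Fun : Type := QuaternionAlgebra Even 0 0 0

theorem re_mul (a b : Fun) : (a * b).re = a.re * b.re := by
  simp

theorem imI_mul (a b : Fun) : (a * b).imI = a.re * b.imI + a.imI * b.re := by
  simp

theorem imJ_mul (a b : Fun) : (a * b).imJ = a.re * b.imJ + a.imJ * b.re := by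
  simp

theorem imK_mul (a b : Fun) :
    (a * b).imK = a.re * b.imK + a.imI * b.imJ - a.imJ * b.imI + a.imK * b.re := by
  simp

/-- The functions of weight `i.1` and parity `i.2`, where all the variables have weight one. -/
def gr (i : ℕ × ZMod 2) : Submodule ℝ Fun where
  carrier := {a | (HasWeight 0 i.1 a.re ∧ HasWeight 1 i.1 a.imI ∧ HasWeight 1 i.1 a.imJ ∧
    HasWeight 2 i.1 a.imK) ∧ (i.2 = 0 → a.imI = 0 ∧ a.imJ = 0) ∧ (i.2 = 1 → a.re = 0 ∧ a.imK = 0)}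
  zero_mem' := ⟨⟨.zero, .zero, .zero, .zero⟩, fun _ => ⟨rfl, rfl⟩, fun _ => ⟨rfl, rfl⟩⟩
  add_mem' {a b} ha hb :=
    ⟨⟨ha.1.1.add hb.1.1, ha.1.2.1.add hb.1.2.1, ha.1.2.2.1.add hb.1.2.2.1,
        ha.1.2.2.2.add hb.1.2.2.2⟩,
      fun h => ⟨by rw [QuaternionAlgebra.imI_add, (ha.2.1 h).1, (hb.2.1 h).1, add_zero],
        by rw [QuaternionAlgebra.imJ_add, (ha.2.1 h).2, (hb.2.1 h).2, add_zero]⟩,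
      fun h => ⟨by rw [QuaternionAlgebra.re_add, (ha.2.2 h).1, (hb.2.2 h).1, add_zero],
        by rw [QuaternionAlgebra.imK_add, (ha.2.2 h).2, (hb.2.2 h).2, add_zero]⟩⟩
  smul_mem' r a ha :=
    ⟨⟨ha.1.1.smul r, ha.1.2.1.smul r, ha.1.2.2.1.smul r, ha.1.2.2.2.smul r⟩,
      fun h => ⟨by rw [QuaternionAlgebra.imI_smul, (ha.2.1 h).1, smul_zero],
        by rw [QuaternionAlgebra.imJ_smul, (ha.2.1 h).2, smul_zero]⟩,
      fun h => ⟨by rw [QuaternionAlgebra.re_smul, (ha.2.2 h).1, smul_zero],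
        by rw [QuaternionAlgebra.imK_smul, (ha.2.2 h).2, smul_zero]⟩⟩

theorem mem_gr_even {w : ℕ} {a : Fun} : a ∈ gr (w, 0) ↔
    a.imI = 0 ∧ a.imJ = 0 ∧ HasWeight 0 w a.re ∧ HasWeight 2 w a.imK := by
  refine ⟨fun h => ⟨(h.2.1 rfl).1, (h.2.1 rfl).2, h.1.1, h.1.2.2.2⟩, fun ⟨h1, h2, h3, h4⟩ => ?_⟩
  exact ⟨⟨h3, by rw [h1]; exact .zero, by rw [h2]; exact .zero, h4⟩, fun _ => ⟨h1, h2⟩,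
    fun h => absurd h zero_ne_one⟩

theorem mem_gr_odd {w : ℕ} {a : Fun} : a ∈ gr (w, 1) ↔
    a.re = 0 ∧ a.imK = 0 ∧ HasWeight 1 w a.imI ∧ HasWeight 1 w a.imJ := by
  refine ⟨fun h => ⟨(h.2.2 rfl).1, (h.2.2 rfl).2, h.1.2.1, h.1.2.2.1⟩, fun ⟨h1, h2, h3, h4⟩ => ?_⟩
  exact ⟨⟨by rw [h1]; exact .zero, h3, h4, by rw [h2]; exact .zero⟩,
    fun h => absurd h one_ne_zero, fun _ => ⟨h1, h2⟩⟩

/-- The projection to the functions of given weight and parity. -/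
noncomputable def proj (i : ℕ × ZMod 2) : Fun →ₗ[ℝ] Fun :=
  if i.2 = 0 then
    { toFun := fun a => ⟨weightProj 0 i.1 a.re, 0, 0, weightProj 2 i.1 a.imK⟩
      map_add' := fun a b => by ext1 <;> simp
      map_smul' := fun r a => by ext1 <;> simp }
  else
    { toFun := fun a => ⟨0, weightProj 1 i.1 a.imI, weightProj 1 i.1 a.imJ, 0⟩
      map_add' := fun a b => by ext1 <;> simp
      map_smul' := fun r a => by ext1 <;> simp }

theorem proj_even (w : ℕ) (a : Fun) :
    proj (w, 0) a = ⟨weightProj 0 w a.re, 0, 0, weightProj 2 w a.imK⟩ := by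
  rw [proj, if_pos rfl]; rfl

theorem proj_odd (w : ℕ) (a : Fun) :
    proj (w, 1) a = ⟨0, weightProj 1 w a.imI, weightProj 1 w a.imJ, 0⟩ := by
  rw [proj, if_neg one_ne_zero]; rfl

/-- The bigraded algebra of functions of `x`, `y`, `ξ`, `η`. -/
noncomputable def algebra : BigradedAlgebra where
  R := Fun
  gr := gr
  one_mem := mem_gr_even.2 ⟨rfl, rfl, by simpa using HasWeight.C 1, .zero⟩
  mul_mem {i j a b} ha hb := by
    obtain ⟨w, p⟩ := i
    obtain ⟨w', q⟩ := j
    rw [Prod.mk_add_mk]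
    rcases ZMod.eq_zero_or_one p with rfl | rfl <;> rcases ZMod.eq_zero_or_one q with rfl | rfl
    · rw [mem_gr_even] at ha hb
      rw [add_zero, mem_gr_even, imI_mul, imJ_mul, re_mul, imK_mul, ha.1, ha.2.1, hb.1, hb.2.1]
      refine ⟨by simp, by simp, ha.2.2.1.mul hb.2.2.1, ?_⟩
      simpa using (ha.2.2.1.mul hb.2.2.2).add (ha.2.2.2.mul hb.2.2.1)
    · rw [mem_gr_even] at ha
      rw [mem_gr_odd] at hb
      rw [zero_add, mem_gr_odd, imI_mul, imJ_mul, re_mul, imK_mul, ha.1, ha.2.1, hb.1, hb.2.1]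
      refine ⟨by simp, by simp, ?_, ?_⟩
      · simpa using ha.2.2.1.mul hb.2.2.1
      · simpa using ha.2.2.1.mul hb.2.2.2
    · rw [mem_gr_even] at hb
      rw [mem_gr_odd] at ha
      rw [add_zero, mem_gr_odd, imI_mul, imJ_mul, re_mul, imK_mul, ha.1, ha.2.1, hb.1, hb.2.1]
      refine ⟨by simp, by simp, ?_, ?_⟩
      · simpa using ha.2.2.1.mul hb.2.2.1
      · simpa using ha.2.2.2.mul hb.2.2.1
    · rw [mem_gr_odd] at ha hb
      rw [ZMod.self_add_self, mem_gr_even, imI_mul, imJ_mul, re_mul, imK_mul, ha.1, ha.2.1, hb.1,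
        hb.2.1]
      refine ⟨by simp, by simp, by simpa using HasWeight.zero, ?_⟩
      simpa using (ha.2.2.1.mul hb.2.2.2).sub (ha.2.2.2.mul hb.2.2.1)
  supercomm {i j a b} ha hb := by
    obtain ⟨w, p⟩ := i
    obtain ⟨w', q⟩ := j
    have s1 : sgn (1 : ZMod 2) = -1 := if_neg (by decide)
    have s0 : sgn (0 : ZMod 2) = 1 := if_pos rfl
    rcases ZMod.eq_zero_or_one p with rfl | rfl <;> rcases ZMod.eq_zero_or_one q with rfl | rfl
    · rw [mem_gr_even] at ha hb
      simp only [mul_zero, s0, one_smul]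
      ext1 <;> simp only [imI_mul, imJ_mul, re_mul, imK_mul, ha.1, ha.2.1, hb.1, hb.2.1] <;> ring
    · rw [mem_gr_even] at ha
      rw [mem_gr_odd] at hb
      simp only [zero_mul, s0, one_smul]
      ext1 <;> simp only [imI_mul, imJ_mul, re_mul, imK_mul, ha.1, ha.2.1, hb.1, hb.2.1] <;> ring
    · rw [mem_gr_even] at hb
      rw [mem_gr_odd] at ha
      simp only [mul_zero, s0, one_smul]
      ext1 <;> simp only [imI_mul, imJ_mul, re_mul, imK_mul, ha.1, ha.2.1, hb.1, hb.2.1] <;> ring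
    · rw [mem_gr_odd] at ha hb
      simp only [mul_one, s1, neg_smul, one_smul]
      ext1 <;> simp only [QuaternionAlgebra.re_neg, QuaternionAlgebra.imI_neg,
        QuaternionAlgebra.imJ_neg, QuaternionAlgebra.imK_neg, imI_mul, imJ_mul, re_mul, imK_mul,
        ha.1, ha.2.1, hb.1, hb.2.1] <;> ring
  proj := proj
  proj_of_mem {i a} ha := by
    obtain ⟨w, p⟩ := i
    rcases ZMod.eq_zero_or_one p with rfl | rfl
    · rw [mem_gr_even] at ha
      rw [proj_even, weightProj_of_hasWeight ha.2.2.1, weightProj_of_hasWeight ha.2.2.2]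
      exact QuaternionAlgebra.ext rfl ha.1.symm ha.2.1.symm rfl
    · rw [mem_gr_odd] at ha
      rw [proj_odd, weightProj_of_hasWeight ha.2.2.1, weightProj_of_hasWeight ha.2.2.2]
      exact QuaternionAlgebra.ext ha.1.symm rfl rfl ha.2.1.symm
  proj_of_mem_ne {i j a} ha hne := by
    obtain ⟨w, p⟩ := i
    obtain ⟨w', q⟩ := j
    rcases ZMod.eq_zero_or_one p with rfl | rfl <;> rcases ZMod.eq_zero_or_one q with rfl | rfl
    · have h : w' ≠ w := fun h => hne (by rw [h])
      rw [mem_gr_even] at ha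
      rw [proj_even, weightProj_of_hasWeight_ne ha.2.2.1 h, weightProj_of_hasWeight_ne ha.2.2.2 h]
      rfl
    · rw [mem_gr_odd] at ha
      rw [proj_even, ha.1, ha.2.1, map_zero, map_zero]
      rfl
    · rw [mem_gr_even] at ha
      rw [proj_odd, ha.1, ha.2.1, map_zero]
      rfl
    · have h : w' ≠ w := fun h => hne (by rw [h])
      rw [mem_gr_odd] at ha
      rw [proj_odd, weightProj_of_hasWeight_ne ha.2.2.1 h, weightProj_of_hasWeight_ne ha.2.2.2 h]
      rfl
  iSup_gr := by
    rw [eq_top_iff]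
    intro a _
    let e := (QuaternionAlgebra.linearEquivTuple (0 : Even) 0 0).symm.restrictScalars ℝ
    have hmono (k : Fin 4) (m : Fin 2 →₀ ℕ) (r : ℝ) :
        (e.toLinearMap ∘ₗ LinearMap.single ℝ (fun _ : Fin 4 => Even) k) (monomial m r)
          ∈ ⨆ i, gr i := by
      fin_cases k
      · exact Submodule.mem_iSup_of_mem (m.degree + 0, 0)
          (mem_gr_even.2 ⟨rfl, rfl, .monomial m r 0, .zero⟩)
      · exact Submodule.mem_iSup_of_mem (m.degree + 1, 1)
          (mem_gr_odd.2 ⟨rfl, rfl, .monomial m r 1, .zero⟩)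
      · exact Submodule.mem_iSup_of_mem (m.degree + 1, 1)
          (mem_gr_odd.2 ⟨rfl, rfl, .zero, .monomial m r 1⟩)
      · exact Submodule.mem_iSup_of_mem (m.degree + 2, 0)
          (mem_gr_even.2 ⟨rfl, rfl, .zero, .monomial m r 2⟩)
    have ha : a = ∑ k, (e.toLinearMap ∘ₗ LinearMap.single ℝ (fun _ : Fin 4 => Even) k)
        (e.symm a k) := by
      simp only [LinearMap.comp_apply, ← map_sum]
      change a = e (∑ k, Pi.single k (e.symm a k))
      rw [Finset.univ_sum_single, LinearEquiv.apply_symm_apply]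
    rw [ha]
    exact Submodule.sum_mem _ fun k _ => linearMap_mem _ _ (hmono k) _

/-- The exponents of the monomials in the variables `x`, `y`, `ξ`, `η`, the last two of which are
odd. -/
noncomputable def exponents : (Σ _ : Fin 4, Fin 2 →₀ ℕ) ≃
    {m : Fin 4 → ℕ // ∀ j, (![0, 0, 1, 1] : Fin 4 → ZMod 2) j = 1 → m j ≤ 1} where
  toFun e := ⟨![e.2 0, e.2 1, e.1.1 % 2, e.1.1 / 2], fun j hj => by
    have := e.1.2
    fin_cases j
    · exact absurd hj (by decide)
    · exact absurd hj (by decide)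
    · change e.1.1 % 2 ≤ 1; omega
    · change e.1.1 / 2 ≤ 1; omega⟩
  invFun m := ⟨⟨m.1 2 + 2 * m.1 3, by have := m.2 2 rfl; have := m.2 3 rfl; omega⟩,
    Finsupp.equivFunOnFinite.symm ![m.1 0, m.1 1]⟩
  left_inv e := by
    refine Sigma.ext (Fin.ext ?_) (heq_of_eq (Finsupp.ext fun j => ?_))
    · exact Nat.mod_add_div _ _
    · fin_cases j <;> rfl
  right_inv m := by
    have h2 := m.2 2 rfl
    have h3 := m.2 3 rfl
    refine Subtype.ext (funext fun j => ?_)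
    fin_cases j
    · rfl
    · rfl
    · change (m.1 2 + 2 * m.1 3) % 2 = m.1 2; omega
    · change (m.1 2 + 2 * m.1 3) / 2 = m.1 3; omega

theorem coe_pow_mul (a b : ℕ) (c : Fun) :
    (⟨X 0, 0, 0, 0⟩ : Fun) ^ a * ((⟨X 1, 0, 0, 0⟩ : Fun) ^ b * c)
      = ⟨X 0 ^ a * X 1 ^ b * c.re, X 0 ^ a * X 1 ^ b * c.imI, X 0 ^ a * X 1 ^ b * c.imJ,
        X 0 ^ a * X 1 ^ b * c.imK⟩ := by
  have h (i : Fin 2) (n : ℕ) : (⟨X i, 0, 0, 0⟩ : Fun) ^ n = ((X i ^ n : Even) : Fun) :=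
    (QuaternionAlgebra.coe_pow _ _).symm
  rw [h, h, QuaternionAlgebra.coe_mul_eq_smul, QuaternionAlgebra.coe_mul_eq_smul]
  ext1 <;> simp [mul_assoc]

/-- The coordinate functions `x`, `y`, `ξ`, `η`. -/
noncomputable def var : Fin 4 → Fun := ![⟨X 0, 0, 0, 0⟩, ⟨X 1, 0, 0, 0⟩, ⟨0, 1, 0, 0⟩, ⟨0, 0, 1, 0⟩]

/-- The monomials in `x`, `y`, `ξ`, `η` as a basis of the functions. -/
noncomputable def monomialBasis :
    Module.Basis {m : Fin 4 → ℕ // ∀ j, (![0, 0, 1, 1] : Fin 4 → ZMod 2) j = 1 → m j ≤ 1} ℝ Fun :=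
  ((Pi.basis fun _ : Fin 4 => MvPolynomial.basisMonomials (Fin 2) ℝ).map
    ((QuaternionAlgebra.linearEquivTuple (0 : Even) 0 0).symm.restrictScalars ℝ)).reindex exponents

theorem monomialBasis_apply (m) :
    monomialBasis m = (List.ofFn fun j => var j ^ m.1 j).prod := by
  obtain ⟨⟨k, m⟩, rfl⟩ := exponents.surjective m
  rw [monomialBasis, Module.Basis.reindex_apply, Equiv.symm_apply_apply, Module.Basis.map_apply,
    Pi.basis_apply, MvPolynomial.coe_basisMonomials]
  have hm : (monomial m (1 : ℝ) : Even) = X 0 ^ m 0 * X 1 ^ m 1 := by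
    rw [MvPolynomial.monomial_eq, C_1, one_mul, Finsupp.prod_fintype _ _ fun i => pow_zero _,
      Fin.prod_univ_two]
  have hp : (List.ofFn fun j => var j ^ (exponents ⟨k, m⟩).1 j).prod
      = (⟨X 0, 0, 0, 0⟩ : Fun) ^ m 0 * ((⟨X 1, 0, 0, 0⟩ : Fun) ^ m 1 *
        ((⟨0, 1, 0, 0⟩ : Fun) ^ (k.1 % 2) * (⟨0, 0, 1, 0⟩ : Fun) ^ (k.1 / 2))) := by
    simp [List.ofFn_succ, exponents, var]
  rw [hp, coe_pow_mul]
  beta_reduce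
  rw [hm]
  fin_cases k
  all_goals
    change QuaternionAlgebra.mk _ _ _ _ = _
    ext1 <;> simp

/-- The coordinates `x`, `y`, `ξ`, `η`. -/
noncomputable def coordinates : algebra.Coordinates where
  r := 4
  wt _ := 1
  par := ![0, 0, 1, 1]
  wt_pos _ := one_ne_zero
  wt_le _ := one_le_two
  gen := var
  gen_mem j := by
    have h1 : HasWeight 1 1 (1 : Even) := by simpa using HasWeight.monomial (0 : Fin 2 →₀ ℕ) 1 1
    fin_cases j
    · exact mem_gr_even.2 ⟨rfl, rfl, .X 0, .zero⟩
    · exact mem_gr_even.2 ⟨rfl, rfl, .X 1, .zero⟩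
    · exact mem_gr_odd.2 ⟨rfl, rfl, h1, .zero⟩
    · exact mem_gr_odd.2 ⟨rfl, rfl, .zero, h1⟩
  basis := monomialBasis
  basis_eq := monomialBasis_apply

end Darboux

namespace Darboux

open MvPolynomial

/-! ### The Poisson bracket with `{x, y} = {ξ, η} = 1` -/

/-- The Poisson bracket with `{x, y} = 1` and `{ξ, η} = 1`, the other brackets of coordinates
being zero. -/
noncomputable def bracket : Fun →ₗ[ℝ] Fun →ₗ[ℝ] Fun :=
  LinearMap.mk₂ ℝ
    (fun a b =>
      ⟨pderiv 0 a.re * pderiv 1 b.re - pderiv 1 a.re * pderiv 0 b.re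
          + (a.imI * b.imJ + a.imJ * b.imI),
        pderiv 0 a.re * pderiv 1 b.imI + pderiv 0 a.imI * pderiv 1 b.re
          - pderiv 1 a.re * pderiv 0 b.imI - pderiv 1 a.imI * pderiv 0 b.re
          + (a.imK * b.imI - a.imI * b.imK),
        pderiv 0 a.re * pderiv 1 b.imJ + pderiv 0 a.imJ * pderiv 1 b.re
          - pderiv 1 a.re * pderiv 0 b.imJ - pderiv 1 a.imJ * pderiv 0 b.re
          + (a.imJ * b.imK - a.imK * b.imJ),
        pderiv 0 a.re * pderiv 1 b.imK + pderiv 0 a.imK * pderiv 1 b.re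
          + pderiv 0 a.imI * pderiv 1 b.imJ - pderiv 0 a.imJ * pderiv 1 b.imI
          - (pderiv 1 a.re * pderiv 0 b.imK + pderiv 1 a.imK * pderiv 0 b.re
          + pderiv 1 a.imI * pderiv 0 b.imJ - pderiv 1 a.imJ * pderiv 0 b.imI)⟩)
    (fun a a' b => by
      ext1 <;> simp only [QuaternionAlgebra.re_add, QuaternionAlgebra.imI_add,
        QuaternionAlgebra.imJ_add, QuaternionAlgebra.imK_add, map_add] <;> ring)
    (fun r a b => by
      ext1 <;> simp only [QuaternionAlgebra.re_smul, QuaternionAlgebra.imI_smul,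
        QuaternionAlgebra.imJ_smul, QuaternionAlgebra.imK_smul, smul_eq_C_mul, pderiv_C_mul] <;> ring)
    (fun a b b' => by
      ext1 <;> simp only [QuaternionAlgebra.re_add, QuaternionAlgebra.imI_add,
        QuaternionAlgebra.imJ_add, QuaternionAlgebra.imK_add, map_add] <;> ring)
    (fun r a b => by
      ext1 <;> simp only [QuaternionAlgebra.re_smul, QuaternionAlgebra.imI_smul,
        QuaternionAlgebra.imJ_smul, QuaternionAlgebra.imK_smul, smul_eq_C_mul, pderiv_C_mul] <;> ring)

theorem bracket_re (a b : Fun) : (bracket a b).re =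
    pderiv 0 a.re * pderiv 1 b.re - pderiv 1 a.re * pderiv 0 b.re
      + (a.imI * b.imJ + a.imJ * b.imI) := rfl

theorem bracket_imI (a b : Fun) : (bracket a b).imI =
    pderiv 0 a.re * pderiv 1 b.imI + pderiv 0 a.imI * pderiv 1 b.re
      - pderiv 1 a.re * pderiv 0 b.imI - pderiv 1 a.imI * pderiv 0 b.re
      + (a.imK * b.imI - a.imI * b.imK) := rfl

theorem bracket_imJ (a b : Fun) : (bracket a b).imJ =
    pderiv 0 a.re * pderiv 1 b.imJ + pderiv 0 a.imJ * pderiv 1 b.re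
      - pderiv 1 a.re * pderiv 0 b.imJ - pderiv 1 a.imJ * pderiv 0 b.re
      + (a.imJ * b.imK - a.imK * b.imJ) := rfl

theorem bracket_imK (a b : Fun) : (bracket a b).imK =
    pderiv 0 a.re * pderiv 1 b.imK + pderiv 0 a.imK * pderiv 1 b.re
      + pderiv 0 a.imI * pderiv 1 b.imJ - pderiv 0 a.imJ * pderiv 1 b.imI
      - (pderiv 1 a.re * pderiv 0 b.imK + pderiv 1 a.imK * pderiv 0 b.re
      + pderiv 1 a.imI * pderiv 0 b.imJ - pderiv 1 a.imJ * pderiv 0 b.imI) := rfl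

variable {i j : ℕ × ZMod 2} {a b : Fun}

theorem bracket_hasWeight (ha : a ∈ gr i) (hb : b ∈ gr j) :
    HasWeight 2 (i.1 + j.1) (bracket a b).re ∧ HasWeight 3 (i.1 + j.1) (bracket a b).imI ∧
      HasWeight 3 (i.1 + j.1) (bracket a b).imJ ∧ HasWeight 4 (i.1 + j.1) (bracket a b).imK := by
  obtain ⟨⟨a0, a1, a2, a3⟩, -⟩ := ha
  obtain ⟨⟨b0, b1, b2, b3⟩, -⟩ := hb
  refine ⟨?_, ?_, ?_, ?_⟩
  · exact (((a0.pderiv 0).mul (b0.pderiv 1)).sub ((a0.pderiv 1).mul (b0.pderiv 0))).add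
      ((a1.mul b2).add (a2.mul b1))
  · exact ((((a0.pderiv 0).mul (b1.pderiv 1)).add ((a1.pderiv 0).mul (b0.pderiv 1))).sub
      ((a0.pderiv 1).mul (b1.pderiv 0))).sub ((a1.pderiv 1).mul (b0.pderiv 0)) |>.add
      ((a3.mul b1).sub (a1.mul b3))
  · exact ((((a0.pderiv 0).mul (b2.pderiv 1)).add ((a2.pderiv 0).mul (b0.pderiv 1))).sub
      ((a0.pderiv 1).mul (b2.pderiv 0))).sub ((a2.pderiv 1).mul (b0.pderiv 0)) |>.add
      ((a2.mul b3).sub (a3.mul b2))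
  · exact (((((a0.pderiv 0).mul (b3.pderiv 1)).add ((a3.pderiv 0).mul (b0.pderiv 1))).add
      ((a1.pderiv 0).mul (b2.pderiv 1))).sub ((a2.pderiv 0).mul (b1.pderiv 1))).sub
      (((((a0.pderiv 1).mul (b3.pderiv 0)).add ((a3.pderiv 1).mul (b0.pderiv 0))).add
      ((a1.pderiv 1).mul (b2.pderiv 0))).sub ((a2.pderiv 1).mul (b1.pderiv 0)))

theorem bracket_parity (ha : a ∈ gr i) (hb : b ∈ gr j) :
    (i.2 + j.2 = 0 → (bracket a b).imI = 0 ∧ (bracket a b).imJ = 0) ∧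
      (i.2 + j.2 = 1 → (bracket a b).re = 0 ∧ (bracket a b).imK = 0) := by
  obtain ⟨w, p⟩ := i
  obtain ⟨w', q⟩ := j
  rw [bracket_re, bracket_imI, bracket_imJ, bracket_imK]
  dsimp only
  rcases ZMod.eq_zero_or_one p with rfl | rfl <;> rcases ZMod.eq_zero_or_one q with rfl | rfl
  · rw [mem_gr_even] at ha hb
    simp [ha.1, ha.2.1, hb.1, hb.2.1]
  · rw [mem_gr_even] at ha
    rw [mem_gr_odd] at hb
    simp [ha.1, ha.2.1, hb.1, hb.2.1]
  · rw [mem_gr_even] at hb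
    rw [mem_gr_odd] at ha
    simp [ha.1, ha.2.1, hb.1, hb.2.1]
  · rw [mem_gr_odd] at ha hb
    simp [ha.1, ha.2.1, hb.1, hb.2.1, ZMod.self_add_self]

theorem bracket_mem {m : ℕ} (ha : a ∈ gr i) (hb : b ∈ gr j) (h : m + 2 = i.1 + j.1) :
    bracket a b ∈ gr (m, i.2 + j.2) := by
  obtain ⟨h0, h1, h2, h3⟩ := bracket_hasWeight ha hb
  refine ⟨⟨h0.cast ?_, h1.cast ?_, h2.cast ?_, h3.cast ?_⟩, bracket_parity ha hb⟩ <;>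
    dsimp only <;> omega

theorem bracket_eq_zero (ha : a ∈ gr i) (hb : b ∈ gr j) (h : i.1 + j.1 < 2) :
    bracket a b = 0 := by
  obtain ⟨h0, h1, h2, h3⟩ := bracket_hasWeight ha hb
  exact QuaternionAlgebra.ext (h0.eq_zero (by omega)) (h1.eq_zero (by omega))
    (h2.eq_zero (by omega)) (h3.eq_zero (by omega))

theorem bracket_skew (ha : a ∈ gr i) (hb : b ∈ gr j) :
    bracket a b = -(sgn (i.2 * j.2) • bracket b a) := by
  obtain ⟨w, p⟩ := i
  obtain ⟨w', q⟩ := j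
  rcases ZMod.eq_zero_or_one p with rfl | rfl <;> rcases ZMod.eq_zero_or_one q with rfl | rfl
  · rw [mem_gr_even] at ha hb
    ext1 <;> simp only [mul_zero, sgn_zero, one_smul, QuaternionAlgebra.re_neg,
      QuaternionAlgebra.imI_neg, QuaternionAlgebra.imJ_neg, QuaternionAlgebra.imK_neg, bracket_re,
      bracket_imI, bracket_imJ, bracket_imK, ha.1, ha.2.1, hb.1, hb.2.1, map_zero] <;> ring
  · rw [mem_gr_even] at ha
    rw [mem_gr_odd] at hb
    ext1 <;> simp only [zero_mul, mul_zero, sgn_zero, one_smul, QuaternionAlgebra.re_neg,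
      QuaternionAlgebra.imI_neg, QuaternionAlgebra.imJ_neg, QuaternionAlgebra.imK_neg, bracket_re,
      bracket_imI, bracket_imJ, bracket_imK, ha.1, ha.2.1, hb.1, hb.2.1, map_zero] <;> ring
  · rw [mem_gr_even] at hb
    rw [mem_gr_odd] at ha
    ext1 <;> simp only [zero_mul, mul_zero, sgn_zero, one_smul, QuaternionAlgebra.re_neg,
      QuaternionAlgebra.imI_neg, QuaternionAlgebra.imJ_neg, QuaternionAlgebra.imK_neg, bracket_re,
      bracket_imI, bracket_imJ, bracket_imK, ha.1, ha.2.1, hb.1, hb.2.1, map_zero] <;> ring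
  · rw [mem_gr_odd] at ha hb
    ext1 <;> simp only [mul_one, sgn_one, neg_smul, neg_neg, one_smul, bracket_re,
      bracket_imI, bracket_imJ, bracket_imK, ha.1, ha.2.1, hb.1, hb.2.1, map_zero] <;> ring

theorem bracket_leibniz (c : Fun) (ha : a ∈ gr i) (hb : b ∈ gr j) :
    bracket a (b * c) = bracket a b * c + sgn (i.2 * j.2) • (b * bracket a c) := by
  obtain ⟨w, p⟩ := i
  obtain ⟨w', q⟩ := j
  rcases ZMod.eq_zero_or_one p with rfl | rfl <;> rcases ZMod.eq_zero_or_one q with rfl | rfl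
  · rw [mem_gr_even] at ha hb
    ext1 <;> simp only [mul_zero, sgn_zero, one_smul, QuaternionAlgebra.re_add,
      QuaternionAlgebra.imI_add, QuaternionAlgebra.imJ_add, QuaternionAlgebra.imK_add, bracket_re,
      bracket_imI, bracket_imJ, bracket_imK, re_mul, imI_mul, imJ_mul, imK_mul, map_add, map_sub,
      pderiv_mul, ha.1, ha.2.1, hb.1, hb.2.1, map_zero] <;> ring
  · rw [mem_gr_even] at ha
    rw [mem_gr_odd] at hb
    ext1 <;> simp only [zero_mul, mul_zero, sgn_zero, one_smul, QuaternionAlgebra.re_add,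
      QuaternionAlgebra.imI_add, QuaternionAlgebra.imJ_add, QuaternionAlgebra.imK_add, bracket_re,
      bracket_imI, bracket_imJ, bracket_imK, re_mul, imI_mul, imJ_mul, imK_mul, map_add, map_sub,
      pderiv_mul, ha.1, ha.2.1, hb.1, hb.2.1, map_zero] <;> ring
  · rw [mem_gr_even] at hb
    rw [mem_gr_odd] at ha
    ext1 <;> simp only [zero_mul, mul_zero, sgn_zero, one_smul, QuaternionAlgebra.re_add,
      QuaternionAlgebra.imI_add, QuaternionAlgebra.imJ_add, QuaternionAlgebra.imK_add, bracket_re,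
      bracket_imI, bracket_imJ, bracket_imK, re_mul, imI_mul, imJ_mul, imK_mul, map_add, map_sub,
      pderiv_mul, ha.1, ha.2.1, hb.1, hb.2.1, map_zero] <;> ring
  · rw [mem_gr_odd] at ha hb
    ext1 <;> simp only [mul_one, sgn_one, neg_smul, one_smul, QuaternionAlgebra.re_add,
      QuaternionAlgebra.imI_add, QuaternionAlgebra.imJ_add, QuaternionAlgebra.imK_add,
      QuaternionAlgebra.re_neg, QuaternionAlgebra.imI_neg, QuaternionAlgebra.imJ_neg,
      QuaternionAlgebra.imK_neg, bracket_re,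
      bracket_imI, bracket_imJ, bracket_imK, re_mul, imI_mul, imJ_mul, imK_mul, map_add, map_sub,
      pderiv_mul, ha.1, ha.2.1, hb.1, hb.2.1, map_zero] <;> ring

theorem bracket_jacobi (c : Fun) (ha : a ∈ gr i) (hb : b ∈ gr j) :
    bracket a (bracket b c)
      = bracket (bracket a b) c + sgn (i.2 * j.2) • bracket b (bracket a c) := by
  obtain ⟨w, p⟩ := i
  obtain ⟨w', q⟩ := j
  have hc := pderiv_pderiv_comm (σ := Fin 2) 1 0
  rcases ZMod.eq_zero_or_one p with rfl | rfl <;> rcases ZMod.eq_zero_or_one q with rfl | rfl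
  · rw [mem_gr_even] at ha hb
    ext1 <;> simp only [mul_zero, sgn_zero, one_smul, QuaternionAlgebra.re_add,
      QuaternionAlgebra.imI_add, QuaternionAlgebra.imJ_add, QuaternionAlgebra.imK_add, bracket_re,
      bracket_imI, bracket_imJ, bracket_imK, map_add, map_sub,
      pderiv_mul, ha.1, ha.2.1, hb.1, hb.2.1, map_zero, hc] <;> ring
  · rw [mem_gr_even] at ha
    rw [mem_gr_odd] at hb
    ext1 <;> simp only [zero_mul, mul_zero, sgn_zero, one_smul, QuaternionAlgebra.re_add,
      QuaternionAlgebra.imI_add, QuaternionAlgebra.imJ_add, QuaternionAlgebra.imK_add, bracket_re,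
      bracket_imI, bracket_imJ, bracket_imK, map_add, map_sub,
      pderiv_mul, ha.1, ha.2.1, hb.1, hb.2.1, map_zero, hc] <;> ring
  · rw [mem_gr_even] at hb
    rw [mem_gr_odd] at ha
    ext1 <;> simp only [zero_mul, mul_zero, sgn_zero, one_smul, QuaternionAlgebra.re_add,
      QuaternionAlgebra.imI_add, QuaternionAlgebra.imJ_add, QuaternionAlgebra.imK_add, bracket_re,
      bracket_imI, bracket_imJ, bracket_imK, map_add, map_sub,
      pderiv_mul, ha.1, ha.2.1, hb.1, hb.2.1, map_zero, hc] <;> ring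
  · rw [mem_gr_odd] at ha hb
    ext1 <;> simp only [mul_one, sgn_one, neg_smul, one_smul, QuaternionAlgebra.re_add,
      QuaternionAlgebra.imI_add, QuaternionAlgebra.imJ_add, QuaternionAlgebra.imK_add,
      QuaternionAlgebra.re_neg, QuaternionAlgebra.imI_neg, QuaternionAlgebra.imJ_neg,
      QuaternionAlgebra.imK_neg, bracket_re,
      bracket_imI, bracket_imJ, bracket_imK, map_add, map_sub,
      pderiv_mul, ha.1, ha.2.1, hb.1, hb.2.1, map_zero, hc] <;> ring

/-- The matrix of brackets of the coordinates `x`, `y`, `ξ`, `η`. -/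
def coordMatrix : Matrix (Fin 4) (Fin 4) ℝ := !![0, 1, 0, 0; -1, 0, 0, 0; 0, 0, 0, 1; 0, 0, 1, 0]

theorem isUnit_coordMatrix : IsUnit coordMatrix := by
  let B : Matrix (Fin 4) (Fin 4) ℝ := !![0, -1, 0, 0; 1, 0, 0, 0; 0, 0, 0, 1; 0, 0, 1, 0]
  refine IsUnit.of_mul_eq_one B ?_
  ext s t
  fin_cases s <;> fin_cases t <;>
    simp [coordMatrix, B, Matrix.mul_apply, Fin.sum_univ_succ]

theorem bracket_var (s t : Fin 4) :
    bracket (var s) (var t) = algebraMap ℝ Fun (coordMatrix s t) := by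
  have h (r : ℝ) : algebraMap ℝ Fun r = ⟨C r, 0, 0, 0⟩ := rfl
  rw [h]
  fin_cases s <;> fin_cases t <;>
    ext1 <;> simp [bracket_re, bracket_imI, bracket_imJ, bracket_imK, var, coordMatrix]

/-- The bracket on the graded super bundle over a point with coordinates `x`, `y`, `ξ`, `η`. -/
noncomputable def poisson : PoissonBracket coordinates.bundle where
  br U := LinearMap.mk₂ ℝ (fun (a b : U → Fun) y => bracket (a y) (b y))
    (fun a a' b => funext fun y => bracket.map_add₂ (a y) (a' y) (b y))
    (fun r a b => funext fun y => bracket.map_smul₂ r (a y) (b y))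
    (fun a b b' => funext fun y => map_add (bracket (a y)) (b y) (b' y))
    (fun r a b => funext fun y => map_smul (bracket (a y)) r (b y))
  br_res _ _ _ := rfl
  br_mem ha hb h y _ := bracket_mem (ha y trivial) (hb y trivial) h
  br_eq_zero ha hb h := funext fun y => bracket_eq_zero (ha y trivial) (hb y trivial) h
  skew ha hb := funext fun y => bracket_skew (ha y trivial) (hb y trivial)
  leibniz c ha hb := funext fun y => bracket_leibniz (c y) (ha y trivial) (hb y trivial)
  jacobi c ha hb := funext fun y => bracket_jacobi (c y) (ha y trivial) (hb y trivial)
  nondegenerate _ := by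
    refine ⟨coordinates.chart, trivial, ?_⟩
    let e : Fin 0 ⊕ Fin 4 ≃ Fin 4 := Equiv.emptySum _ _
    have hu : IsUnit (coordMatrix.submatrix e e) :=
      (Matrix.isUnit_submatrix_equiv e e).2 isUnit_coordMatrix
    refine (congrArg IsUnit ?_).mpr
      (hu.map (algebraMap ℝ (algebra.sheaf.A ⊤)).mapMatrix)
    ext s t : 2
    rcases s with s | s
    · exact s.elim0
    rcases t with t | t
    · exact t.elim0
    exact funext fun y => bracket_var s t

/-- The function `x²η - xyξ`. -/
noncomputable def theta : Fun := ⟨0, -(X 0 * X 1), X 0 ^ 2, 0⟩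

theorem theta_mem : theta ∈ gr (3, 1) := by
  refine mem_gr_odd.2 ⟨rfl, rfl, ?_, ?_⟩
  · exact ((HasWeight.X 0).mul (HasWeight.X 1)).neg.cast rfl
  · exact (pow_two (X 0 : Even) ▸ (HasWeight.X 0).mul (HasWeight.X 0)).cast rfl

theorem eq_of_weight_zero {p : ZMod 2} {a : Fun} (ha : a ∈ gr (0, p)) :
    ∃ r : ℝ, a = algebraMap ℝ Fun r := by
  obtain ⟨⟨h0, h1, h2, h3⟩, -⟩ := ha
  refine ⟨coeff 0 a.re, QuaternionAlgebra.ext h0.eq_C (h1.eq_zero one_pos) (h2.eq_zero one_pos)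
    (h3.eq_zero two_pos)⟩

theorem bracket_algebraMap (a : Fun) (r : ℝ) : bracket a (algebraMap ℝ Fun r) = 0 := by
  have h : algebraMap ℝ Fun r = ⟨C r, 0, 0, 0⟩ := rfl
  rw [h]
  ext1 <;> simp [bracket_re, bracket_imI, bracket_imJ, bracket_imK]

/-- The pre-Courant algebroid over a point given by the bracket `{x, y} = {ξ, η} = 1` and the
function `x²η - xyξ`. -/
noncomputable def preCourant : PreCourantAlgebroid.{0, 0} 0 Pt where
  F := coordinates.bundle
  P := poisson
  Θ := fun _ => theta
  Θ_mem _ _ := theta_mem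
  almost U f hf := by
    obtain ⟨f0, h0, f1, h1, rfl⟩ := Submodule.mem_sup.1 hf
    refine funext fun y => ?_
    obtain ⟨r0, e0⟩ := eq_of_weight_zero (h0 y trivial)
    obtain ⟨r1, e1⟩ := eq_of_weight_zero (h1 y trivial)
    have h : (f0 + f1 : U → Fun) y = algebraMap ℝ Fun (r0 + r1) := by
      rw [map_add, ← e0, ← e1]; rfl
    exact (congrArg (bracket (bracket theta theta)) h).trans (bracket_algebraMap _ _)

end Darboux

namespace Darboux

open MvPolynomial

/-! ### The sub-Dirac structure `y = η = 0` -/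

/-- Polynomials in the even variable `x`. -/
abbrev SubEven : Type := MvPolynomial (Fin 1) ℝ

/-- The functions `a.fst + a.snd ξ` of an even variable `x` and an odd variable `ξ`. -/
abbrev SubFun : Type := TrivSqZeroExt SubEven SubEven

/-- The functions of weight `i.1` and parity `i.2`, where both variables have weight one. -/
def subGr (i : ℕ × ZMod 2) : Submodule ℝ SubFun where
  carrier := {a | (HasWeight 0 i.1 a.fst ∧ HasWeight 1 i.1 a.snd) ∧
    (i.2 = 0 → a.snd = 0) ∧ (i.2 = 1 → a.fst = 0)}
  zero_mem' := ⟨⟨.zero, .zero⟩, fun _ => rfl, fun _ => rfl⟩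
  add_mem' {a b} ha hb := ⟨⟨ha.1.1.add hb.1.1, ha.1.2.add hb.1.2⟩,
    fun h => by rw [TrivSqZeroExt.snd_add, ha.2.1 h, hb.2.1 h, add_zero],
    fun h => by rw [TrivSqZeroExt.fst_add, ha.2.2 h, hb.2.2 h, add_zero]⟩
  smul_mem' r a ha := ⟨⟨ha.1.1.smul r, ha.1.2.smul r⟩,
    fun h => by rw [TrivSqZeroExt.snd_smul, ha.2.1 h, smul_zero],
    fun h => by rw [TrivSqZeroExt.fst_smul, ha.2.2 h, smul_zero]⟩

theorem mem_subGr_even {w : ℕ} {a : SubFun} : a ∈ subGr (w, 0) ↔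
    a.snd = 0 ∧ HasWeight 0 w a.fst := by
  refine ⟨fun h => ⟨h.2.1 rfl, h.1.1⟩, fun ⟨h1, h2⟩ => ?_⟩
  exact ⟨⟨h2, by rw [h1]; exact .zero⟩, fun _ => h1, fun h => absurd h zero_ne_one⟩

theorem mem_subGr_odd {w : ℕ} {a : SubFun} : a ∈ subGr (w, 1) ↔
    a.fst = 0 ∧ HasWeight 1 w a.snd := by
  refine ⟨fun h => ⟨h.2.2 rfl, h.1.2⟩, fun ⟨h1, h2⟩ => ?_⟩
  exact ⟨⟨by rw [h1]; exact .zero, h2⟩, fun h => absurd h one_ne_zero, fun _ => h1⟩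

/-- The projection to the functions of given weight and parity. -/
noncomputable def subProj (i : ℕ × ZMod 2) : SubFun →ₗ[ℝ] SubFun :=
  if i.2 = 0 then
    { toFun := fun a => TrivSqZeroExt.inl (weightProj 0 i.1 a.fst)
      map_add' := fun a b => by ext1 <;> simp
      map_smul' := fun r a => by ext1 <;> simp }
  else
    { toFun := fun a => TrivSqZeroExt.inr (weightProj 1 i.1 a.snd)
      map_add' := fun a b => by ext1 <;> simp
      map_smul' := fun r a => by ext1 <;> simp }

theorem subProj_even (w : ℕ) (a : SubFun) :
    subProj (w, 0) a = TrivSqZeroExt.inl (weightProj 0 w a.fst) := by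
  rw [subProj, if_pos rfl]; rfl

theorem subProj_odd (w : ℕ) (a : SubFun) :
    subProj (w, 1) a = TrivSqZeroExt.inr (weightProj 1 w a.snd) := by
  rw [subProj, if_neg one_ne_zero]; rfl

/-- The bigraded algebra of functions of `x` and `ξ`. -/
noncomputable def subAlgebra : BigradedAlgebra where
  R := SubFun
  gr := subGr
  one_mem := mem_subGr_even.2 ⟨rfl, by simpa using HasWeight.C 1⟩
  mul_mem {i j a b} ha hb := by
    obtain ⟨w, p⟩ := i
    obtain ⟨w', q⟩ := j
    rw [Prod.mk_add_mk]
    rcases ZMod.eq_zero_or_one p with rfl | rfl <;> rcases ZMod.eq_zero_or_one q with rfl | rfl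
    · rw [mem_subGr_even] at ha hb
      rw [add_zero, mem_subGr_even, TrivSqZeroExt.fst_mul, TrivSqZeroExt.snd_mul, ha.1, hb.1]
      exact ⟨by simp, by simpa using ha.2.mul hb.2⟩
    · rw [mem_subGr_even] at ha
      rw [mem_subGr_odd] at hb
      rw [zero_add, mem_subGr_odd, TrivSqZeroExt.fst_mul, TrivSqZeroExt.snd_mul, ha.1, hb.1]
      exact ⟨by simp, by simpa using ha.2.mul hb.2⟩
    · rw [mem_subGr_even] at hb
      rw [mem_subGr_odd] at ha
      rw [add_zero, mem_subGr_odd, TrivSqZeroExt.fst_mul, TrivSqZeroExt.snd_mul, ha.1, hb.1]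
      exact ⟨by simp, by simpa using ha.2.mul hb.2⟩
    · rw [mem_subGr_odd] at ha hb
      rw [ZMod.self_add_self, mem_subGr_even, TrivSqZeroExt.fst_mul, TrivSqZeroExt.snd_mul, ha.1,
        hb.1]
      exact ⟨by simp, by simpa using HasWeight.zero⟩
  supercomm {i j a b} ha hb := by
    obtain ⟨w, p⟩ := i
    obtain ⟨w', q⟩ := j
    rcases ZMod.eq_zero_or_one p with rfl | rfl
    · rw [zero_mul, sgn_zero, one_smul, mul_comm]
    rcases ZMod.eq_zero_or_one q with rfl | rfl
    · rw [mul_zero, sgn_zero, one_smul, mul_comm]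
    rw [mem_subGr_odd] at ha hb
    ext1 <;> simp [ha.1, hb.1]
  proj := subProj
  proj_of_mem {i a} ha := by
    obtain ⟨w, p⟩ := i
    rcases ZMod.eq_zero_or_one p with rfl | rfl
    · rw [mem_subGr_even] at ha
      rw [subProj_even, weightProj_of_hasWeight ha.2]
      exact TrivSqZeroExt.ext rfl ha.1.symm
    · rw [mem_subGr_odd] at ha
      rw [subProj_odd, weightProj_of_hasWeight ha.2]
      exact TrivSqZeroExt.ext ha.1.symm rfl
  proj_of_mem_ne {i j a} ha hne := by
    obtain ⟨w, p⟩ := i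
    obtain ⟨w', q⟩ := j
    rcases ZMod.eq_zero_or_one p with rfl | rfl <;> rcases ZMod.eq_zero_or_one q with rfl | rfl
    · rw [mem_subGr_even] at ha
      rw [subProj_even, weightProj_of_hasWeight_ne ha.2 fun h => hne (by rw [h])]
      rfl
    · rw [mem_subGr_odd] at ha
      rw [subProj_even, ha.1, map_zero]
      rfl
    · rw [mem_subGr_even] at ha
      rw [subProj_odd, ha.1, map_zero]
      rfl
    · rw [mem_subGr_odd] at ha
      rw [subProj_odd, weightProj_of_hasWeight_ne ha.2 fun h => hne (by rw [h])]
      rfl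
  iSup_gr := by
    rw [eq_top_iff]
    intro a _
    rw [← TrivSqZeroExt.inl_fst_add_inr_snd_eq a]
    refine add_mem ?_ ?_
    · refine linearMap_mem (TrivSqZeroExt.inlAlgHom ℝ SubEven SubEven).toLinearMap _
        (fun m r => ?_) a.fst
      exact Submodule.mem_iSup_of_mem (m.degree + 0, 0)
        (mem_subGr_even.2 ⟨rfl, .monomial m r 0⟩)
    · refine linearMap_mem ((TrivSqZeroExt.inrHom SubEven SubEven).restrictScalars ℝ) _
        (fun m r => ?_) a.snd
      exact Submodule.mem_iSup_of_mem (m.degree + 1, 1)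
        (mem_subGr_odd.2 ⟨rfl, .monomial m r 1⟩)

/-- The exponents of the monomials in the variables `x` and `ξ`, the second of which is odd. -/
noncomputable def subExponents : ((Fin 1 →₀ ℕ) ⊕ (Fin 1 →₀ ℕ)) ≃
    {m : Fin 2 → ℕ // ∀ j, (![0, 1] : Fin 2 → ZMod 2) j = 1 → m j ≤ 1} where
  toFun := Sum.elim
    (fun m => ⟨![m 0, 0], fun j hj => by
      fin_cases j
      · exact absurd hj (by decide)
      · exact zero_le_one⟩)
    (fun m => ⟨![m 0, 1], fun j hj => by
      fin_cases j
      · exact absurd hj (by decide)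
      · exact le_rfl⟩)
  invFun m := if m.1 1 = 0 then Sum.inl (Finsupp.single 0 (m.1 0))
    else Sum.inr (Finsupp.single 0 (m.1 0))
  left_inv := by
    rintro (m | m)
    · exact congrArg Sum.inl (Finsupp.unique_ext (by simp))
    · exact congrArg Sum.inr (Finsupp.unique_ext (by simp))
  right_inv m := by
    have h := m.2 1 rfl
    refine Subtype.ext (funext fun j => ?_)
    dsimp only
    split_ifs with h0
    · fin_cases j
      · simp
      · exact h0.symm
    · fin_cases j
      · simp
      · change 1 = m.1 1; omega

/-- The coordinate functions `x` and `ξ`. -/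
noncomputable def subVar : Fin 2 → SubFun := ![TrivSqZeroExt.inl (X 0), TrivSqZeroExt.inr 1]

/-- The components of a function of `x` and `ξ`. -/
noncomputable def subEquiv : (SubEven × SubEven) ≃ₗ[ℝ] SubFun where
  toFun a := TrivSqZeroExt.inl a.1 + TrivSqZeroExt.inr a.2
  invFun a := (a.fst, a.snd)
  map_add' a b := by ext1 <;> simp
  map_smul' r a := by ext1 <;> simp
  left_inv a := by simp
  right_inv a := TrivSqZeroExt.inl_fst_add_inr_snd_eq a

/-- The monomials in `x` and `ξ` as a basis of the functions. -/
noncomputable def subMonomialBasis :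
    Module.Basis {m : Fin 2 → ℕ // ∀ j, (![0, 1] : Fin 2 → ZMod 2) j = 1 → m j ≤ 1} ℝ SubFun :=
  (((MvPolynomial.basisMonomials (Fin 1) ℝ).prod (MvPolynomial.basisMonomials (Fin 1) ℝ)).map
    subEquiv).reindex subExponents

theorem subMonomialBasis_apply (m) :
    subMonomialBasis m = (List.ofFn fun j => subVar j ^ m.1 j).prod := by
  obtain ⟨m, rfl⟩ := subExponents.surjective m
  rw [subMonomialBasis, Module.Basis.reindex_apply, Equiv.symm_apply_apply,
    Module.Basis.map_apply]
  have hm (m : Fin 1 →₀ ℕ) : (monomial m (1 : ℝ) : SubEven) = X 0 ^ m 0 := by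
    rw [MvPolynomial.monomial_eq, C_1, one_mul, Finsupp.prod_fintype _ _ fun i => pow_zero _,
      Fin.prod_univ_one]
  rcases m with m | m
  · rw [Module.Basis.prod_apply]
    simp [List.ofFn_succ, subExponents, subVar, subEquiv, hm]
  · rw [Module.Basis.prod_apply]
    simp [List.ofFn_succ, subExponents, subVar, subEquiv, hm]
    ext1 <;> simp

/-- The coordinates `x` and `ξ`. -/
noncomputable def subCoordinates : subAlgebra.Coordinates where
  r := 2
  wt _ := 1
  par := ![0, 1]
  wt_pos _ := one_ne_zero
  wt_le _ := one_le_two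
  gen := subVar
  gen_mem j := by
    have h1 : HasWeight 1 1 (1 : SubEven) := by simpa using HasWeight.monomial (0 : Fin 1 →₀ ℕ) 1 1
    fin_cases j
    · exact mem_subGr_even.2 ⟨rfl, .X 0⟩
    · exact mem_subGr_odd.2 ⟨rfl, h1⟩
  basis := subMonomialBasis
  basis_eq := subMonomialBasis_apply

/-- Restriction of polynomials to the line `y = 0`. -/
noncomputable def evenRestrict : Even →ₐ[ℝ] SubEven := aeval ![X 0, 0]

theorem evenRestrict_X_zero : evenRestrict (X 0) = X 0 := by simp [evenRestrict]

theorem evenRestrict_X_one : evenRestrict (X 1) = 0 := by simp [evenRestrict]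

theorem evenRestrict_C (r : ℝ) : evenRestrict (C r) = C r := by
  simp [evenRestrict, algebraMap_eq]

theorem evenRestrict_rename (f : SubEven) : evenRestrict (rename (fun _ => 0) f) = f := by
  rw [evenRestrict, aeval_rename]
  have : (![X 0, 0] : Fin 2 → SubEven) ∘ (fun _ : Fin 1 => 0) = X := by
    funext j
    rw [Subsingleton.elim j 0]
    rfl
  rw [this, aeval_X_left_apply]

theorem evenRestrict_pderiv (f : Even) :
    evenRestrict (pderiv 0 f) = pderiv 0 (evenRestrict f) := by
  induction f using MvPolynomial.induction_on with
  | C a => rw [pderiv_C, map_zero, evenRestrict_C, pderiv_C]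
  | add p q hp hq => rw [map_add, map_add, map_add, map_add, hp, hq]
  | mul_X p i hp =>
    rw [pderiv_mul, map_add, map_mul, map_mul, map_mul, pderiv_mul, hp]
    fin_cases i <;> simp [evenRestrict]

theorem evenRestrict_hasWeight {c w : ℕ} {f : Even} (hf : HasWeight c w f) :
    HasWeight c w (evenRestrict f) := by
  rw [f.as_sum, map_sum]
  refine Finset.sum_induction _ (HasWeight c w) (fun _ _ => .add) .zero fun m hm => ?_
  have hm := hf m (mem_support_iff.1 hm)
  have h : evenRestrict (monomial m (coeff m f)) = C (coeff m f) * (X 0 ^ m 0 * 0 ^ m 1) := by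
    rw [evenRestrict, aeval_monomial, Finsupp.prod_fintype _ _ fun i => pow_zero _,
      Fin.prod_univ_two]
    rfl
  rw [h]
  by_cases h1 : m 1 = 0
  · rw [h1, pow_zero, mul_one, X_pow_eq_monomial, C_mul_monomial]
    refine (HasWeight.monomial _ _ c).cast ?_
    rw [Finsupp.degree_single]
    rw [Finsupp.degree_eq_sum, Fin.sum_univ_two, h1] at hm
    omega
  · rw [zero_pow h1, mul_zero, mul_zero]
    exact .zero

/-- Restriction of functions to `y = η = 0`. -/
noncomputable def restrict : Fun →ₐ[ℝ] SubFun where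
  toFun a := TrivSqZeroExt.inl (evenRestrict a.re) + TrivSqZeroExt.inr (evenRestrict a.imI)
  map_one' := by ext1 <;> simp
  map_mul' a b := by ext1 <;> simp
  map_zero' := by ext1 <;> simp
  map_add' a b := by ext1 <;> simp
  commutes' r := by
    have h : algebraMap ℝ Fun r = ⟨C r, 0, 0, 0⟩ := rfl
    rw [h]
    ext1
    · simp; rfl
    · simp; rfl

theorem restrict_fst (a : Fun) : (restrict a).fst = evenRestrict a.re := by
  simp [restrict]

theorem restrict_snd (a : Fun) : (restrict a).snd = evenRestrict a.imI := by
  simp [restrict]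

theorem restrict_mem {i : ℕ × ZMod 2} {a : Fun} (ha : a ∈ gr i) : restrict a ∈ subGr i := by
  refine ⟨?_, fun h => ?_, fun h => ?_⟩
  · rw [restrict_fst, restrict_snd]
    exact ⟨evenRestrict_hasWeight ha.1.1, evenRestrict_hasWeight ha.1.2.1⟩
  · rw [restrict_snd, (ha.2.1 h).1, map_zero]
  · rw [restrict_fst, (ha.2.2 h).1, map_zero]

theorem restrict_surjective : Function.Surjective restrict := fun b => by
  refine ⟨⟨rename (fun _ => 0) b.fst, rename (fun _ => 0) b.snd, 0, 0⟩, TrivSqZeroExt.ext ?_ ?_⟩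
  · rw [restrict_fst, evenRestrict_rename]
  · rw [restrict_snd, evenRestrict_rename]

theorem restrict_eq_zero {a : Fun} :
    restrict a = 0 ↔ evenRestrict a.re = 0 ∧ evenRestrict a.imI = 0 := by
  rw [TrivSqZeroExt.ext_iff, restrict_fst, restrict_snd]
  rfl

/-- The submanifold `y = η = 0`. -/
noncomputable def subbundle : GradedSubbundle coordinates.bundle 0 Pt where
  D := subCoordinates.bundle
  i := ContinuousMap.id Pt
  isEmbedding := Topology.IsEmbedding.id
  pull U :=
    { toFun := fun (a : U → Fun) (y : U) => restrict (a y)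
      map_one' := funext fun _ => map_one restrict
      map_mul' := fun a b => funext fun y => map_mul restrict (a y) (b y)
      map_zero' := funext fun _ => map_zero restrict
      map_add' := fun a b => funext fun y => map_add restrict (a y) (b y)
      commutes' := fun r => funext fun _ => restrict.commutes r }
  pull_mem ha y _ := restrict_mem (ha y trivial)
  pull_res _ _ := rfl
  surj V b y hy := by
    choose a ha using fun z => restrict_surjective (b z)
    exact ⟨V, le_rfl, a, hy, funext ha⟩

end Darboux

namespace BigradedSheaf

variable {X : Type u} [TopologicalSpace X] {F : BigradedSheaf.{u, v} X} {V : Opens X}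

theorem supercomm_iSup {p : ZMod 2} {i : ℕ × ZMod 2} {a b : F.A V}
    (ha : a ∈ ⨆ k : ℕ, F.gr V (k, p)) (hb : b ∈ F.gr V i) :
    a * b = sgn (p * i.2) • (b * a) := by
  refine Submodule.iSup_induction (fun k : ℕ => F.gr V (k, p))
    (motive := fun a => a * b = sgn (p * i.2) • (b * a)) ha (fun k a ha => F.supercomm ha hb)
    (by simp) fun a a' ha ha' => ?_
  rw [add_mul, ha, ha', mul_add, smul_add]

theorem VectorField.app_one {U : Opens X} {q : ZMod 2} (δ : F.VectorField U q) (hV : V ≤ U) :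
    δ.app V hV 1 = 0 := by
  have h := δ.leibniz hV 1 (F.one_mem V)
  simpa using h

end BigradedSheaf

namespace Darboux

open MvPolynomial

/-- Tangency of Hamiltonian vector fields to the sub-supermanifold `y = η = 0` may be checked
pointwise. -/
theorem hamTangent_of_bracket {W : Opens Pt} (a : W → Fun)
    (h : ∀ y, ∀ g, restrict g = 0 → restrict (bracket (a y) g) = 0) :
    subbundle.HamTangent poisson a := fun _ hV g hg =>
  funext fun y => h ⟨y.1, hV y.2⟩ (g y) (congrFun hg y)

theorem restrict_bracket_theta {g : Fun} (hg : restrict g = 0) :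
    restrict (bracket theta g) = 0 := by
  rw [restrict_eq_zero] at hg ⊢
  rw [bracket_re, bracket_imI]
  simp only [map_add, map_sub, map_mul, evenRestrict_pderiv, hg]
  simp [theta, evenRestrict_X_zero, evenRestrict_X_one]

theorem var_mem (j : Fin 4) : var j ∈ gr (1, (![0, 0, 1, 1] : Fin 4 → ZMod 2) j) :=
  coordinates.gen_mem j

/-- A coordinate as a function on an open subset of the base. -/
noncomputable def varOn (W : Opens Pt) (j : Fin 4) : coordinates.bundle.A W := fun _ => var j

/-- Restriction of functions over `W` to `y = η = 0`. -/
noncomputable def pullOn (W : Opens Pt) : coordinates.bundle.A W →ₐ[ℝ] subbundle.D.A W :=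
  subbundle.pull W

theorem pullOn_mem {W : Opens Pt} {i : ℕ × ZMod 2} {a : coordinates.bundle.A W}
    (ha : a ∈ coordinates.bundle.gr W i) : pullOn W a ∈ subbundle.D.gr W i :=
  subbundle.pull_mem ha

theorem varOn_mem (W : Opens Pt) (j : Fin 4) :
    varOn W j ∈ coordinates.bundle.gr W (1, (![0, 0, 1, 1] : Fin 4 → ZMod 2) j) :=
  fun _ _ => var_mem j

theorem restrict_var_one : restrict (var 1) = 0 := by
  rw [restrict_eq_zero]
  exact ⟨evenRestrict_X_one, map_zero _⟩

theorem restrict_var_three : restrict (var 3) = 0 := by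
  rw [restrict_eq_zero]
  exact ⟨map_zero _, map_zero _⟩

theorem pullOn_varOn_one (W : Opens Pt) : pullOn W (varOn W 1) = 0 :=
  funext fun _ => restrict_var_one

theorem pullOn_varOn_three (W : Opens Pt) : pullOn W (varOn W 3) = 0 :=
  funext fun _ => restrict_var_three

theorem br_varOn (W : Opens Pt) (s t : Fin 4) :
    poisson.br W (varOn W s) (varOn W t) = algebraMap ℝ _ (coordMatrix s t) :=
  funext fun _ => bracket_var s t

theorem br_algebraMap (W : Opens Pt) (a : coordinates.bundle.A W) (r : ℝ) :
    poisson.br W a (algebraMap ℝ _ r) = 0 :=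
  funext fun y => bracket_algebraMap (a y) r

/-- The coordinates `x`, `y`, `ξ`, `η` as a chart. -/
noncomputable def chart : BigradedSheaf.Chart 0 coordinates.bundle.toBigradedSheaf 2 :=
  coordinates.chart

/-- The vector fields on `y = η = 0` are combinations of the restrictions of
`∂/∂x = -{y, •}` and `∂/∂ξ = {η, •}`. -/
theorem vectorField_eq {V W : Opens Pt} {q : ZMod 2} (δ : subbundle.D.VectorField V q)
    (h : W ≤ V) (a : coordinates.bundle.A W) :
    δ.app W h (pullOn W a)
      = -δ.app W h (pullOn W (varOn W 0)) * pullOn W (poisson.br W (varOn W 1) a)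
        + δ.app W h (pullOn W (varOn W 2)) * pullOn W (poisson.br W (varOn W 3) a) := by
  rcases isEmpty_or_nonempty W with hW | ⟨⟨w⟩⟩
  · exact funext fun z => (hW.false z).elim
  have hxmem := δ.app_parity h (pullOn_mem (varOn_mem W 0))
  have hξmem := δ.app_parity h (pullOn_mem (varOn_mem W 2))
  generalize hA : δ.app W h (pullOn W (varOn W 0)) = A at hxmem ⊢
  generalize hB : δ.app W h (pullOn W (varOn W 2)) = B at hξmem ⊢
  induction a using BigradedSheaf.homog_induction with
  | h0 => simp only [map_zero, mul_zero, add_zero]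
  | hadd a b ha hb => simp only [map_add, mul_add, ha, hb]; abel
  | hom i a ha =>
  refine BigradedSheaf.Chart.graded_induction (c := chart) (hV := le_top)
    (P := fun i a => δ.app W h (pullOn W a)
      = -A * pullOn W (poisson.br W (varOn W 1) a) + B * pullOn W (poisson.br W (varOn W 3) a))
    (fun i => by simp only [map_zero, mul_zero, add_zero])
    (fun i a b ha hb => by simp only [map_add, mul_add, ha, hb]; abel)
    (fun i j a b hi hj ha hb => ?_) (fun f => ?_) (fun l => ?_) ha
  · have hb1 := poisson.leibniz b (varOn_mem W 1) hi
    have hb3 := poisson.leibniz b (varOn_mem W 3) hi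
    have hpa := pullOn_mem hi
    have c1 := BigradedSheaf.supercomm_iSup hxmem hpa
    have c3 := BigradedSheaf.supercomm_iSup hξmem hpa
    rw [map_mul, δ.leibniz h _ hpa, ha, hb, hb1, hb3]
    simp only [map_add, map_mul, map_smul, mul_add, add_mul, ← mul_assoc, neg_mul, mul_smul_comm,
      c1, c3, smul_mul_assoc, mul_neg]
    generalize i.2 = p
    rcases ZMod.eq_zero_or_one p with rfl | rfl <;> rcases ZMod.eq_zero_or_one q with rfl | rfl <;>
      simp [ZMod.self_add_self] <;> abel
  · obtain ⟨r, hr⟩ : ∃ r : ℝ, chart.emb W le_top f = algebraMap ℝ _ r :=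
      ⟨f w, funext fun z => by rw [Subsingleton.elim z w]; rfl⟩
    rw [hr, br_algebraMap, br_algebraMap, AlgHom.commutes, Algebra.algebraMap_eq_smul_one,
      map_smul, δ.app_one, smul_zero, map_zero, mul_zero, mul_zero, add_zero]
  · have h (j : Fin 4) : δ.app W h (pullOn W (varOn W j))
        = -A * pullOn W (poisson.br W (varOn W 1) (varOn W j))
          + B * pullOn W (poisson.br W (varOn W 3) (varOn W j)) := by
      rw [br_varOn, br_varOn, AlgHom.commutes, AlgHom.commutes]
      fin_cases j
      · simpa [coordMatrix] using hA
      · refine (congrArg (δ.app W _) (pullOn_varOn_one W)).trans ?_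
        simp [coordMatrix]
      · simpa [coordMatrix] using hB
      · refine (congrArg (δ.app W _) (pullOn_varOn_three W)).trans ?_
        simp [coordMatrix]
    exact h l

/-- The isotropy of the sub-supermanifold `y = η = 0`. -/
theorem isIsotropic_subbundle : subbundle.IsIsotropic poisson := by
  intro V q δ y hy
  refine ⟨V, le_rfl, 2, ![varOn V 1, varOn V 3],
    ![-δ.app V le_rfl (pullOn V (varOn V 0)), δ.app V le_rfl (pullOn V (varOn V 2))], hy,
    fun t => ?_, fun W h a => ?_⟩
  · fin_cases t
    · exact pullOn_varOn_one V
    · exact pullOn_varOn_three V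
  · have hx : subbundle.D.res h (-δ.app V le_rfl (pullOn V (varOn V 0)))
        = -δ.app W h (pullOn W (varOn W 0)) := by
      rw [map_neg, ← δ.app_res le_rfl h]; rfl
    have hξ : subbundle.D.res h (δ.app V le_rfl (pullOn V (varOn V 2)))
        = δ.app W h (pullOn W (varOn W 2)) := (δ.app_res le_rfl h _).symm
    rw [Fin.sum_univ_two]
    refine (vectorField_eq δ h a).trans ?_
    rw [← hx, ← hξ]
    rfl

/-- The sub-Dirac structure `y = η = 0`. -/
noncomputable def subDirac : SubDirac preCourant 0 Pt where
  toGradedSubbundle := subbundle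
  isotropic := isIsotropic_subbundle
  tangent := hamTangent_of_bracket _ fun _ _ => restrict_bracket_theta

end Darboux

/-! ### Failure of the Jacobi identity -/

/-- An odd section `s` satisfies `[s, [s, s]] = 0`, as the Jacobi identity and skew symmetry give
`[s, [s, s]] = -2 [s, [s, s]]`. -/
theorem AlmostLieAlgebroid.Jacobi.bracket_bracket_self {Y : Type u} [TopologicalSpace Y]
    {B : BigradedSheaf.{u, v} Y} {L : AlmostLieAlgebroid.{u, v, w} B} (hJ : L.Jacobi)
    {V : Opens Y} {s : L.Sec V} (hs : s ∈ L.par V 1) :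
    L.bracket V s (L.bracket V s s) = 0 := by
  have hjac := hJ V 1 1 s hs s hs s
  rw [L.skew (L.bracket_mem hs hs) hs, ZMod.self_add_self, zero_mul, sgn_zero, one_smul, mul_one,
    sgn_one, neg_one_smul] at hjac
  have h3 : (3 : ℝ) • L.bracket V s (L.bracket V s s) = 0 := by
    rw [← sub_eq_zero.2 hjac]
    module
  exact (smul_eq_zero.1 h3).resolve_left three_ne_zero

namespace Darboux

open MvPolynomial

theorem eq_top_of_mem {V : Opens Pt} {y : Pt} (hy : y ∈ V) : V = ⊤ :=
  top_le_iff.1 fun z _ => Subsingleton.elim y z ▸ hy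

theorem subFun_eq_of_weight_zero {p : ZMod 2} {a : SubFun} (ha : a ∈ subGr (0, p)) :
    ∃ r : ℝ, a = algebraMap ℝ SubFun r := by
  obtain ⟨⟨h0, h1⟩, -⟩ := ha
  refine ⟨coeff 0 a.fst, TrivSqZeroExt.ext (h0.eq_C) (h1.eq_zero one_pos)⟩

theorem subFun_algebraMap_eq_zero {r : ℝ} (h : algebraMap ℝ SubFun r = 0) : r = 0 :=
  C_injective (Fin 1) ℝ ((congrArg TrivSqZeroExt.fst h).trans (map_zero C).symm)

/-- The `x`-derivative of the even part of a function of `x` and `ξ`. -/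
noncomputable def evenDeriv : SubFun →ₗ[ℝ] SubFun where
  toFun a := TrivSqZeroExt.inl (pderiv 0 a.fst)
  map_add' a b := by rw [TrivSqZeroExt.fst_add, map_add, TrivSqZeroExt.inl_add]
  map_smul' r a := by
    rw [TrivSqZeroExt.fst_smul, Derivation.map_smul, TrivSqZeroExt.inl_smul]; rfl

theorem evenDeriv_mem {q : ZMod 2} {a : SubFun} (ha : a ∈ subGr (1, q)) :
    evenDeriv a ∈ subGr (0, q) := by
  rcases ZMod.eq_zero_or_one q with rfl | rfl
  · exact mem_subGr_even.2 ⟨rfl, (ha.1.1.pderiv 0).cast rfl⟩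
  · have h : evenDeriv a = 0 := by
      change TrivSqZeroExt.inl (pderiv 0 a.fst) = 0
      rw [(mem_subGr_odd.1 ha).1, map_zero, TrivSqZeroExt.inl_zero]
    rw [h]
    exact zero_mem _

theorem evenDeriv_mul {q : ZMod 2} {f : SubFun} (hf : f ∈ subGr (0, q)) (a : SubFun) :
    evenDeriv (f * a) = f * evenDeriv a := by
  obtain ⟨r, rfl⟩ := subFun_eq_of_weight_zero hf
  rw [← Algebra.smul_def, ← Algebra.smul_def, map_smul]

/-- The functional on functions of weight one which takes the coefficient of `x`. -/
noncomputable def coeffX (V : Opens Pt) :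
    subbundle.D.weightPart V 1 →ₗ[ℝ] subbundle.D.base V where
  toFun α := ⟨fun y => evenDeriv ((α.1 : V → SubFun) y), by
    obtain ⟨a, ha, b, hb, h⟩ := Submodule.mem_sup.1 α.2
    refine Submodule.mem_sup.2 ⟨fun y => evenDeriv ((a : V → SubFun) y),
      fun y _ => evenDeriv_mem (ha y trivial), fun y => evenDeriv ((b : V → SubFun) y),
      fun y _ => evenDeriv_mem (hb y trivial), ?_⟩
    rw [← h]
    exact funext fun y => (map_add evenDeriv (a y) (b y)).symm⟩
  map_add' α β := Subtype.ext (funext fun y =>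
    map_add evenDeriv ((α.1 : V → SubFun) y) ((β.1 : V → SubFun) y))
  map_smul' r α := Subtype.ext (funext fun y => map_smul evenDeriv r ((α.1 : V → SubFun) y))

theorem coeffX_mem (V : Opens Pt) (q : ZMod 2) (α : subbundle.D.weightPart V 1)
    (hα : α.1 ∈ subbundle.D.gr V (1, q)) :
    (coeffX V α).1 ∈ subbundle.D.gr V (0, 1 + 1 + q) := by
  rw [ZMod.self_add_self, zero_add]
  exact fun y _ => evenDeriv_mem (hα y trivial)

theorem coeffX_linear (V : Opens Pt) (q : ZMod 2) (f : subbundle.D.base V)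
    (α β : subbundle.D.weightPart V 1) (hf : f.1 ∈ subbundle.D.gr V (0, q))
    (hβ : β.1 = f.1 * α.1) :
    coeffX V β = sgn ((1 + 1) * q) • (f * coeffX V α) := by
  rw [ZMod.self_add_self, zero_mul, sgn_zero, one_smul]
  refine Subtype.ext (funext fun y => ?_)
  exact (congrArg evenDeriv (congrFun hβ y)).trans (evenDeriv_mul (hf y trivial) _)

theorem neg_y_mem : -var 1 ∈ gr (1, 0) := neg_mem (var_mem 1)

theorem eta_mem : (2 : ℝ) • var 3 ∈ gr (1, 1) := Submodule.smul_mem _ _ (var_mem 3)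

theorem bracket_theta_neg_y : bracket theta (-var 1) = ⟨0, X 1, -(X 0 + X 0), 0⟩ := by
  ext1 <;> simp [bracket_re, bracket_imI, bracket_imJ, bracket_imK, theta, var, two_mul]

theorem bracket_bracket_theta_neg_y :
    bracket (bracket theta (-var 1)) (-var 1) = (2 : ℝ) • var 3 := by
  rw [bracket_theta_neg_y, two_smul]
  ext1 <;> simp [bracket_re, bracket_imI, bracket_imJ, bracket_imK, var]

theorem bracket_bracket_theta_eta :
    bracket (bracket theta (-var 1)) ((2 : ℝ) • var 3) = (2 : ℝ) • var 1 := by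
  rw [bracket_theta_neg_y, two_smul, two_smul]
  ext1 <;> simp [bracket_re, bracket_imI, bracket_imJ, bracket_imK, var, mul_add]

theorem restrict_bracket_neg_y (a : Fun) : restrict (bracket (-var 1) a)
    = evenDeriv (restrict a) + TrivSqZeroExt.inr (pderiv 0 (restrict a).snd) := by
  change _ = TrivSqZeroExt.inl (pderiv 0 (restrict a).fst) + _
  rw [restrict_fst, restrict_snd, ← evenRestrict_pderiv, ← evenRestrict_pderiv]
  ext1
  · simp [restrict_fst, bracket_re, var]
  · simp [restrict_snd, bracket_imI, var]

theorem restrict_bracket_neg_y_of_weight_one {p q : ZMod 2} {a b : Fun} (ha : a ∈ gr (1, p))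
    (hb : b ∈ gr (1, q)) : restrict (bracket (-var 1) (a + b)) = evenDeriv (restrict (a + b)) := by
  have h : pderiv 0 (restrict (a + b)).snd = 0 :=
    (((restrict_mem ha).1.2.add (restrict_mem hb).1.2).pderiv 0).eq_zero one_lt_two |> fun h => by
      rwa [map_add, TrivSqZeroExt.snd_add]
  rw [restrict_bracket_neg_y, h, TrivSqZeroExt.inr_zero, add_zero]

theorem hamTangent_neg_y (W : Opens Pt) : subbundle.HamTangent poisson (W := W) (fun _ => -var 1) :=
  hamTangent_of_bracket _ fun _ g hg => by
    rw [restrict_bracket_neg_y, hg]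
    simp

variable {L : AlmostLieAlgebroid.{0, 0, 0} subDirac.D.toBigradedSheaf}
  {e : LinearFunctionsPairing L.toSuperVectorBundle}

/-- A function with constant coefficients, over the whole base. -/
def const (a : Fun) : preCourant.F.A ⊤ := fun _ => a

theorem const_mem {i : ℕ × ZMod 2} {a : Fun} (ha : a ∈ gr i) : const a ∈ preCourant.F.gr ⊤ i :=
  fun _ _ => ha

/-- Over a point the correction terms `{Θ, f}` vanish, so the bracket is induced by the
Courant--Dorfman pre-bracket. -/
theorem represents_bracket (h : subDirac.IsInduced L e) {p q : ZMod 2} {a b : Fun}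
    (ha : a ∈ gr (1, p)) (hb : b ∈ gr (1, q)) {s t : L.Sec (Opens.comap subDirac.i ⊤)}
    (hs : s ∈ L.par _ (p + 1)) (ht : t ∈ L.par _ (q + 1))
    (has : subDirac.Represents e (const a) s) (hbt : subDirac.Represents e (const b) t) :
    subDirac.Represents e (const (sgn p • bracket (bracket theta a) b)) (L.bracket _ s t) := by
  obtain ⟨V, hV, hy, f, hf, hf0, -, hrep⟩ :=
    h.bracket_eq ⊤ p q _ (const_mem ha) _ (const_mem hb) s hs t ht has hbt 0 trivial
  obtain rfl := eq_top_of_mem hy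
  have hfz : f = 0 := funext fun y => by
    obtain ⟨r, hr⟩ := eq_of_weight_zero (hf y trivial)
    have h0 : restrict (f y) = 0 := congrFun hf0 y
    rw [hr, AlgHom.commutes] at h0
    rw [hr, subFun_algebraMap_eq_zero h0, map_zero]
    rfl
  rw [hfz, map_zero, add_zero, L.res_id] at hrep
  exact hrep

theorem exists_represents_neg_y (e : LinearFunctionsPairing L.toSuperVectorBundle) :
    ∃ s ∈ L.par (Opens.comap subDirac.i ⊤) (0 + 1), subDirac.Represents e (const (-var 1)) s := by
  obtain ⟨s, ⟨hs, hse⟩, -⟩ := e.perfect (Opens.comap subDirac.i ⊤) 1 (coeffX _)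
    (coeffX_mem _) (coeffX_linear _)
  refine ⟨s, by rwa [zero_add], hamTangent_neg_y ⊤, fun V hV a α ha hα => funext fun y => ?_⟩
  obtain rfl := eq_top_of_mem (V := V) y.2
  rw [L.res_id, hse]
  obtain ⟨a₀, ha₀, a₁, ha₁, rfl⟩ := Submodule.mem_sup.1 ha
  refine (congrArg evenDeriv (congrFun hα y)).trans ?_
  exact (restrict_bracket_neg_y_of_weight_one (ha₀ y trivial) (ha₁ y trivial)).symm

/-- The section given by `2y` does not vanish, as `{2y, x} = -2`. -/
theorem ne_zero_of_represents {s : L.Sec (Opens.comap subDirac.i ⊤)}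
    (hs : subDirac.Represents e (const ((2 : ℝ) • var 1)) s) : s ≠ 0 := by
  rintro rfl
  have h := hs.2 ⊤ le_rfl (const (var 0))
    ⟨_, subDirac.pull_weightPart (Submodule.mem_sup_left (const_mem (var_mem 0)))⟩
    (Submodule.mem_sup_left (const_mem (var_mem 0))) rfl
  rw [map_zero, map_zero, LinearMap.zero_apply] at h
  have h0 : (0 : SubFun) = restrict (bracket ((2 : ℝ) • var 1) (var 0)) :=
    congrFun h (⟨0, trivial⟩ : (⊤ : Opens Pt))
  rw [LinearMap.map_smul₂, bracket_var, map_smul, AlgHom.commutes] at h0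
  have h1 := subFun_algebraMap_eq_zero ((smul_eq_zero.1 h0.symm).resolve_left two_ne_zero)
  norm_num [coordMatrix] at h1

/-- The Jacobi identity fails on the section `s` given by `-y`: the sections `[s, s]` and
`[s, [s, s]]` are given by `2η` and `2y`. -/
theorem not_jacobi (h : subDirac.IsInduced L e) : ¬ L.Jacobi := by
  intro hJ
  obtain ⟨s, hs, hrep⟩ := exists_represents_neg_y e
  have h1 := represents_bracket h neg_y_mem neg_y_mem hs hs hrep hrep
  rw [sgn_zero, one_smul, bracket_bracket_theta_neg_y] at h1
  have hs' : s ∈ L.par _ 1 := by rwa [zero_add] at hs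
  have h2 := represents_bracket h neg_y_mem eta_mem hs (L.bracket_mem hs' hs') hrep h1
  rw [sgn_zero, one_smul, bracket_bracket_theta_eta] at h2
  exact ne_zero_of_represents h2 (hJ.bracket_bracket_self hs')

end Darboux
theorem mainTheorem2 :
    (∀ (n : ℕ) (X : Type u) [TopologicalSpace X] [ChartedSpace (EuclideanSpace ℝ (Fin n)) X]
      [IsManifold (𝓡 n) ∞ X] [T2Space X] [SigmaCompactSpace X]
      (C : PreCourantAlgebroid.{u, v} n X)
      (m : ℕ) (Y : Type u) [TopologicalSpace Y] [ChartedSpace (EuclideanSpace ℝ (Fin m)) Y]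
      [IsManifold (𝓡 m) ∞ Y] [T2Space Y] [SigmaCompactSpace Y]
      (S : SubDirac C m Y),
      ∃ (L : AlmostLieAlgebroid.{u, v, v} S.D.toBigradedSheaf)
        (e : LinearFunctionsPairing L.toSuperVectorBundle), S.IsInduced L e) ∧
    (∃ (C : PreCourantAlgebroid.{0, 0} 0 (EuclideanSpace ℝ (Fin 0)))
      (S : SubDirac C 0 (EuclideanSpace ℝ (Fin 0))),
      ∀ (L : AlmostLieAlgebroid.{0, 0, 0} S.D.toBigradedSheaf)
        (e : LinearFunctionsPairing L.toSuperVectorBundle), S.IsInduced L e → ¬ L.Jacobi) := by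
  exact ⟨fun n X _ _ _ _ _ C m Y _ _ _ _ _ S => S.exists_isInduced,
    Darboux.preCourant, Darboux.subDirac, fun L e h => Darboux.not_jacobi h⟩
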